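/- Let $n\ge 3$, let $\Omega\subset\mathbb R^n$ be open and bounded with Lipschitz boundary, and put $Q=\Omega\times(0,\infty)$. Let $p\in C^1(\overline Q)$ satisfy $p_t\ge 0$ and $$2<p^-\le p(\cdot)\le p^+<\frac{2(n-1)}{n-2},\qquad p^-:=\operatorname*{ess\,inf}_Q p,\quad p^+:=\operatorname*{ess\,sup}_Q p .$$ Let $k\in C^1[0,\infty)$ satisfy $k(0)>0$, $k'(t)\ge 0$ for all $t\ge 0$, and $k_\infty:=\lim_{t\to\infty}k(t)<\infty$. Let $0\neq u_0\in W^{1,2}_0(\Omega)$, and consider the problem $$(P)\qquad \frac{u_t}{|x|^2}-\Delta u_t-\Delta u=k(t)\,|u|^{p(x,t)-2}u\ \text{ in }\Omega\times(0,T),\qquad u=0\ \text{ on }\partial\Omega\times(0,T),\qquad u(\cdot,0)=u_0 .$$ A weak solution of $(P)$ on $[0,T]$ is a function $u\in C([0,T];L^2(\Omega))\cap L^\infty(0,T;W^{1,2}_0(\Omega))$ with $u(0)=u_0$ whose weak time derivative $u_t$ satisfies $u_t(t)\in W_0^{1,2}(\Omega)$ for a.e. $t\in[0,T]$ and $\int_0^T\!\int_\Omega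 |u_t|^2/|x|^2\,dx\,dt<\infty$, and such that for a.e. $t\in[0,T]$ and all $\varphi\in W^{1,2}_0(\Omega)$ $$\int_\Omega \frac{u_t\,\varphi}{|x|^2}\,dx+\int_\Omega\nabla u_t\cdot\nabla\varphi\,dx+\int_\Omega\nabla u\cdot\nabla\varphi\,dx=k(t)\int_\Omega|u|^{p(x,t)-2}u\,\varphi\,dx .$$ The maximal existence time $T^*\in(0,\infty]$ of $u$ is the largest time such that $u$ exists as a weak solution on $[0,T]$ for every $T\in(0,T^*)$. If $T^*<\infty$, then $u$ is said to blow up at $T^*$ if $\limsup_{t\to (T^*)^-}\|u(t)/|x|\|_{L^2(\Omega)}^2=\infty$. For $v\in W^{1,2}_0(\Omega)$ and $t\ge 0$ let $$J(v,t)=\frac12\int_\Omega|\nabla v|^2\,dx-k(t)\int_\Omega\frac{|v|^{p(x,t)}}{p(x,t)}\,dx,\qquad E(v,t)=J(v,t)+k_\infty\int_\Omega\frac{dx}{p(x,t)} .$$ Theorem. Suppose $E(u_0,0)<0$, and let $u$ be a weak solution of $(P)$ (on some $[0,T]$, $T>0$, continued to its maximal existence time). Then $u$ blows up at a finite time $T^*$,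 and $$T^*\le\frac{\big\|u_0/|x|\big\|_{L^2(\Omega)}^2+\|\nabla u_0\|_{L^2(\Omega)}^2}{p^-\,(2-p^-)\,E(u_0,0)} .$$ -/

import Mathlib

open MeasureTheory Set Filter Topology
open scoped ENNReal NNReal ContDiff Gradient

namespace PseudoParabolic

/-- `ℝⁿ` with its Euclidean norm. -/
abbrev E (n : ℕ) : Type := EuclideanSpace ℝ (Fin n)

/-- `Ω` has Lipschitz boundary: near each boundary point, for a suitable unit direction `ν`, the set
`Ω` is the part strictly above the graph of a Lipschitz function `γ` of the orthogonal projection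
of the point onto the hyperplane `ν^⊥`. -/
def HasLipschitzBoundary {n : ℕ} (Ω : Set (E n)) : Prop :=
  ∀ x₀ ∈ frontier Ω, ∃ (ν : E n) (r : ℝ) (K : ℝ≥0) (γ : E n → ℝ),
    ‖ν‖ = 1 ∧ 0 < r ∧ LipschitzWith K γ ∧
      Ω ∩ Metric.ball x₀ r =
        {y | γ (y - (inner ℝ ν y : ℝ) • ν) < inner ℝ ν y} ∩ Metric.ball x₀ r

/-- The space-time cylinder `Q = Ω × (0, ∞)`. -/
def cylinder {n : ℕ} (Ω : Set (E n)) : Set (E n × ℝ) := Ω ×ˢ Ioi 0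

/-- `p⁻`, the essential infimum of the exponent over `Q`. -/
noncomputable def pMinus {n : ℕ} (Ω : Set (E n)) (p : E n → ℝ → ℝ) : ℝ :=
  essInf (fun z : E n × ℝ => p z.1 z.2) (volume.restrict (cylinder Ω))

/-- `p⁺`, the essential supremum of the exponent over `Q`. -/
noncomputable def pPlus {n : ℕ} (Ω : Set (E n)) (p : E n → ℝ → ℝ) : ℝ :=
  essSup (fun z : E n × ℝ => p z.1 z.2) (volume.restrict (cylinder Ω))

/-- The assumptions on the exponent: `p ∈ C¹(closure Q)`, `p_t ≥ 0` and
`2 < p⁻ ≤ p ≤ p⁺ < 2(n-1)/(n-2)`. -/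
structure IsAdmissibleExponent {n : ℕ} (Ω : Set (E n)) (p : E n → ℝ → ℝ) : Prop where
  contDiffOn : ContDiffOn ℝ 1 (fun z : E n × ℝ => p z.1 z.2) (closure (cylinder Ω))
  deriv_nonneg : ∀ x ∈ Ω, ∀ t, 0 < t → 0 ≤ deriv (p x) t
  two_lt : 2 < pMinus Ω p
  le_and_le : ∀ z ∈ closure (cylinder Ω), pMinus Ω p ≤ p z.1 z.2 ∧ p z.1 z.2 ≤ pPlus Ω p
  lt_crit : pPlus Ω p < 2 * ((n : ℝ) - 1) / ((n : ℝ) - 2)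

/-- The assumptions on the coefficient: `k ∈ C¹[0, ∞)`, `k(0) > 0`, `k' ≥ 0`, and `k(t)` tends to the
finite limit `kInf` as `t → ∞`. -/
structure IsAdmissibleCoefficient (k : ℝ → ℝ) (kInf : ℝ) : Prop where
  contDiffOn : ContDiffOn ℝ 1 k (Ici 0)
  pos : 0 < k 0
  deriv_nonneg : ∀ t, 0 ≤ t → 0 ≤ derivWithin k (Ici 0) t
  tendsto : Tendsto k atTop (𝓝 kInf)

/-- `L²(Ω)`. -/
abbrev L2 {n : ℕ} (Ω : Set (E n)) : Type := Lp ℝ 2 (volume.restrict Ω)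

/-- `L²(Ω; ℝⁿ)`. -/
abbrev L2Vec {n : ℕ} (Ω : Set (E n)) : Type := Lp (E n) 2 (volume.restrict Ω)

/-- The pairs `(φ, ∇φ)` with `φ ∈ C_c^∞(Ω)`, as elements of `L²(Ω) × L²(Ω; ℝⁿ)`. -/
def testPairs {n : ℕ} (Ω : Set (E n)) : Set (L2 Ω × L2Vec Ω) :=
  {v | ∃ φ : E n → ℝ, ContDiff ℝ ∞ φ ∧ HasCompactSupport φ ∧ tsupport φ ⊆ Ω ∧
    (v.1 : E n → ℝ) =ᵐ[volume.restrict Ω] φ ∧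
    (v.2 : E n → E n) =ᵐ[volume.restrict Ω] ∇ φ}

/-- `W₀^{1,2}(Ω)`, the closure of `C_c^∞(Ω)` in `W^{1,2}(Ω)`. A function `u ∈ W^{1,2}(Ω)` is
identified with the pair `(u, ∇u)` of the function and its weak gradient; limits of test pairs are
again of this form, and the product topology is that of the `W^{1,2}` norm. (The set of test pairs
is a linear subspace, so the span only serves to bundle it.) -/
noncomputable def H10 {n : ℕ} (Ω : Set (E n)) : Submodule ℝ (L2 Ω × L2Vec Ω) :=
  (Submodule.span ℝ (testPairs Ω)).topologicalClosure

/-- The `L²` class of an element of `W₀^{1,2}(Ω)`. -/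
def toL2 {n : ℕ} {Ω : Set (E n)} (v : H10 Ω) : L2 Ω := v.1.1

/-- The element of `W₀^{1,2}(Ω)` as a function (a representative). -/
noncomputable def fn {n : ℕ} {Ω : Set (E n)} (v : H10 Ω) : E n → ℝ := (v.1.1 : E n → ℝ)

/-- The weak gradient (a representative). -/
noncomputable def grad {n : ℕ} {Ω : Set (E n)} (v : H10 Ω) : E n → E n := (v.1.2 : E n → E n)

/-- `‖v/|x|‖²` in `L²(Ω)`, as a value in `[0, ∞]`. -/
noncomputable def hardyNormSq {n : ℕ} {Ω : Set (E n)} (v : H10 Ω) : ℝ≥0∞ :=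
  ∫⁻ x in Ω, ENNReal.ofReal (fn v x ^ 2 / ‖x‖ ^ 2)

/-- `‖∇v‖²` in `L²(Ω)`. -/
noncomputable def gradNormSq {n : ℕ} {Ω : Set (E n)} (v : H10 Ω) : ℝ :=
  ∫ x in Ω, ‖grad v x‖ ^ 2

/-- `J(v,t) = ½ ∫ |∇v|² - k(t) ∫ |v|^{p(x,t)} / p(x,t)`. -/
noncomputable def energyJ {n : ℕ} {Ω : Set (E n)} (p : E n → ℝ → ℝ) (k : ℝ → ℝ)
    (v : H10 Ω) (t : ℝ) : ℝ :=
  1 / 2 * gradNormSq v - k t * ∫ x in Ω, 1 / p x t * |fn v x| ^ p x t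

/-- The modified energy `E(v,t) = J(v,t) + k_∞ ∫ 1/p(x,t)`. -/
noncomputable def energyE {n : ℕ} {Ω : Set (E n)} (p : E n → ℝ → ℝ) (k : ℝ → ℝ) (kInf : ℝ)
    (v : H10 Ω) (t : ℝ) : ℝ :=
  energyJ p k v t + kInf * ∫ x in Ω, 1 / p x t

/-- `w` is the weak derivative of the `X`-valued function `f` on the interval `(0,T)`. -/
def IsWeakTimeDeriv {X : Type*} [NormedAddCommGroup X] [NormedSpace ℝ X] (T : ℝ)
    (f w : ℝ → X) : Prop :=
  ∀ η : ℝ → ℝ, ContDiff ℝ ∞ η → HasCompactSupport η → tsupport η ⊆ Ioo 0 T →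
    ∫ t in Ioo 0 T, deriv η t • f t = - ∫ t in Ioo 0 T, η t • w t

/-- `w` is the time derivative `u_t` of `u` on `(0,T)`: it has values in `W₀^{1,2}(Ω)`,
`∫₀ᵀ ∫_Ω |w|²/|x|² < ∞` (so `w` is integrable in time with values in `L²(Ω)`, as `Ω` is bounded),
and `w` is the weak derivative of `u` as an `L²(Ω)`-valued function. -/
structure IsTimeDeriv {n : ℕ} {Ω : Set (E n)} (T : ℝ) (u w : ℝ → H10 Ω) : Prop where
  aestronglyMeasurable : AEStronglyMeasurable w (volume.restrict (Ioo 0 T))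
  hardy_lt_top : ∫⁻ t in Ioo 0 T, hardyNormSq (w t) < ⊤
  weakDeriv : IsWeakTimeDeriv T (fun t => toL2 (u t)) (fun t => toL2 (w t))

/-- The identity
`(u_t/|x|², φ) + (∇u_t, ∇φ) + (∇u, ∇φ) = k(t) (|u|^{p(x,t)-2} u, φ)` at time `t`, for all
`φ ∈ W₀^{1,2}(Ω)`; here `u`, `w` are the values of the solution and its time derivative at `t`. -/
def WeakForm {n : ℕ} {Ω : Set (E n)} (p : E n → ℝ → ℝ) (k : ℝ → ℝ) (t : ℝ) (u w : H10 Ω) : Prop :=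
  ∀ φ : H10 Ω,
    (∫ x in Ω, fn w x / ‖x‖ ^ 2 * fn φ x) + (∫ x in Ω, inner ℝ (grad w x) (grad φ x))
        + (∫ x in Ω, inner ℝ (grad u x) (grad φ x))
      = k t * ∫ x in Ω, (|fn u x| ^ (p x t - 2) * fn u x) * fn φ x

/-- `u` is a weak solution on `[0,T]` with initial datum `u₀`:
`u ∈ C([0,T]; L²(Ω)) ∩ L^∞(0,T; W₀^{1,2}(Ω))`, `u(0) = u₀`, and `u` has a time derivative with which
the weak form holds for a.e. `t`. Only the values of `u` on `[0,T]` matter. -/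
structure IsWeakSolution {n : ℕ} {Ω : Set (E n)} (p : E n → ℝ → ℝ) (k : ℝ → ℝ) (u₀ : H10 Ω)
    (T : ℝ) (u : ℝ → H10 Ω) : Prop where
  initial : u 0 = u₀
  continuousOn : ContinuousOn (fun t => toL2 (u t)) (Icc 0 T)
  aestronglyMeasurable : AEStronglyMeasurable u (volume.restrict (Ioo 0 T))
  essBounded : ∃ C : ℝ, ∀ᵐ t ∂volume.restrict (Ioo 0 T), ‖u t‖ ≤ C
  equation : ∃ w : ℝ → H10 Ω, IsTimeDeriv T u w ∧
    ∀ᵐ t ∂volume.restrict (Ioo 0 T), WeakForm p k t (u t) (w t)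

/-- `Tmax ∈ (0,∞]` is the maximal existence time of `u`: `u` is a weak solution on `[0,T]` for every
`T ∈ (0,Tmax)`, and `Tmax` is the largest time with this property, even if one is allowed to
continue `u` beyond `[0,Tmax)` in an arbitrary way. -/
def IsMaximalExistenceTime {n : ℕ} {Ω : Set (E n)} (p : E n → ℝ → ℝ) (k : ℝ → ℝ) (u₀ : H10 Ω)
    (u : ℝ → H10 Ω) (Tmax : ℝ≥0∞) : Prop :=
  0 < Tmax ∧
  (∀ T : ℝ, 0 < T → ENNReal.ofReal T < Tmax → IsWeakSolution p k u₀ T u) ∧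
  ∀ (T : ℝ) (v : ℝ → H10 Ω), Tmax < ENNReal.ofReal T → IsWeakSolution p k u₀ T v →
    ¬ ∀ t : ℝ, 0 ≤ t → ENNReal.ofReal t < Tmax → v t = u t

/-- `u` blows up at the finite time `Tmax`: `limsup ‖u(t)/|x|‖² = ∞` as `t → Tmax` from the left. -/
def BlowsUpAt {n : ℕ} {Ω : Set (E n)} (u : ℝ → H10 Ω) (Tmax : ℝ) : Prop :=
  limsup (fun t => hardyNormSq (u t)) (𝓝[<] Tmax) = ⊤

end PseudoParabolic

/-!
Let `L(v) = ‖v/|x|‖² + ‖∇v‖²`. By Hardy's inequality, `√L` is an equivalent norm on `W₀^{1,2}(Ω)`,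
and it comes from an inner product, here through the embedding `energyEmb` of `W₀^{1,2}(Ω)` into a
Hilbert space. The Riesz theorem inverts `1/|x|² - Δ` in it, and so the problem becomes an ordinary
differential equation `u' = Φ(t, u)` in `W₀^{1,2}(Ω)`, with the field `Admissible.field`. Since the
exponent stays below `2(n-1)/(n-2) = 2 + 2/(n-2)`, Hölder's and Sobolev's inequalities make `Φ`
locally Lipschitz (`Admissible.exists_field_lipschitz`). A weak solution is continuously
differentiable with values in `W₀^{1,2}(Ω)`, and weak solutions are the same as solutions of this
equation (`Admissible.isODESol_of_isWeakSolution`, `Admissible.isWeakSolution_of_isODESol`).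

The bound on the existence time comes from the concavity method. Let `F = -E(u(t), t)`. Testing with
`u` gives `L' ≥ 2 p⁻ F` (`Admissible.neg_energyE_le_inner`). Testing with `u_t` gives `F' ≥ L(u_t)`;
the terms with `p_t` and `k'` have the right sign because of the summand `k_∞ ∫ 1/p`, as
`a ↦ (k |v|^a - k_∞)/a` increases when `k ≤ k_∞`. This is only proved in the integrated form
`F ≥ G` with `G(0) = F(0)` and `G' = L(u_t)` (`Admissible.IsODESolIco.exists_le_neg_energyE`), by
comparing increments: convexity of `|a|^p` and monotonicity in time then suffice, and nothing has to
be differentiated under the integral. As `(L')² ≤ 4 L(u) L(u_t)`, the function `G L^{-p⁻/2}` does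
not decrease, whence `L' ≥ c L^{p⁻/2}`, which cannot hold longer than the stated time
(`levine_time_bound`).

It remains to see that `‖u/|x|‖` itself, and not only `L`, is unbounded near the end of the maximal
interval. Suppose that it is bounded. Then the part of the nonlinearity with exponents below
`r = 2 + 3/n` is of lower order, and `L' ≥ 2r(F - C)`
(`Admissible.exists_neg_energyE_le_inner`), while interpolation between `L²` and `L^{2*}` bounds `F`
by a power of `L` less than `r/2` (`Admissible.exists_neg_energyE_le_rpow`); it is here that
`p⁺ < 2(n-1)/(n-2)` is compared with `r`. If `G` exceeds `C` at some time, then the concavity method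
gives `G - C ≥ c L^{r/2}` from then on, and the two bounds keep `L` bounded. If it never does, then
`∫ L(u_t)` is bounded, and so is `L` (`Admissible.IsODESolIco.exists_normSq_le`). A bounded solution
of an equation with locally Lipschitz field continues beyond the end of its interval
(`Admissible.IsODESolIco.exists_extension`), against maximality. That a maximal continuation exists
is Zorn's lemma (`Admissible.exists_maximal_continuation`).
-/

namespace PseudoParabolic

variable {n : ℕ} {Ω : Set (E n)}

/-! ### Test functions and the space `W₀^{1,2}` -/

/-- `φ ∈ C_c^∞(Ω)`. -/
structure IsTest (Ω : Set (E n)) (φ : E n → ℝ) : Prop where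
  contDiff : ContDiff ℝ ∞ φ
  hasCompactSupport : HasCompactSupport φ
  tsupport_subset : tsupport φ ⊆ Ω

theorem IsTest.differentiable {φ : E n → ℝ} (h : IsTest Ω φ) : Differentiable ℝ φ :=
  h.contDiff.differentiable (by simp)

theorem gradient_eq_zero_of_notMem_tsupport {φ : E n → ℝ} {x : E n} (hx : x ∉ tsupport φ) :
    ∇ φ x = 0 := by
  have : fderiv ℝ φ x = 0 := by
    by_contra h
    exact hx (support_fderiv_subset ℝ h)
  simp [gradient, this]

theorem norm_gradient (φ : E n → ℝ) (x : E n) : ‖∇ φ x‖ = ‖fderiv ℝ φ x‖ := by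
  simp [gradient]

theorem IsTest.continuous_gradient {φ : E n → ℝ} (h : IsTest Ω φ) : Continuous (∇ φ) :=
  (LinearIsometryEquiv.continuous _).comp (h.contDiff.continuous_fderiv (by simp))

theorem IsTest.hasCompactSupport_gradient {φ : E n → ℝ} (h : IsTest Ω φ) :
    HasCompactSupport (∇ φ) :=
  HasCompactSupport.intro h.hasCompactSupport fun _ hx => gradient_eq_zero_of_notMem_tsupport hx

theorem mem_testPairs {z : L2 Ω × L2Vec Ω} : z ∈ testPairs Ω ↔ ∃ φ : E n → ℝ, IsTest Ω φ ∧
    (z.1 : E n → ℝ) =ᵐ[volume.restrict Ω] φ ∧ (z.2 : E n → E n) =ᵐ[volume.restrict Ω] ∇ φ :=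
  ⟨fun ⟨φ, h1, h2, h3, h4⟩ => ⟨φ, ⟨h1, h2, h3⟩, h4⟩, fun ⟨φ, h, h4⟩ => ⟨φ, h.1, h.2, h.3, h4⟩⟩

theorem coe_span_testPairs (Ω : Set (E n)) :
    (Submodule.span ℝ (testPairs Ω) : Set (L2 Ω × L2Vec Ω)) = testPairs Ω := by
  refine subset_antisymm (fun z hz => ?_) Submodule.subset_span
  induction hz using Submodule.span_induction with
  | mem z hz => exact hz
  | zero =>
    refine mem_testPairs.2 ⟨0, ⟨contDiff_const, HasCompactSupport.zero, by simp⟩, ?_, ?_⟩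
    · exact Lp.coeFn_zero _ _ _
    · have : ∇ (0 : E n → ℝ) = 0 := by
        exact funext fun x => gradient_fun_const (𝕜 := ℝ) x (0 : ℝ)
      rw [this]
      exact Lp.coeFn_zero _ _ _
  | add z w _ _ hz hw =>
    obtain ⟨φ, hφ, h1, h2⟩ := mem_testPairs.1 hz
    obtain ⟨ψ, hψ, h3, h4⟩ := mem_testPairs.1 hw
    refine mem_testPairs.2 ⟨φ + ψ, ⟨hφ.1.add hψ.1, hφ.2.add hψ.2, (tsupport_add φ ψ).trans
      (union_subset hφ.3 hψ.3)⟩, ?_, ?_⟩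
    · exact (Lp.coeFn_add _ _).trans (h1.add h3)
    · have : ∇ (φ + ψ) = ∇ φ + ∇ ψ := by
        ext1 x
        simp [gradient, fderiv_add (hφ.differentiable x) (hψ.differentiable x)]
      rw [this]
      exact (Lp.coeFn_add _ _).trans (h2.add h4)
  | smul c z _ hz =>
    obtain ⟨φ, hφ, h1, h2⟩ := mem_testPairs.1 hz
    refine mem_testPairs.2 ⟨c • φ, ⟨hφ.1.const_smul c, hφ.2.smul_left (f := fun _ => c),
      (tsupport_smul_subset_right (fun _ => c) φ).trans hφ.3⟩, ?_, ?_⟩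
    · exact (Lp.coeFn_smul _ _).trans (h1.const_smul c)
    · have : ∇ (c • φ) = c • ∇ φ := by
        ext1 x
        simp [gradient, fderiv_const_smul (hφ.differentiable x)]
      rw [this]
      exact (Lp.coeFn_smul _ _).trans (h2.const_smul c)

theorem exists_seq_isTest (v : H10 Ω) : ∃ φ : ℕ → E n → ℝ, (∀ m, IsTest Ω (φ m)) ∧
    (∀ᵐ x ∂volume.restrict Ω, Tendsto (fun m => φ m x) atTop (𝓝 (fn v x))) ∧
    Tendsto (fun m => eLpNorm (∇ (φ m)) 2 (volume.restrict Ω)) atTop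
      (𝓝 (eLpNorm (grad v) 2 (volume.restrict Ω))) := by
  have hv : v.1 ∈ closure (testPairs Ω) := by
    have : v.1 ∈ (Submodule.span ℝ (testPairs Ω)).topologicalClosure := v.2
    rw [← SetLike.mem_coe, Submodule.topologicalClosure_coe, coe_span_testPairs] at this
    exact this
  obtain ⟨z, hz, hzlim⟩ := mem_closure_iff_seq_limit.1 hv
  have h1 : Tendsto (fun m => (z m).1) atTop (𝓝 v.1.1) :=
    (continuous_fst.tendsto _).comp hzlim
  have h2 : Tendsto (fun m => (z m).2) atTop (𝓝 v.1.2) :=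
    (continuous_snd.tendsto _).comp hzlim
  obtain ⟨ns, hns, hae⟩ := (tendstoInMeasure_of_tendsto_Lp h1).exists_seq_tendsto_ae
  choose φ hφ hφ1 hφ2 using fun m => mem_testPairs.1 (hz m)
  refine ⟨fun m => φ (ns m), fun m => hφ _, ?_, ?_⟩
  · filter_upwards [hae, ae_all_iff.2 hφ1] with x hx hx1
    simp only [← hx1]
    exact hx
  · have h3 := ((continuous_enorm.tendsto _).comp h2).comp hns.tendsto_atTop
    simp only [Lp.enorm_def, Function.comp_def] at h3
    refine h3.congr fun m => ?_
    exact eLpNorm_congr_ae (hφ2 _)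

/-- An inequality `‖a φ‖_{L^q} ≤ C ‖∇φ‖_{L²}` for test functions extends to `W₀^{1,2}(Ω)`. -/
theorem eLpNorm_mul_fn_le {a : E n → ℝ} (ha : Measurable a) {q : ℝ≥0∞} {C : ℝ≥0}
    (h : ∀ φ : E n → ℝ, IsTest Ω φ → eLpNorm (fun x => a x * φ x) q (volume.restrict Ω) ≤
      C * eLpNorm (∇ φ) 2 (volume.restrict Ω)) (v : H10 Ω) :
    eLpNorm (fun x => a x * fn v x) q (volume.restrict Ω) ≤
      C * eLpNorm (grad v) 2 (volume.restrict Ω) := by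
  obtain ⟨φ, hφ, hae, hlim⟩ := exists_seq_isTest v
  have h1 : eLpNorm (fun x => a x * fn v x) q (volume.restrict Ω) ≤
      liminf (fun m => eLpNorm (fun x => a x * φ m x) q (volume.restrict Ω)) atTop := by
    refine Lp.eLpNorm_lim_le_liminf_eLpNorm (fun m => ?_) _ ?_
    · exact (ha.mul (hφ m).1.continuous.measurable).aestronglyMeasurable
    · filter_upwards [hae] with x hx using hx.const_mul _
  refine h1.trans ?_
  have h2 : Tendsto (fun m => (C : ℝ≥0∞) * eLpNorm (∇ (φ m)) 2 (volume.restrict Ω)) atTop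
      (𝓝 (C * eLpNorm (grad v) 2 (volume.restrict Ω))) :=
    ENNReal.Tendsto.const_mul hlim (Or.inr ENNReal.coe_ne_top)
  rw [← h2.liminf_eq]
  exact liminf_le_liminf (Eventually.of_forall fun m => h _ (hφ m))

theorem IsTest.eLpNorm_restrict_gradient {φ : E n → ℝ} (h : IsTest Ω φ) :
    eLpNorm (∇ φ) 2 (volume.restrict Ω) = eLpNorm (∇ φ) 2 volume := by
  apply eLpNorm_restrict_eq_of_support_subset
  intro x hx
  by_contra hxΩ
  exact hx (gradient_eq_zero_of_notMem_tsupport fun h' => hxΩ (h.3 h'))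

/-! ### The Sobolev inequality -/

/-- The critical Sobolev exponent `2* = 2n/(n-2)`. -/
noncomputable def sobolevExp (n : ℕ) : ℝ := 2 * n / (n - 2)

theorem sobolevExp_gt_two (hn : 3 ≤ n) : 2 < sobolevExp n := by
  have : (3 : ℝ) ≤ n := by exact_mod_cast hn
  rw [sobolevExp, lt_div_iff₀ (by linarith)]
  linarith

/-- The constant in the Sobolev inequality `‖v‖_{2*} ≤ C ‖∇v‖₂`. -/
noncomputable def sobolevConst (n : ℕ) : ℝ≥0 :=
  SNormLESNormFDerivOfEqConst ℝ (volume : Measure (E n)) 2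

theorem eLpNorm_sobolev_le (hn : 3 ≤ n) (v : H10 Ω) :
    eLpNorm (fn v) (ENNReal.ofReal (sobolevExp n)) (volume.restrict Ω) ≤
      sobolevConst n * eLpNorm (grad v) 2 (volume.restrict Ω) := by
  have h3 : (3 : ℝ) ≤ n := by exact_mod_cast hn
  have := eLpNorm_mul_fn_le (a := fun _ => 1) (C := sobolevConst n)
    (q := ENNReal.ofReal (sobolevExp n)) measurable_const (fun φ hφ => ?_) v
  · simpa using this
  simp only [one_mul]
  rw [hφ.eLpNorm_restrict_gradient]
  refine (eLpNorm_mono_measure _ Measure.restrict_le_self).trans ?_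
  have hle := eLpNorm_le_eLpNorm_fderiv_of_eq (μ := (volume : Measure (E n))) (u := φ) (p := 2)
    (p' := (sobolevExp n).toNNReal) (hφ.1.of_le (by exact_mod_cast le_top)) hφ.2 (by norm_num)
    (by simp; omega) ?_
  · refine hle.trans_eq ?_
    rw [sobolevConst]
    congr 1
    refine eLpNorm_congr_norm_ae (Eventually.of_forall fun x => (norm_gradient φ x).symm)
  · rw [Real.coe_toNNReal _ (by linarith [sobolevExp_gt_two hn]), sobolevExp]
    simp only [finrank_euclideanSpace, Fintype.card_fin]
    have : (n : ℝ) - 2 ≠ 0 := by linarith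
    push_cast
    field_simp

end PseudoParabolic

namespace PseudoParabolic

variable {n : ℕ} {Ω : Set (E n)}

/-! ### The Hardy inequality -/

/-- The regularization `1 / (|x|² + ε)` of the Hardy weight. -/
noncomputable def hardyWeight (n : ℕ) (ε : ℝ) (x : E n) : ℝ := (‖x‖ ^ 2 + ε)⁻¹

theorem hardyWeight_pos {ε : ℝ} (hε : 0 < ε) (x : E n) : 0 < hardyWeight n ε x := by
  unfold hardyWeight; positivity

theorem contDiff_hardyWeight {ε : ℝ} (hε : 0 < ε) : ContDiff ℝ 1 (hardyWeight n ε) :=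
  ((contDiff_norm_sq ℝ).add contDiff_const).inv fun x => by positivity

theorem fderiv_hardyWeight {ε : ℝ} (hε : 0 < ε) (x v : E n) :
    fderiv ℝ (hardyWeight n ε) x v = -(hardyWeight n ε x) ^ 2 * (2 * inner ℝ x v) := by
  have h1 : HasFDerivAt (fun x : E n => ‖x‖ ^ 2 + ε) (2 • innerSL ℝ x) x :=
    ((hasStrictFDerivAt_norm_sq x).hasFDerivAt).add_const ε
  have h2 : HasFDerivAt (hardyWeight n ε) _ x :=
    (hasDerivAt_inv (by positivity : ‖x‖ ^ 2 + ε ≠ 0)).comp_hasFDerivAt x h1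
  rw [h2.fderiv]
  simp [hardyWeight]

theorem integral_sq_mul_div_eq_zero {φ : E n → ℝ} (hφ : ContDiff ℝ 1 φ) (hc : HasCompactSupport φ)
    {ε : ℝ} (hε : 0 < ε) :
    Integrable (fun x => φ x ^ 2 * (n * hardyWeight n ε x - 2 * ‖x‖ ^ 2 * hardyWeight n ε x ^ 2)
      + 2 * φ x * hardyWeight n ε x * fderiv ℝ φ x x) ∧
    ∫ x, (φ x ^ 2 * (n * hardyWeight n ε x - 2 * ‖x‖ ^ 2 * hardyWeight n ε x ^ 2)
      + 2 * φ x * hardyWeight n ε x * fderiv ℝ φ x x) = 0 := by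
  set w := hardyWeight n ε with hw
  have hwc : ContDiff ℝ 1 w := contDiff_hardyWeight hε
  let e : Fin n → E n := fun i => EuclideanSpace.single i 1
  have hcoord : ∀ i, ContDiff ℝ 1 (fun x : E n => x i) := fun i =>
    (EuclideanSpace.proj (𝕜 := ℝ) i).contDiff
  have hg : ∀ i, ContDiff ℝ 1 (fun x : E n => x i * w x) := fun i => (hcoord i).mul hwc
  have hφ2 : ContDiff ℝ 1 (fun x => φ x ^ 2) := hφ.pow 2
  have hc2 : HasCompactSupport (fun x => φ x ^ 2) := by
    simp only [pow_two]; exact hc.mul_left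
  have hd1 : ∀ i, Continuous fun x => fderiv ℝ (fun x => φ x ^ 2) x (e i) := fun i =>
    (hφ2.continuous_fderiv (by simp)).clm_apply continuous_const
  have hd2 : ∀ i, Continuous fun x => fderiv ℝ (fun x => x i * w x) x (e i) := fun i =>
    ((hg i).continuous_fderiv (by simp)).clm_apply continuous_const
  have hi1 : ∀ i, Integrable (fun x => fderiv ℝ (fun x => φ x ^ 2) x (e i) * (x i * w x)) :=
    fun i => ((hd1 i).mul (hg i).continuous).integrable_of_hasCompactSupport
      ((hc2.fderiv_apply ℝ (e i)).mul_right)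
  have hi2 : ∀ i, Integrable (fun x => φ x ^ 2 * fderiv ℝ (fun x => x i * w x) x (e i)) :=
    fun i => (hφ2.continuous.mul (hd2 i)).integrable_of_hasCompactSupport hc2.mul_right
  have hi3 : ∀ i, Integrable (fun x => φ x ^ 2 * (x i * w x)) :=
    fun i => (hφ2.continuous.mul (hg i).continuous).integrable_of_hasCompactSupport hc2.mul_right
  have hibp := fun i => integral_mul_fderiv_eq_neg_fderiv_mul_of_integrable (hi1 i) (hi2 i) (hi3 i)
    (fun x _ => hφ2.differentiable (by simp) x) (fun x _ => (hg i).differentiable (by simp) x)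
  have hpt : ∀ x, φ x ^ 2 * (n * w x - 2 * ‖x‖ ^ 2 * w x ^ 2) + 2 * φ x * w x * fderiv ℝ φ x x =
      ∑ i, (φ x ^ 2 * fderiv ℝ (fun x => x i * w x) x (e i) +
        fderiv ℝ (fun x => φ x ^ 2) x (e i) * (x i * w x)) := by
    intro x
    have h1 : ∀ i, fderiv ℝ (fun x => x i * w x) x (e i) = w x - 2 * x i ^ 2 * w x ^ 2 := by
      intro i
      have := ((EuclideanSpace.proj (𝕜 := ℝ) i).hasFDerivAt (x := x)).mul
        (hwc.differentiable (by simp) x).hasFDerivAt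
      have h' : fderiv ℝ (fun x => x i * w x) x = _ := this.fderiv
      rw [h']
      simp only [add_apply, smul_apply, smul_eq_mul]
      rw [hw, fderiv_hardyWeight hε]
      simp [e, EuclideanSpace.inner_single_right]
      ring
    have h2 : ∀ i, fderiv ℝ (fun x => φ x ^ 2) x (e i) = 2 * φ x * fderiv ℝ φ x (e i) := by
      intro i
      have h' : fderiv ℝ (fun x => φ x ^ 2) x = _ :=
        ((hφ.differentiable (by simp) x).hasFDerivAt.pow 2).fderiv
      rw [h']
      simp
    have h3 : fderiv ℝ φ x x = ∑ i, x i * fderiv ℝ φ x (e i) := by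
      have : x = ∑ i, x i • e i := by
        simpa [e] using ((EuclideanSpace.basisFun (Fin n) ℝ).sum_repr x).symm
      have h' := congrArg (fderiv ℝ φ x) this
      rw [map_sum] at h'
      simpa using h'
    have h4 : ‖x‖ ^ 2 = ∑ i, x i ^ 2 := by
      simp [EuclideanSpace.norm_sq_eq]
    simp only [h1, h2, h3, h4, Finset.sum_add_distrib, Finset.mul_sum, Finset.sum_mul, mul_sub,
      Finset.sum_sub_distrib]
    simp only [Finset.sum_const, Finset.card_univ, Fintype.card_fin, nsmul_eq_mul]
    congr 1
    · congr 1
      ring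
    · exact Finset.sum_congr rfl fun i _ => by ring
  have hint : ∀ i, Integrable (fun x => φ x ^ 2 * fderiv ℝ (fun x => x i * w x) x (e i) +
        fderiv ℝ (fun x => φ x ^ 2) x (e i) * (x i * w x)) := fun i => (hi2 i).add (hi1 i)
  simp only [hpt]
  refine ⟨integrable_finsetSum _ fun i _ => hint i, ?_⟩
  rw [integral_finsetSum _ fun i _ => hint i]
  refine Finset.sum_eq_zero fun i _ => ?_
  rw [integral_add (hi2 i) (hi1 i), hibp i]
  ring

/-- The pointwise inequality behind Hardy's inequality: Young's inequality for the mixed term. -/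
theorem hardy_pointwise {m a W D X d : ℝ} (hm : 0 < m) (hW : 0 ≤ W)
    (hb : X ^ 2 * W ≤ 1) (hd : |d| ≤ D * X) :
    m / 2 * (a ^ 2 * W) - 2 / m * D ^ 2 ≤
      a ^ 2 * ((m + 2) * W - 2 * X ^ 2 * W ^ 2) + 2 * a * W * d := by
  have h1 : -(2 * a * W * d) ≤ 2 * |a| * W * (D * X) := by
    calc -(2 * a * W * d) ≤ |2 * a * W * d| := neg_le_abs _
      _ = 2 * |a| * W * |d| := by rw [abs_mul, abs_mul, abs_mul, abs_two, abs_of_nonneg hW]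
      _ ≤ _ := by gcongr
  have h3 : 0 ≤ m / 2 * (|a| * W * X - 2 / m * D) ^ 2 := by positivity
  have h4 : m / 2 * (|a| * W * X - 2 / m * D) ^ 2 =
      m / 2 * (|a| ^ 2 * W) * (X ^ 2 * W) + 2 / m * D ^ 2 - 2 * |a| * W * (D * X) := by
    field_simp
    ring
  rw [sq_abs] at h4
  have h5 : m / 2 * (a ^ 2 * W) * (X ^ 2 * W) ≤ m / 2 * (a ^ 2 * W) * 1 := by gcongr
  have h6 : 2 * (a ^ 2 * W) * (X ^ 2 * W) ≤ 2 * (a ^ 2 * W) * 1 := by gcongr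
  linarith

theorem integral_sq_mul_hardyWeight_le (hn : 3 ≤ n) {φ : E n → ℝ} (hφ : ContDiff ℝ 1 φ)
    (hc : HasCompactSupport φ) {ε : ℝ} (hε : 0 < ε) :
    ∫ x, φ x ^ 2 * hardyWeight n ε x ≤ (2 / ((n : ℝ) - 2)) ^ 2 * ∫ x, ‖∇ φ x‖ ^ 2 := by
  have hn' : (0 : ℝ) < n - 2 := by
    have : (3 : ℝ) ≤ n := by exact_mod_cast hn
    linarith
  set m : ℝ := n - 2 with hm
  obtain ⟨hI, h0⟩ := integral_sq_mul_div_eq_zero hφ hc hε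
  have hw : Continuous (hardyWeight n ε) := (contDiff_hardyWeight hε).continuous
  have hI1 : Integrable fun x => φ x ^ 2 * hardyWeight n ε x :=
    ((hφ.continuous.pow 2).mul hw).integrable_of_hasCompactSupport
      (by simp only [pow_two]; exact (hc.mul_left).mul_right)
  have hI2 : Integrable fun x => ‖∇ φ x‖ ^ 2 := by
    simp only [norm_gradient]
    refine ((hφ.continuous_fderiv (by simp)).norm.pow 2).integrable_of_hasCompactSupport ?_
    simp only [pow_two]
    exact (hc.fderiv ℝ).norm.mul_left
  have hle : ∫ x, (m / 2 * (φ x ^ 2 * hardyWeight n ε x) - 2 / m * ‖∇ φ x‖ ^ 2) ≤ 0 := by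
    refine le_trans (integral_mono ((hI1.const_mul _).sub (hI2.const_mul _)) hI fun x => ?_) h0.le
    have hwx := hardyWeight_pos hε x
    have hb : ‖x‖ ^ 2 * hardyWeight n ε x ≤ 1 := by
      rw [hardyWeight, ← div_eq_mul_inv, div_le_one (by positivity)]
      linarith
    have hd : |fderiv ℝ φ x x| ≤ ‖∇ φ x‖ * ‖x‖ := by
      rw [norm_gradient]; exact (fderiv ℝ φ x).le_opNorm x
    have hnm : (n : ℝ) = m + 2 := by rw [hm]; ring
    rw [hnm]
    exact hardy_pointwise hn' hwx.le hb hd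
  rw [integral_sub (hI1.const_mul _) (hI2.const_mul _), integral_const_mul, integral_const_mul]
    at hle
  have : (2 / m) ^ 2 * ∫ x, ‖∇ φ x‖ ^ 2 = 2 / m * (2 / m * ∫ x, ‖∇ φ x‖ ^ 2) := by ring
  rw [this]
  calc ∫ x, φ x ^ 2 * hardyWeight n ε x = 2 / m * (m / 2 * ∫ x, φ x ^ 2 * hardyWeight n ε x) := by
        field_simp
    _ ≤ _ := mul_le_mul_of_nonneg_left (by linarith) (by positivity)

/-- The constant in the Hardy inequality `‖v/|x|‖₂ ≤ C ‖∇v‖₂`. -/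
noncomputable def hardyConst (n : ℕ) : ℝ≥0 := (2 / ((n : ℝ) - 2)).toNNReal

theorem eLpNorm_two_sq {α F : Type*} [MeasurableSpace α] [NormedAddCommGroup F] (f : α → F)
    (μ : Measure α) : eLpNorm f 2 μ ^ 2 = ∫⁻ x, ‖f x‖ₑ ^ 2 ∂μ := by
  have := eLpNorm_nnreal_pow_eq_lintegral (f := f) (μ := μ) (p := 2) (by norm_num)
  simpa using this

theorem IsTest.eLpNorm_hardy_le (hn : 3 ≤ n) {φ : E n → ℝ} (hφ : IsTest Ω φ) :
    eLpNorm (fun x => ‖x‖⁻¹ * φ x) 2 (volume.restrict Ω) ≤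
      hardyConst n * eLpNorm (∇ φ) 2 (volume.restrict Ω) := by
  have hn' : (0 : ℝ) < n - 2 := by
    have : (3 : ℝ) ≤ n := by exact_mod_cast hn
    linarith
  rw [hφ.eLpNorm_restrict_gradient]
  refine (eLpNorm_mono_measure _ Measure.restrict_le_self).trans ?_
  rw [← ENNReal.pow_le_pow_left_iff two_ne_zero, mul_pow, eLpNorm_two_sq,
    eLpNorm_two_sq]
  have hφ1 : ContDiff ℝ 1 φ := hφ.1.of_le (by exact_mod_cast le_top)
  let ε : ℕ → ℝ := fun j => 1 / ((j : ℝ) + 1)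
  have hε : ∀ j, 0 < ε j := fun j => by positivity
  have hεlim : Tendsto ε atTop (𝓝 0) := tendsto_one_div_add_atTop_nhds_zero_nat
  have hmeas : ∀ j, Measurable fun x => ENNReal.ofReal (φ x ^ 2 * hardyWeight n (ε j) x) :=
    fun j => ((hφ1.continuous.pow 2).mul
      (contDiff_hardyWeight (hε j)).continuous).measurable.ennreal_ofReal
  have hgrad : ∫⁻ x, ‖∇ φ x‖ₑ ^ 2 = ENNReal.ofReal (∫ x, ‖∇ φ x‖ ^ 2) := by
    rw [ofReal_integral_eq_lintegral_ofReal _ (Eventually.of_forall fun x => by positivity)]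
    · refine lintegral_congr fun x => ?_
      rw [ENNReal.ofReal_pow (norm_nonneg _), ofReal_norm]
    · refine (hφ.continuous_gradient.norm.pow 2).integrable_of_hasCompactSupport ?_
      simp only [pow_two]
      exact hφ.hasCompactSupport_gradient.norm.mul_left
  calc ∫⁻ x, ‖‖x‖⁻¹ * φ x‖ₑ ^ 2
      ≤ ∫⁻ x, liminf (fun j => ENNReal.ofReal (φ x ^ 2 * hardyWeight n (ε j) x)) atTop := by
        refine lintegral_mono fun x => ?_
        rcases eq_or_ne x 0 with rfl | hx
        · simp
        have hlim : Tendsto (fun j => ENNReal.ofReal (φ x ^ 2 * hardyWeight n (ε j) x)) atTop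
            (𝓝 (ENNReal.ofReal (φ x ^ 2 * (‖x‖ ^ 2 + 0)⁻¹))) := by
          refine ENNReal.tendsto_ofReal (Tendsto.const_mul _ ?_)
          exact (tendsto_const_nhds.add hεlim).inv₀ (by simpa using hx)
        rw [hlim.liminf_eq, ← ofReal_norm, ← ENNReal.ofReal_pow (norm_nonneg _)]
        refine (congrArg _ ?_).le
        simp [mul_pow, mul_comm]
    _ ≤ liminf (fun j => ∫⁻ x, ENNReal.ofReal (φ x ^ 2 * hardyWeight n (ε j) x)) atTop :=
        lintegral_liminf_le hmeas
    _ ≤ liminf (fun _ : ℕ => (hardyConst n : ℝ≥0∞) ^ 2 * ∫⁻ x, ‖∇ φ x‖ₑ ^ 2) atTop := by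
        refine liminf_le_liminf (Eventually.of_forall fun j => ?_)
        have hI1 : Integrable fun x => φ x ^ 2 * hardyWeight n (ε j) x :=
          ((hφ1.continuous.pow 2).mul
            (contDiff_hardyWeight (hε j)).continuous).integrable_of_hasCompactSupport
            (by simp only [pow_two]; exact (hφ.2.mul_left).mul_right)
        have hnn : ∀ x, 0 ≤ φ x ^ 2 * hardyWeight n (ε j) x := fun x =>
          mul_nonneg (sq_nonneg _) (hardyWeight_pos (hε j) x).le
        rw [← ofReal_integral_eq_lintegral_ofReal hI1 (Eventually.of_forall hnn), hgrad]
        refine (ENNReal.ofReal_le_ofReal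
          (integral_sq_mul_hardyWeight_le hn hφ1 hφ.2 (hε j))).trans_eq ?_
        rw [ENNReal.ofReal_mul (by positivity), ENNReal.ofReal_pow (by positivity)]
        rfl
    _ = _ := by simp

theorem eLpNorm_hardy_le (hn : 3 ≤ n) (v : H10 Ω) :
    eLpNorm (fun x => ‖x‖⁻¹ * fn v x) 2 (volume.restrict Ω) ≤
      hardyConst n * eLpNorm (grad v) 2 (volume.restrict Ω) :=
  eLpNorm_mul_fn_le measurable_norm.inv (fun _ hφ => hφ.eLpNorm_hardy_le hn) v

end PseudoParabolic

namespace PseudoParabolic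

variable {n : ℕ} {Ω : Set (E n)}

/-! ### The Hilbert space structure given by the weighted inner product -/

instance : CompleteSpace (H10 Ω) :=
  inferInstanceAs (CompleteSpace (Submodule.span ℝ (testPairs Ω)).topologicalClosure)

/-- The inclusion `W₀^{1,2}(Ω) → L²(Ω)` as a continuous linear map. -/
noncomputable def fnMap (Ω : Set (E n)) : H10 Ω →L[ℝ] L2 Ω :=
  (ContinuousLinearMap.fst ℝ (L2 Ω) (L2Vec Ω)).comp (H10 Ω).subtypeL

/-- The weak gradient as a continuous linear map. -/
noncomputable def gradMap (Ω : Set (E n)) : H10 Ω →L[ℝ] L2Vec Ω :=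
  (ContinuousLinearMap.snd ℝ (L2 Ω) (L2Vec Ω)).comp (H10 Ω).subtypeL

theorem coe_fnMap (v : H10 Ω) : (fnMap Ω v : E n → ℝ) = fn v := rfl

theorem coe_gradMap (v : H10 Ω) : (gradMap Ω v : E n → E n) = grad v := rfl

theorem norm_eq_max (v : H10 Ω) : ‖v‖ = max ‖fnMap Ω v‖ ‖gradMap Ω v‖ := rfl

theorem memLp_fn (v : H10 Ω) : MemLp (fn v) 2 (volume.restrict Ω) := Lp.memLp _

theorem memLp_grad (v : H10 Ω) : MemLp (grad v) 2 (volume.restrict Ω) := Lp.memLp _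

theorem fn_add (v w : H10 Ω) : fn (v + w) =ᵐ[volume.restrict Ω] fn v + fn w :=
  Lp.coeFn_add v.1.1 w.1.1

theorem fn_sub (v w : H10 Ω) : fn (v - w) =ᵐ[volume.restrict Ω] fn v - fn w :=
  Lp.coeFn_sub v.1.1 w.1.1

theorem fn_smul (c : ℝ) (v : H10 Ω) : fn (c • v) =ᵐ[volume.restrict Ω] c • fn v :=
  Lp.coeFn_smul c v.1.1

theorem memLp_hardy (hn : 3 ≤ n) (v : H10 Ω) :
    MemLp (fun x => ‖x‖⁻¹ * fn v x) 2 (volume.restrict Ω) :=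
  ⟨(measurable_norm.inv.aestronglyMeasurable).mul (memLp_fn v).1,
    (eLpNorm_hardy_le hn v).trans_lt
      (ENNReal.mul_lt_top ENNReal.coe_lt_top (memLp_grad v).eLpNorm_lt_top)⟩

theorem norm_toLp_hardy_le (hn : 3 ≤ n) (v : H10 Ω) :
    ‖(memLp_hardy hn v).toLp _‖ ≤ hardyConst n * ‖gradMap Ω v‖ := by
  rw [Lp.norm_toLp, Lp.norm_def, coe_gradMap]
  have := ENNReal.toReal_mono (ENNReal.mul_lt_top ENNReal.coe_lt_top
    (memLp_grad v).eLpNorm_lt_top).ne (eLpNorm_hardy_le hn v)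
  rwa [ENNReal.toReal_mul, ENNReal.coe_toReal] at this

/-- The map `v ↦ v/|x|` from `W₀^{1,2}(Ω)` to `L²(Ω)`. -/
noncomputable def hardyMap (hn : 3 ≤ n) (Ω : Set (E n)) : H10 Ω →L[ℝ] L2 Ω :=
  LinearMap.mkContinuous
    { toFun := fun v => (memLp_hardy hn v).toLp _
      map_add' := fun v w => by
        rw [← MemLp.toLp_add]
        refine MemLp.toLp_congr _ _ ?_
        filter_upwards [fn_add v w] with x hx
        simp [hx, mul_add]
      map_smul' := fun c v => by
        rw [RingHom.id_apply, ← MemLp.toLp_const_smul]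
        refine MemLp.toLp_congr _ _ ?_
        filter_upwards [fn_smul c v] with x hx
        simp only [hx, Pi.smul_apply, smul_eq_mul]
        ring }
    (hardyConst n) fun v => (norm_toLp_hardy_le hn v).trans
      (by rw [norm_eq_max]; gcongr; exact le_max_right _ _)

theorem coe_hardyMap (hn : 3 ≤ n) (v : H10 Ω) :
    (hardyMap hn Ω v : E n → ℝ) =ᵐ[volume.restrict Ω] fun x => ‖x‖⁻¹ * fn v x :=
  (memLp_hardy hn v).coeFn_toLp

theorem gradNormSq_eq (v : H10 Ω) : gradNormSq v = ‖gradMap Ω v‖ ^ 2 := by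
  rw [← real_inner_self_eq_norm_sq, L2.inner_def, gradNormSq]
  simp only [real_inner_self_eq_norm_sq]
  rfl

theorem hardyNormSq_eq (hn : 3 ≤ n) (v : H10 Ω) :
    hardyNormSq v = ENNReal.ofReal (‖hardyMap hn Ω v‖ ^ 2) := by
  rw [ENNReal.ofReal_pow (norm_nonneg _), ofReal_norm, Lp.enorm_def, eLpNorm_two_sq, hardyNormSq]
  refine lintegral_congr_ae ?_
  filter_upwards [coe_hardyMap hn v] with x hx
  rw [hx, ← ofReal_norm, ← ENNReal.ofReal_pow (norm_nonneg _)]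
  congr 1
  simp [mul_pow, div_eq_mul_inv, mul_comm]

theorem toReal_hardyNormSq (hn : 3 ≤ n) (v : H10 Ω) :
    (hardyNormSq v).toReal = ‖hardyMap hn Ω v‖ ^ 2 := by
  rw [hardyNormSq_eq hn, ENNReal.toReal_ofReal (by positivity)]

theorem integral_grad_eq (v w : H10 Ω) :
    ∫ x in Ω, inner ℝ (grad v x) (grad w x) = inner ℝ (gradMap Ω v) (gradMap Ω w) := by
  rw [L2.inner_def]; rfl

theorem integral_hardy_eq (hn : 3 ≤ n) (v w : H10 Ω) :
    ∫ x in Ω, fn v x / ‖x‖ ^ 2 * fn w x = inner ℝ (hardyMap hn Ω v) (hardyMap hn Ω w) := by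
  rw [L2.inner_def]
  refine integral_congr_ae ?_
  filter_upwards [coe_hardyMap hn v, coe_hardyMap hn w] with x h1 h2
  rw [h1, h2]
  simp only [RCLike.inner_apply, conj_trivial, div_eq_mul_inv]
  ring

/-- Poincaré's inequality, in the form of a bound by the Hardy norm on a bounded domain. -/
theorem exists_norm_fnMap_le (hn : 3 ≤ n) (hb : Bornology.IsBounded Ω) (hm : MeasurableSet Ω) :
    ∃ R : ℝ, 0 < R ∧ ∀ v : H10 Ω, ‖fnMap Ω v‖ ≤ R * ‖hardyMap hn Ω v‖ := by
  obtain ⟨R, hR0, hR⟩ := hb.exists_pos_norm_le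
  refine ⟨R, hR0, fun v => Lp.norm_le_mul_norm_of_ae_le_mul ?_⟩
  have hne : ∀ᵐ x : E n ∂volume.restrict Ω, x ≠ 0 := by
    have : Nonempty (Fin n) := ⟨⟨0, by omega⟩⟩
    exact ae_restrict_of_ae (Measure.ae_ne volume 0)
  filter_upwards [coe_hardyMap hn v, ae_restrict_mem hm, hne] with x hx hxΩ h0
  rw [hx, coe_fnMap, norm_mul, norm_inv, norm_norm]
  have h0' : 0 < ‖x‖ := norm_pos_iff.2 h0
  rw [← mul_assoc]
  refine le_mul_of_one_le_left (norm_nonneg _) ?_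
  rw [← div_eq_mul_inv, one_le_div h0']
  exact hR x hxΩ

/-- The embedding `v ↦ (v/|x|, ∇v)`, whose range carries the inner product
`∫ vw/|x|² + ∫ ∇v·∇w`. -/
noncomputable def energyEmb (hn : 3 ≤ n) (Ω : Set (E n)) :
    H10 Ω →L[ℝ] WithLp 2 (L2 Ω × L2Vec Ω) :=
  (WithLp.prodContinuousLinearEquiv 2 ℝ (L2 Ω) (L2Vec Ω)).symm.toContinuousLinearMap.comp
    ((hardyMap hn Ω).prod (gradMap Ω))

theorem inner_energyEmb (hn : 3 ≤ n) (v w : H10 Ω) :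
    inner ℝ (energyEmb hn Ω v) (energyEmb hn Ω w) =
      inner ℝ (hardyMap hn Ω v) (hardyMap hn Ω w) + inner ℝ (gradMap Ω v) (gradMap Ω w) := rfl

theorem norm_energyEmb_sq (hn : 3 ≤ n) (v : H10 Ω) :
    ‖energyEmb hn Ω v‖ ^ 2 = ‖hardyMap hn Ω v‖ ^ 2 + ‖gradMap Ω v‖ ^ 2 := by
  rw [← real_inner_self_eq_norm_sq, inner_energyEmb, real_inner_self_eq_norm_sq,
    real_inner_self_eq_norm_sq]

theorem norm_gradMap_le_energyEmb (hn : 3 ≤ n) (v : H10 Ω) :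
    ‖gradMap Ω v‖ ≤ ‖energyEmb hn Ω v‖ := by
  refine le_of_sq_le_sq ?_ (norm_nonneg _)
  rw [norm_energyEmb_sq]
  nlinarith [norm_nonneg (hardyMap hn Ω v)]

theorem norm_hardyMap_le_energyEmb (hn : 3 ≤ n) (v : H10 Ω) :
    ‖hardyMap hn Ω v‖ ≤ ‖energyEmb hn Ω v‖ := by
  refine le_of_sq_le_sq ?_ (norm_nonneg _)
  rw [norm_energyEmb_sq]
  nlinarith [norm_nonneg (gradMap Ω v)]

theorem exists_norm_le_energyEmb (hn : 3 ≤ n) (hb : Bornology.IsBounded Ω)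
    (hm : MeasurableSet Ω) : ∃ K : ℝ≥0, ∀ v : H10 Ω, ‖v‖ ≤ K * ‖energyEmb hn Ω v‖ := by
  obtain ⟨R, hR0, hR⟩ := exists_norm_fnMap_le hn hb hm
  refine ⟨(R + 1).toNNReal, fun v => ?_⟩
  rw [norm_eq_max, Real.coe_toNNReal _ (by positivity)]
  have h1 := norm_gradMap_le_energyEmb hn v
  have h2 := norm_hardyMap_le_energyEmb hn v
  refine max_le ((hR v).trans ?_) ?_ <;>
  nlinarith [norm_nonneg (energyEmb hn Ω v)]

theorem antilipschitz_energyEmb (hn : 3 ≤ n) (hb : Bornology.IsBounded Ω)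
    (hm : MeasurableSet Ω) : ∃ K : ℝ≥0, AntilipschitzWith K (energyEmb hn Ω) := by
  obtain ⟨K, hK⟩ := exists_norm_le_energyEmb hn hb hm
  exact ⟨K, ContinuousLinearMap.antilipschitz_of_bound _ hK⟩

/-- `W₀^{1,2}(Ω)` is isomorphic to the range of the energy embedding, which is a Hilbert space. -/
noncomputable def energyEquiv (hn : 3 ≤ n) (hb : Bornology.IsBounded Ω) (hm : MeasurableSet Ω) :
    H10 Ω ≃L[ℝ] (energyEmb hn Ω).range :=
  (energyEmb hn Ω).equivRange (antilipschitz_energyEmb hn hb hm).choose_spec.injective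
    ((antilipschitz_energyEmb hn hb hm).choose_spec.isClosed_range
      (energyEmb hn Ω).uniformContinuous)

theorem coe_energyEquiv (hn : 3 ≤ n) (hb : Bornology.IsBounded Ω) (hm : MeasurableSet Ω)
    (v : H10 Ω) : (energyEquiv hn hb hm v : WithLp 2 (L2 Ω × L2Vec Ω)) = energyEmb hn Ω v := rfl

theorem completeSpace_range (hn : 3 ≤ n) (hb : Bornology.IsBounded Ω) (hm : MeasurableSet Ω) :
    CompleteSpace ((energyEmb hn Ω).range) :=
  ((antilipschitz_energyEmb hn hb hm).choose_spec.isClosed_range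
      (energyEmb hn Ω).uniformContinuous).completeSpace_coe

/-- For a bounded operator `T` from `W₀^{1,2}(Ω)` to a Hilbert space `G`, the operator that sends
`g` to the Riesz representative of `φ ↦ ⟪g, T φ⟫` with respect to the energy inner product, that is,
the solution `v` of `v/|x|² - Δv = T* g`. -/
noncomputable def rieszLift (hn : 3 ≤ n) (hb : Bornology.IsBounded Ω) (hm : MeasurableSet Ω)
    {G : Type*} [NormedAddCommGroup G] [InnerProductSpace ℝ G] [CompleteSpace G]
    (T : H10 Ω →L[ℝ] G) : G →L[ℝ] H10 Ω :=
  haveI := completeSpace_range hn hb hm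
  (energyEquiv hn hb hm).symm.toContinuousLinearMap.comp
    (ContinuousLinearMap.adjoint (T.comp (energyEquiv hn hb hm).symm.toContinuousLinearMap))

theorem inner_energyEmb_rieszLift (hn : 3 ≤ n) (hb : Bornology.IsBounded Ω)
    (hm : MeasurableSet Ω) {G : Type*} [NormedAddCommGroup G] [InnerProductSpace ℝ G]
    [CompleteSpace G] (T : H10 Ω →L[ℝ] G) (g : G) (φ : H10 Ω) :
    inner ℝ (energyEmb hn Ω (rieszLift hn hb hm T g)) (energyEmb hn Ω φ) = inner ℝ g (T φ) := by
  have := completeSpace_range hn hb hm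
  rw [← coe_energyEquiv hn hb hm, ← coe_energyEquiv hn hb hm, ← Submodule.coe_inner]
  simp [rieszLift, ContinuousLinearMap.adjoint_inner_left]

theorem eq_of_inner_energyEmb_eq (hn : 3 ≤ n) (hb : Bornology.IsBounded Ω)
    (hm : MeasurableSet Ω) {v w : H10 Ω}
    (h : ∀ φ, inner ℝ (energyEmb hn Ω v) (energyEmb hn Ω φ) =
      inner ℝ (energyEmb hn Ω w) (energyEmb hn Ω φ)) : v = w := by
  obtain ⟨K, hK⟩ := antilipschitz_energyEmb hn hb hm
  refine hK.injective (sub_eq_zero.1 ?_)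
  rw [← map_sub, ← inner_self_eq_zero (𝕜 := ℝ)]
  conv_lhs => rw [map_sub, inner_sub_left, ← map_sub, h, sub_self]

/-! ### Uniqueness of the weak gradient -/

/-- An element of `W₀^{1,2}(Ω)` is determined by its class in `L²(Ω)`. -/
theorem fnMap_injective (hΩ : IsOpen Ω) : Function.Injective (fnMap Ω) := by
  rw [injective_iff_map_eq_zero]
  intro v hv
  -- the weak gradient satisfies the integration by parts formula
  have key : ∀ (ψ : E n → ℝ), IsTest Ω ψ → ∀ e : E n,
      ∫ x in Ω, inner ℝ (ψ x • e) (grad v x) = 0 := by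
    intro ψ hψ e
    have hm1 : MemLp (fun x => ψ x • e) 2 (volume.restrict Ω) :=
      ((hψ.1.continuous.smul continuous_const).memLp_of_hasCompactSupport
        hψ.2.smul_right).restrict Ω
    have hψ' : Continuous fun x => fderiv ℝ ψ x e :=
      (hψ.1.continuous_fderiv (by simp)).clm_apply continuous_const
    have hm2 : MemLp (fun x => fderiv ℝ ψ x e) 2 (volume.restrict Ω) :=
      (hψ'.memLp_of_hasCompactSupport (hψ.2.fderiv_apply ℝ e)).restrict Ω
    let ℓ : L2 Ω × L2Vec Ω →L[ℝ] ℝ :=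
      (innerSL ℝ (hm1.toLp _)).comp (ContinuousLinearMap.snd ℝ _ _) +
        (innerSL ℝ (hm2.toLp _)).comp (ContinuousLinearMap.fst ℝ _ _)
    have hℓ : H10 Ω ≤ ℓ.ker := by
      refine Submodule.topologicalClosure_minimal _ ?_ ℓ.isClosed_ker
      rw [Submodule.span_le]
      intro z hz
      obtain ⟨φ, hφ, h1, h2⟩ := mem_testPairs.1 hz
      simp only [SetLike.mem_coe, LinearMap.mem_ker]
      change inner ℝ (hm1.toLp _) z.2 + inner ℝ (hm2.toLp _) z.1 = 0
      rw [L2.inner_def, L2.inner_def]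
      have e1 : ∫ x in Ω, inner ℝ (hm1.toLp _ x) (z.2 x) = ∫ x, ψ x * fderiv ℝ φ x e := by
        refine (integral_congr_ae ?_).trans (setIntegral_eq_integral_of_forall_compl_eq_zero
          (s := Ω) (f := fun x => ψ x * fderiv ℝ φ x e) fun x hx => ?_)
        · filter_upwards [hm1.coeFn_toLp, h2] with x hx hx2
          rw [hx, hx2, real_inner_smul_left, real_inner_comm, gradient,
            InnerProductSpace.toDual_symm_apply]
        · rw [image_eq_zero_of_notMem_tsupport fun h => hx (hψ.3 h), zero_mul]
      have e2 : ∫ x in Ω, inner ℝ (hm2.toLp _ x) (z.1 x) = ∫ x, fderiv ℝ ψ x e * φ x := by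
        refine (integral_congr_ae ?_).trans (setIntegral_eq_integral_of_forall_compl_eq_zero
          (s := Ω) (f := fun x => fderiv ℝ ψ x e * φ x) fun x hx => ?_)
        · filter_upwards [hm2.coeFn_toLp, h1] with x hx hx2
          rw [hx, hx2]
          simp [mul_comm]
        · rw [image_eq_zero_of_notMem_tsupport (f := φ) fun h => hx (hφ.3 h), mul_zero]
      rw [e1, e2, integral_mul_fderiv_eq_neg_fderiv_mul_of_integrable]
      · ring
      · exact (hψ'.mul hφ.1.continuous).integrable_of_hasCompactSupport hφ.2.mul_left
      · exact (hψ.1.continuous.mul ((hφ.1.continuous_fderiv (by simp)).clm_apply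
          continuous_const)).integrable_of_hasCompactSupport hψ.2.mul_right
      · exact (hψ.1.continuous.mul hφ.1.continuous).integrable_of_hasCompactSupport
          hψ.2.mul_right
      · exact fun x _ => hψ.differentiable x
      · exact fun x _ => hφ.differentiable x
    have h0 : ℓ v.1 = 0 := hℓ v.2
    change inner ℝ (hm1.toLp _) (gradMap Ω v) + inner ℝ (hm2.toLp _) (fnMap Ω v) = 0 at h0
    rw [hv, inner_zero_right, add_zero, L2.inner_def] at h0
    rw [← h0]
    refine integral_congr_ae ?_
    filter_upwards [hm1.coeFn_toLp] with x hx
    rw [hx, coe_gradMap]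
  have hloc : LocallyIntegrableOn (grad v) Ω :=
    locallyIntegrableOn_of_locallyIntegrable_restrict
      ((memLp_grad v).locallyIntegrable (by norm_num))
  have hg : ∀ᵐ x, x ∈ Ω → grad v x = 0 := by
    refine hΩ.ae_eq_zero_of_integral_contDiff_smul_eq_zero hloc fun ψ h1 h2 h3 => ?_
    have hψ : IsTest Ω ψ := ⟨h1, h2, h3⟩
    rw [← setIntegral_eq_integral_of_forall_compl_eq_zero (s := Ω) (fun x hx => by
      rw [image_eq_zero_of_notMem_tsupport fun h => hx (h3 h), zero_smul])]
    have hint : Integrable (fun x => ψ x • grad v x) (volume.restrict Ω) :=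
      memLp_one_iff_integrable.1 ((memLp_grad v).smul
        ((hψ.1.continuous.memLp_of_hasCompactSupport hψ.2 (p := 2)).restrict Ω))
    refine ext_inner_left ℝ fun e => ?_
    rw [← integral_inner hint, inner_zero_right, ← key ψ hψ e]
    simp only [real_inner_smul_left, real_inner_smul_right]
  have hgrad : gradMap Ω v = 0 := by
    rw [Lp.eq_zero_iff_ae_eq_zero]
    exact (ae_restrict_iff' hΩ.measurableSet).2 hg
  exact Subtype.ext (Prod.ext hv hgrad)

end PseudoParabolic

namespace PseudoParabolic

variable {n : ℕ} {Ω : Set (E n)}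

/-! ### Elementary inequalities for powers -/

theorem rpow_sub_rpow_le {r a b : ℝ} (hr : 1 ≤ r) (ha : 0 ≤ a) (hab : a ≤ b) :
    b ^ r - a ^ r ≤ r * b ^ (r - 1) * (b - a) := by
  rcases (ha.trans hab).eq_or_lt with hb | hb
  · have : a = b := le_antisymm hab (hb ▸ ha)
    simp [this]
  have h := one_add_mul_self_le_rpow_one_add (s := a / b - 1) (by
    have : 0 ≤ a / b := by positivity
    linarith) hr
  rw [add_sub_cancel, Real.div_rpow ha hb.le, le_div_iff₀ (by positivity)] at h
  have hbr : b ^ r = b ^ (r - 1) * b := by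
    rw [← Real.rpow_add_one hb.ne', sub_add_cancel]
  have : (1 + r * (a / b - 1)) * b ^ r = b ^ r - r * b ^ (r - 1) * (b - a) := by
    rw [hbr]; field_simp; ring
  linarith

theorem abs_rpow_mul_self_of_nonneg {q a : ℝ} (hq : 2 ≤ q) (ha : 0 ≤ a) :
    |a| ^ (q - 2) * a = a ^ (q - 1) := by
  rw [abs_of_nonneg ha]
  rcases ha.eq_or_lt with rfl | ha
  · rw [mul_zero, Real.zero_rpow (by linarith)]
  · rw [← Real.rpow_add_one ha.ne']; ring_nf

theorem abs_rpow_mul_sub_le_of_nonneg {q a b : ℝ} (hq : 2 ≤ q) (ha : 0 ≤ a) (hab : |a| ≤ b) :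
    |(|b| ^ (q - 2) * b) - |a| ^ (q - 2) * a| ≤ (q - 1) * b ^ (q - 2) * (b - a) := by
  rw [abs_of_nonneg ha] at hab
  have hb := ha.trans hab
  rw [abs_rpow_mul_self_of_nonneg hq ha, abs_rpow_mul_self_of_nonneg hq hb, abs_of_nonneg
    (sub_nonneg.2 (Real.rpow_le_rpow ha hab (by linarith)))]
  refine (rpow_sub_rpow_le (by linarith) ha hab).trans_eq ?_
  ring_nf

/-- The function `a ↦ |a|^{q-2} a` is Lipschitz on bounded sets. -/
theorem abs_rpow_mul_sub_le {q : ℝ} (hq : 2 ≤ q) (a b : ℝ) :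
    |(|a| ^ (q - 2) * a) - |b| ^ (q - 2) * b| ≤ (q - 1) * (max |a| |b|) ^ (q - 2) * |a - b| := by
  -- by symmetry, `|a| ≤ |b|` and `0 ≤ b`
  wlog hab : |a| ≤ |b| generalizing a b
  · rw [abs_sub_comm, max_comm, abs_sub_comm a b]
    exact this b a (le_of_not_ge hab)
  wlog hb : 0 ≤ b generalizing a b
  · have := this (-a) (-b) (by simpa using hab) (by linarith)
    simp only [abs_neg, mul_neg] at this
    rw [neg_sub_neg, abs_sub_comm, neg_sub_neg, abs_sub_comm b a] at this
    exact this
  rw [max_eq_right hab, abs_of_nonneg hb] at *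
  rw [abs_sub_comm, abs_sub_comm a b]
  rcases le_total 0 a with ha | ha
  · rw [abs_of_nonneg (show 0 ≤ b - a by linarith [le_abs_self a])]
    have := abs_rpow_mul_sub_le_of_nonneg hq ha hab
    rwa [abs_of_nonneg hb] at this
  · have h1 : |a| ^ (q - 2) ≤ b ^ (q - 2) := Real.rpow_le_rpow (abs_nonneg _) hab (by linarith)
    have h2 : 0 ≤ |a| ^ (q - 2) := by positivity
    have h3 : 0 ≤ b ^ (q - 2) := by positivity
    rw [abs_of_nonneg (show 0 ≤ b - a by linarith), abs_of_nonneg (by nlinarith)]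
    have h4 : b ^ (q - 2) * b - |a| ^ (q - 2) * a ≤ b ^ (q - 2) * (b - a) := by nlinarith
    refine h4.trans ?_
    have : 0 ≤ b ^ (q - 2) * (b - a) := mul_nonneg h3 (by linarith)
    nlinarith

theorem rpow_le_one_add_rpow {x r s : ℝ} (hx : 0 ≤ x) (hr : 0 ≤ r) (hrs : r ≤ s) :
    x ^ r ≤ 1 + x ^ s := by
  rcases le_total x 1 with h | h
  · have := Real.rpow_le_one hx h hr
    have : 0 ≤ x ^ s := by positivity
    linarith
  · have := Real.rpow_le_rpow_of_exponent_le h hrs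
    linarith

theorem abs_rpow_mul_sub_le_growth {q s : ℝ} (hq : 2 ≤ q) (hqs : q ≤ 2 + s) (a b : ℝ) :
    |(|a| ^ (q - 2) * a) - |b| ^ (q - 2) * b| ≤
      (1 + s) * (1 + |a| ^ s + |b| ^ s) * |a - b| := by
  refine (abs_rpow_mul_sub_le hq a b).trans ?_
  have h1 : (max |a| |b|) ^ (q - 2) ≤ 1 + (max |a| |b|) ^ s :=
    rpow_le_one_add_rpow (by positivity) (by linarith) (by linarith)
  have h2 : (max |a| |b|) ^ s ≤ |a| ^ s + |b| ^ s := by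
    have h3 : 0 ≤ |a| ^ s := by positivity
    have h4 : 0 ≤ |b| ^ s := by positivity
    rcases max_choice |a| |b| with h | h <;> rw [h] <;> linarith
  gcongr
  · linarith
  · linarith
  · linarith

/-- The tangent line inequality for the convex function `|a|^q / q`. -/
theorem tangent_le_abs_rpow {q : ℝ} (hq : 2 ≤ q) (a b : ℝ) :
    (|a| ^ (q - 2) * a) * (b - a) ≤ 1 / q * |b| ^ q - 1 / q * |a| ^ q := by
  have hq0 : 0 < q := by linarith
  have hconj : (q / (q - 1)).HolderConjugate q :=
    (Real.HolderConjugate.conjExponent (show 1 < q by linarith)).symm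
  have hy := Real.young_inequality_of_nonneg (a := |a| ^ (q - 1)) (b := |b|) (by positivity)
    (by positivity) hconj
  rw [← Real.rpow_mul (abs_nonneg _), mul_div_cancel₀ _ (show q - 1 ≠ 0 by linarith)] at hy
  have h1 : (|a| ^ (q - 2) * a) * a = |a| ^ q := by
    have h : |a| ^ (q - 2) * |a| = |a| ^ (q - 1) := by
      simpa using abs_rpow_mul_self_of_nonneg hq (abs_nonneg a)
    have h' : |a| ^ q = |a| ^ (q - 1) * |a| := by
      rcases (abs_nonneg a).eq_or_lt with h0 | h0
      · rw [← h0, mul_zero, Real.zero_rpow hq0.ne']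
      · rw [← Real.rpow_add_one h0.ne', sub_add_cancel]
    rw [h', ← h, mul_assoc, mul_assoc, abs_mul_abs_self]
  have h2 : (|a| ^ (q - 2) * a) * b ≤ |a| ^ (q - 1) * |b| := by
    have h : |a| ^ (q - 2) * |a| = |a| ^ (q - 1) := by
      simpa using abs_rpow_mul_self_of_nonneg hq (abs_nonneg a)
    rw [← h]
    calc (|a| ^ (q - 2) * a) * b ≤ |(|a| ^ (q - 2) * a) * b| := le_abs_self _
      _ = _ := by rw [abs_mul, abs_mul, abs_of_nonneg (by positivity : 0 ≤ |a| ^ (q - 2))]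
  have h3 : |a| ^ q / (q / (q - 1)) = |a| ^ q - 1 / q * |a| ^ q := by
    field_simp
  rw [h3] at hy
  rw [mul_sub, h1]
  have : |b| ^ q / q = 1 / q * |b| ^ q := by ring
  linarith

/-- The density `(k |a|^q - k_∞) / q` is nondecreasing in `q` and in `k ∈ [0, k_∞]`: the term
`k_∞ / q` in the energy compensates for the values `|a| < 1`. -/
theorem energy_density_mono {κ κ' κInf q q' a : ℝ} (hκ0 : 0 ≤ κ) (hκ : κ ≤ κ') (hκ' : κ' ≤ κInf)
    (hq : 0 < q) (hqq : q ≤ q') :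
    κ * (1 / q * |a| ^ q) - κInf * (1 / q) ≤ κ' * (1 / q' * |a| ^ q') - κInf * (1 / q') := by
  have hq' : 0 < q' := hq.trans_le hqq
  have h0 : 0 ≤ |a| ^ q := by positivity
  have h := one_add_mul_self_le_rpow_one_add (s := |a| ^ q - 1) (by linarith)
    ((one_le_div hq).2 hqq)
  rw [add_sub_cancel, ← Real.rpow_mul (abs_nonneg _), mul_div_cancel₀ _ hq.ne'] at h
  have h1 : 1 / q * (|a| ^ q - 1) ≤ 1 / q' * (|a| ^ q' - 1) := by
    have h2 : q' / q * (|a| ^ q - 1) ≤ |a| ^ q' - 1 := by linarith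
    have h3 := mul_le_mul_of_nonneg_left h2 (show 0 ≤ 1 / q' by positivity)
    refine le_trans (le_of_eq ?_) h3
    field_simp
  have h4 : 1 / q' ≤ 1 / q := one_div_le_one_div_of_le hq hqq
  have h5 : 0 ≤ 1 / q' * |a| ^ q' := by positivity
  have h6 := mul_le_mul_of_nonneg_left h1 hκ0
  have h7 := mul_le_mul_of_nonneg_left h4 (show 0 ≤ κInf - κ by linarith)
  have h8 := mul_le_mul_of_nonneg_right hκ h5
  nlinarith

end PseudoParabolic

namespace PseudoParabolic

variable {n : ℕ} {Ω : Set (E n)}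

/-! ### The superposition operator `v ↦ |v|^{q(x)-2} v` -/

/-- The exponent `2/(n-2)`: for `q ≤ 2 + 2/(n-2) = 2(n-1)/(n-2)` the function `|v|^{q-1}` is square
integrable for `v ∈ W₀^{1,2}(Ω)`, by Sobolev's inequality. -/
noncomputable def growthExp (n : ℕ) : ℝ := 2 / (n - 2)

theorem growthExp_pos (hn : 3 ≤ n) : 0 < growthExp n := by
  have : (3 : ℝ) ≤ n := by exact_mod_cast hn
  exact div_pos two_pos (by linarith)

/-- A variable exponent with values in `(2, 2(n-1)/(n-2)]`. -/
structure IsSubcritical (Ω : Set (E n)) (q : E n → ℝ) : Prop where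
  aemeasurable : AEMeasurable q (volume.restrict Ω)
  two_lt : ∀ x ∈ Ω, 2 < q x
  le : ∀ x ∈ Ω, q x ≤ 2 + growthExp n

theorem holderTriple_sobolev (hn : 3 ≤ n) :
    ENNReal.HolderTriple n (ENNReal.ofReal (sobolevExp n)) 2 := by
  have h3 : (3 : ℝ) ≤ n := by exact_mod_cast hn
  have hs : 0 < sobolevExp n := by linarith [sobolevExp_gt_two hn]
  constructor
  have h2 : (2 : ℝ≥0∞) = ENNReal.ofReal 2 := by simp
  rw [h2, ← ENNReal.ofReal_natCast, ← ENNReal.ofReal_inv_of_pos (by linarith),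
    ← ENNReal.ofReal_inv_of_pos hs, ← ENNReal.ofReal_inv_of_pos two_pos,
    ← ENNReal.ofReal_add (by positivity) (by positivity)]
  congr 1
  have : (n : ℝ) - 2 ≠ 0 := by linarith
  rw [sobolevExp]
  field_simp
  ring

theorem aestronglyMeasurable_power {q f : E n → ℝ} (hq : IsSubcritical Ω q)
    (hf : AEStronglyMeasurable f (volume.restrict Ω)) :
    AEStronglyMeasurable (fun x => |f x| ^ (q x - 2) * f x) (volume.restrict Ω) :=
  (((hf.aemeasurable.abs).pow (hq.aemeasurable.sub_const 2)).mul
    hf.aemeasurable).aestronglyMeasurable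

theorem eLpNorm_power_sub_le (hn : 3 ≤ n) (hm : MeasurableSet Ω) {q f g : E n → ℝ}
    (hq : IsSubcritical Ω q) (hf : AEStronglyMeasurable f (volume.restrict Ω))
    (hg : AEStronglyMeasurable g (volume.restrict Ω)) :
    eLpNorm (fun x => |f x| ^ (q x - 2) * f x - |g x| ^ (q x - 2) * g x) 2 (volume.restrict Ω) ≤
      ENNReal.ofReal (1 + growthExp n) * ((eLpNorm (fun _ => (1 : ℝ)) n (volume.restrict Ω) +
        eLpNorm f (ENNReal.ofReal (sobolevExp n)) (volume.restrict Ω) ^ growthExp n +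
        eLpNorm g (ENNReal.ofReal (sobolevExp n)) (volume.restrict Ω) ^ growthExp n) *
        eLpNorm (f - g) (ENNReal.ofReal (sobolevExp n)) (volume.restrict Ω)) := by
  set μ := volume.restrict Ω
  have hs := growthExp_pos hn
  have h3 : (3 : ℝ) ≤ n := by exact_mod_cast hn
  have hn1 : (1 : ℝ≥0∞) ≤ n := by exact_mod_cast (by omega : 1 ≤ n)
  set s := growthExp n
  have hpow : ∀ f : E n → ℝ, AEStronglyMeasurable f μ →
      AEStronglyMeasurable (fun x => |f x| ^ s) μ := fun f hf =>
    ((hf.aemeasurable.abs).pow_const s).aestronglyMeasurable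
  have hnorm : ∀ f : E n → ℝ, eLpNorm (fun x => |f x| ^ s) n μ =
      eLpNorm f (ENNReal.ofReal (sobolevExp n)) μ ^ s := by
    intro f
    have := eLpNorm_norm_rpow (p := n) (μ := μ) f hs
    simp only [Real.norm_eq_abs] at this
    rw [this, ← ENNReal.ofReal_natCast, ← ENNReal.ofReal_mul (by positivity)]
    congr 3
    simp only [s, growthExp, sobolevExp]
    ring
  have hw : AEStronglyMeasurable (fun x => 1 + |f x| ^ s + |g x| ^ s) μ :=
    (aestronglyMeasurable_const.add (hpow f hf)).add (hpow g hg)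
  have := holderTriple_sobolev hn
  calc _ ≤ ENNReal.ofReal (1 + s) *
        eLpNorm ((fun x => 1 + |f x| ^ s + |g x| ^ s) • (f - g)) 2 μ := by
        refine eLpNorm_le_mul_eLpNorm_of_ae_le_mul ?_ _
        filter_upwards [ae_restrict_mem hm] with x hx
        refine (abs_rpow_mul_sub_le_growth (hq.two_lt x hx).le (hq.le x hx) _ _).trans_eq ?_
        rw [Pi.smul_apply', smul_eq_mul, norm_mul, Real.norm_eq_abs, Real.norm_eq_abs,
          abs_of_nonneg (by positivity : 0 ≤ 1 + |f x| ^ s + |g x| ^ s), mul_assoc]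
        rfl
    _ ≤ ENNReal.ofReal (1 + s) * (eLpNorm (fun x => 1 + |f x| ^ s + |g x| ^ s) n μ *
        eLpNorm (f - g) (ENNReal.ofReal (sobolevExp n)) μ) := by
        gcongr
        exact eLpNorm_smul_le_mul_eLpNorm (hf.sub hg) hw
    _ ≤ _ := by
        gcongr
        refine (eLpNorm_add_le (aestronglyMeasurable_const.add (hpow f hf)) (hpow g hg)
          hn1).trans ?_
        rw [hnorm]
        gcongr
        refine (eLpNorm_add_le aestronglyMeasurable_const (hpow f hf) hn1).trans ?_
        rw [hnorm]

theorem eLpNorm_sobolev_le_ofReal (hn : 3 ≤ n) (v : H10 Ω) :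
    eLpNorm (fn v) (ENNReal.ofReal (sobolevExp n)) (volume.restrict Ω) ≤
      ENNReal.ofReal (sobolevConst n * ‖gradMap Ω v‖) := by
  refine (eLpNorm_sobolev_le hn v).trans_eq ?_
  rw [ENNReal.ofReal_mul (NNReal.coe_nonneg _), ENNReal.ofReal_coe_nnreal, ofReal_norm,
    Lp.enorm_def, coe_gradMap]

theorem eLpNorm_one_ne_top (hb : Bornology.IsBounded Ω) :
    eLpNorm (fun _ => (1 : ℝ)) n (volume.restrict Ω) ≠ ⊤ := by
  have : IsFiniteMeasure (volume.restrict Ω) := ⟨by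
    rw [Measure.restrict_apply_univ]; exact hb.measure_lt_top⟩
  exact (memLp_const (1 : ℝ)).eLpNorm_ne_top

theorem exists_eLpNorm_power_sub_le (hn : 3 ≤ n) (hb : Bornology.IsBounded Ω)
    (hm : MeasurableSet Ω) (R : ℝ) : ∃ K : ℝ≥0, ∀ q : E n → ℝ, IsSubcritical Ω q →
      ∀ v w : H10 Ω, ‖v‖ ≤ R → ‖w‖ ≤ R →
        eLpNorm (fun x => |fn v x| ^ (q x - 2) * fn v x - |fn w x| ^ (q x - 2) * fn w x) 2
          (volume.restrict Ω) ≤ ENNReal.ofReal (K * ‖v - w‖) := by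
  set A := (eLpNorm (fun _ => (1 : ℝ)) n (volume.restrict Ω)).toReal
  set S : ℝ := (sobolevConst n : ℝ)
  set s := growthExp n with hs
  have hspos : 0 < s := growthExp_pos hn
  have hA : eLpNorm (fun _ => (1 : ℝ)) n (volume.restrict Ω) = ENNReal.ofReal A :=
    (ENNReal.ofReal_toReal (eLpNorm_one_ne_top hb)).symm
  have hA0 : 0 ≤ A := ENNReal.toReal_nonneg
  have hS0 : 0 ≤ S := NNReal.coe_nonneg _
  by_cases hR : 0 ≤ R
  swap
  · exact ⟨0, fun q _ v w hv => absurd ((norm_nonneg v).trans hv) hR⟩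
  refine ⟨((1 + s) * ((A + (S * R) ^ s + (S * R) ^ s) * S)).toNNReal, fun q hq v w hv hw => ?_⟩
  have hB0 : 0 ≤ (S * R) ^ s := by positivity
  have hgrad : ∀ v : H10 Ω, ‖gradMap Ω v‖ ≤ ‖v‖ := fun v => by
    rw [norm_eq_max]; exact le_max_right _ _
  have hSv : ∀ v : H10 Ω, ‖v‖ ≤ R →
      eLpNorm (fn v) (ENNReal.ofReal (sobolevExp n)) (volume.restrict Ω) ^ s ≤
        ENNReal.ofReal ((S * R) ^ s) := by
    intro v hv
    rw [← ENNReal.ofReal_rpow_of_nonneg (by positivity) hspos.le]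
    refine ENNReal.rpow_le_rpow ((eLpNorm_sobolev_le_ofReal hn v).trans ?_) hspos.le
    exact ENNReal.ofReal_le_ofReal (mul_le_mul_of_nonneg_left ((hgrad v).trans hv) hS0)
  have hdiff : eLpNorm (fn v - fn w) (ENNReal.ofReal (sobolevExp n)) (volume.restrict Ω) ≤
      ENNReal.ofReal (S * ‖v - w‖) := by
    rw [← eLpNorm_congr_ae (fn_sub v w)]
    refine (eLpNorm_sobolev_le_ofReal hn _).trans ?_
    exact ENNReal.ofReal_le_ofReal (mul_le_mul_of_nonneg_left (hgrad _) hS0)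
  refine (eLpNorm_power_sub_le hn hm hq (memLp_fn v).1 (memLp_fn w).1).trans ?_
  rw [Real.coe_toNNReal _ (by positivity), mul_assoc, mul_assoc, ENNReal.ofReal_mul (by positivity),
    ENNReal.ofReal_mul (by positivity), ENNReal.ofReal_add (by positivity) hB0,
    ENNReal.ofReal_add hA0 hB0, hA]
  gcongr
  · exact hSv v hv
  · exact hSv w hw

theorem memLp_power (hn : 3 ≤ n) (hb : Bornology.IsBounded Ω) (hm : MeasurableSet Ω)
    {q : E n → ℝ} (hq : IsSubcritical Ω q) (v : H10 Ω) :
    MemLp (fun x => |fn v x| ^ (q x - 2) * fn v x) 2 (volume.restrict Ω) := by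
  refine ⟨aestronglyMeasurable_power hq (memLp_fn v).1, ?_⟩
  obtain ⟨K, hK⟩ := exists_eLpNorm_power_sub_le hn hb hm ‖v‖
  refine lt_of_le_of_lt (le_of_eq ?_) ((hK q hq v 0 le_rfl (by simp)).trans_lt
    ENNReal.ofReal_lt_top)
  refine eLpNorm_congr_ae ?_
  have h0 : fn (0 : H10 Ω) =ᵐ[volume.restrict Ω] 0 := Lp.coeFn_zero _ _ _
  filter_upwards [h0] with x hx
  simp [hx]

open Classical in
/-- The superposition operator `v ↦ |v|^{q(x)-2} v` from `W₀^{1,2}(Ω)` to `L²(Ω)`; it is set to `0`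
where the function is not square integrable, which does not happen for subcritical exponents. -/
noncomputable def nemytskii (q : E n → ℝ) (v : H10 Ω) : L2 Ω :=
  if h : MemLp (fun x => |fn v x| ^ (q x - 2) * fn v x) 2 (volume.restrict Ω) then h.toLp _ else 0

theorem nemytskii_eq (hn : 3 ≤ n) (hb : Bornology.IsBounded Ω) (hm : MeasurableSet Ω)
    {q : E n → ℝ} (hq : IsSubcritical Ω q) (v : H10 Ω) :
    nemytskii q v = (memLp_power hn hb hm hq v).toLp _ :=
  dif_pos (memLp_power hn hb hm hq v)

theorem coe_nemytskii (hn : 3 ≤ n) (hb : Bornology.IsBounded Ω) (hm : MeasurableSet Ω)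
    {q : E n → ℝ} (hq : IsSubcritical Ω q) (v : H10 Ω) :
    (nemytskii q v : E n → ℝ) =ᵐ[volume.restrict Ω] fun x => |fn v x| ^ (q x - 2) * fn v x := by
  rw [nemytskii_eq hn hb hm hq]
  exact MemLp.coeFn_toLp _

theorem inner_nemytskii (hn : 3 ≤ n) (hb : Bornology.IsBounded Ω) (hm : MeasurableSet Ω)
    {q : E n → ℝ} (hq : IsSubcritical Ω q) (v φ : H10 Ω) :
    inner ℝ (nemytskii q v) (fnMap Ω φ) =
      ∫ x in Ω, (|fn v x| ^ (q x - 2) * fn v x) * fn φ x := by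
  rw [L2.inner_def]
  refine integral_congr_ae ?_
  filter_upwards [coe_nemytskii hn hb hm hq v] with x hx
  rw [hx, coe_fnMap]
  simp [mul_comm]

theorem exists_nemytskii_lipschitz (hn : 3 ≤ n) (hb : Bornology.IsBounded Ω)
    (hm : MeasurableSet Ω) (R : ℝ) : ∃ K : ℝ≥0, ∀ q : E n → ℝ, IsSubcritical Ω q →
      ∀ v w : H10 Ω, ‖v‖ ≤ R → ‖w‖ ≤ R → ‖nemytskii q v - nemytskii q w‖ ≤ K * ‖v - w‖ := by
  obtain ⟨K, hK⟩ := exists_eLpNorm_power_sub_le hn hb hm R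
  refine ⟨K, fun q hq v w hv hw => ?_⟩
  rw [nemytskii_eq hn hb hm hq, nemytskii_eq hn hb hm hq, ← MemLp.toLp_sub, Lp.norm_toLp]
  exact ENNReal.toReal_le_of_le_ofReal (by positivity) (hK q hq v w hv hw)

theorem nemytskii_zero (hn : 3 ≤ n) (hb : Bornology.IsBounded Ω) (hm : MeasurableSet Ω)
    {q : E n → ℝ} (hq : IsSubcritical Ω q) : nemytskii q (0 : H10 Ω) = 0 := by
  rw [Lp.eq_zero_iff_ae_eq_zero]
  have h0 : fn (0 : H10 Ω) =ᵐ[volume.restrict Ω] 0 := Lp.coeFn_zero _ _ _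
  filter_upwards [coe_nemytskii hn hb hm hq 0, h0] with x hx h0
  rw [hx, h0]
  simp

/-- The superposition operator depends continuously on the exponent, by dominated convergence. -/
theorem tendsto_nemytskii (hn : 3 ≤ n) (hb : Bornology.IsBounded Ω) (hm : MeasurableSet Ω)
    {ι : Type*} {l : Filter ι} [l.IsCountablyGenerated] {q : ι → E n → ℝ} {q₀ : E n → ℝ}
    (hq : ∀ᶠ i in l, IsSubcritical Ω (q i)) (hq₀ : IsSubcritical Ω q₀)
    (hlim : ∀ x ∈ Ω, Tendsto (fun i => q i x) l (𝓝 (q₀ x))) (v : H10 Ω) :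
    Tendsto (fun i => nemytskii (q i) v) l (𝓝 (nemytskii q₀ v)) := by
  have hs : 0 < growthExp n := growthExp_pos hn
  set s := growthExp n with hs_def
  -- the constant exponent `2 + s` dominates all the others
  have hmax : IsSubcritical Ω (fun _ => 2 + s) :=
    ⟨aemeasurable_const, fun _ _ => by linarith, fun _ _ => le_rfl⟩
  have hbound : ∀ q : E n → ℝ, IsSubcritical Ω q → ∀ x ∈ Ω, |(|fn v x| ^ (q x - 2) * fn v x)| ≤
      |fn v x| + |(|fn v x| ^ ((2 + s) - 2) * fn v x)| := by
    intro q hq x hx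
    have h1 := hq.two_lt x hx
    have h2 := hq.le x hx
    rw [abs_mul, abs_mul, abs_of_nonneg (by positivity : 0 ≤ |fn v x| ^ (q x - 2)),
      abs_of_nonneg (by positivity : 0 ≤ |fn v x| ^ ((2 + s) - 2))]
    have := rpow_le_one_add_rpow (abs_nonneg (fn v x)) (show 0 ≤ q x - 2 by linarith)
      (show q x - 2 ≤ (2 + s) - 2 by linarith)
    nlinarith [abs_nonneg (fn v x)]
  set B : E n → ℝ := fun x => 2 * (|fn v x| + |(|fn v x| ^ ((2 + s) - 2) * fn v x)|) with hB
  have hBmem : MemLp B 2 (volume.restrict Ω) :=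
    (((memLp_fn v).abs).add (memLp_power hn hb hm hmax v).abs).const_mul 2
  let F : ι → E n → ℝ := fun i x =>
    |fn v x| ^ (q i x - 2) * fn v x - |fn v x| ^ (q₀ x - 2) * fn v x
  have hsq : Tendsto (fun i => eLpNorm (F i) 2 (volume.restrict Ω) ^ 2) l (𝓝 0) := by
    simp only [eLpNorm_two_sq]
    have : (0 : ℝ≥0∞) = ∫⁻ _ in Ω, (0 : ℝ≥0∞) := by simp
    rw [this]
    refine tendsto_lintegral_filter_of_dominated_convergence' (fun x => ‖B x‖ₑ ^ 2) ?_ ?_ ?_ ?_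
    · filter_upwards [hq] with i hi
      exact (((memLp_power hn hb hm hi v).1.sub
        (memLp_power hn hb hm hq₀ v).1).enorm).pow_const 2
    · filter_upwards [hq] with i hi
      filter_upwards [ae_restrict_mem hm] with x hxΩ
      refine pow_le_pow_left' (enorm_le_iff_norm_le.2 ?_) 2
      have e1 := hbound _ hi x hxΩ
      have e2 := hbound _ hq₀ x hxΩ
      rw [Real.norm_eq_abs, Real.norm_eq_abs, abs_of_nonneg (by positivity : 0 ≤ B x)]
      refine (abs_sub _ _).trans ?_
      simp only [hB]
      linarith
    · rw [← eLpNorm_two_sq]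
      exact ENNReal.pow_ne_top hBmem.eLpNorm_ne_top
    · filter_upwards [ae_restrict_mem hm] with x hxΩ
      have h1 : Tendsto (fun i => F i x) l (𝓝 0) := by
        rcases eq_or_ne (fn v x) 0 with h0 | h0
        · simpa [F, h0] using tendsto_const_nhds
        · have h2 : Tendsto (fun i => |fn v x| ^ (q i x - 2)) l (𝓝 (|fn v x| ^ (q₀ x - 2))) :=
            (Real.continuousAt_const_rpow (abs_ne_zero.2 h0)).tendsto.comp
              ((hlim x hxΩ).sub_const 2)
          have h3 := (h2.mul_const (fn v x)).sub_const (|fn v x| ^ (q₀ x - 2) * fn v x)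
          simpa using h3
      have h4 := (ENNReal.continuous_pow 2).tendsto _ |>.comp ((continuous_enorm.tendsto _).comp h1)
      simpa [Function.comp_def] using h4
  have hlim2 : Tendsto (fun i => eLpNorm (F i) 2 (volume.restrict Ω)) l (𝓝 0) := by
    have h := (ENNReal.continuous_rpow_const (y := (2 : ℝ)⁻¹)).tendsto 0 |>.comp hsq
    rw [ENNReal.zero_rpow_of_pos (by norm_num)] at h
    refine h.congr fun i => ?_
    rw [Function.comp_apply, ← ENNReal.rpow_natCast, ← ENNReal.rpow_mul]
    norm_num
  rw [tendsto_iff_norm_sub_tendsto_zero]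
  have h := (ENNReal.tendsto_toReal ENNReal.zero_ne_top).comp hlim2
  rw [ENNReal.toReal_zero] at h
  refine h.congr' ?_
  filter_upwards [hq] with i hi
  rw [nemytskii_eq hn hb hm hi, nemytskii_eq hn hb hm hq₀, ← MemLp.toLp_sub, Lp.norm_toLp]
  rfl

end PseudoParabolic

namespace PseudoParabolic

variable {n : ℕ} {Ω : Set (E n)} {p : E n → ℝ → ℝ} {k : ℝ → ℝ} {kInf : ℝ}

/-! ### The exponent and the coefficient -/

theorem closure_cylinder (Ω : Set (E n)) : closure (cylinder Ω) = closure Ω ×ˢ Ici 0 := by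
  rw [cylinder, closure_prod_eq, closure_Ioi]

theorem IsAdmissibleExponent.continuousOn_right (hp : IsAdmissibleExponent Ω p) {x : E n}
    (hx : x ∈ Ω) : ContinuousOn (p x) (Ici 0) := by
  refine hp.contDiffOn.continuousOn.comp (f := fun t => (x, t)) (by fun_prop) fun t ht => ?_
  rw [closure_cylinder]
  exact ⟨subset_closure hx, ht⟩

theorem IsAdmissibleExponent.continuousOn_left (hp : IsAdmissibleExponent Ω p) {t : ℝ}
    (ht : 0 ≤ t) : ContinuousOn (fun x => p x t) Ω := by
  refine hp.contDiffOn.continuousOn.comp (f := fun x => (x, t)) (by fun_prop) fun x hx => ?_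
  rw [closure_cylinder]
  exact ⟨subset_closure hx, ht⟩

theorem IsAdmissibleExponent.bounds (hp : IsAdmissibleExponent Ω p) {x : E n} (hx : x ∈ Ω) {t : ℝ}
    (ht : 0 ≤ t) : pMinus Ω p ≤ p x t ∧ p x t ≤ pPlus Ω p :=
  hp.le_and_le (x, t) (by rw [closure_cylinder]; exact ⟨subset_closure hx, ht⟩)

theorem IsAdmissibleExponent.pPlus_lt (hp : IsAdmissibleExponent Ω p) (hn : 3 ≤ n) :
    pPlus Ω p < 2 + growthExp n := by
  have h3 : (3 : ℝ) ≤ n := by exact_mod_cast hn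
  refine hp.lt_crit.trans_eq ?_
  have : (n : ℝ) - 2 ≠ 0 := by linarith
  rw [growthExp]
  field_simp
  ring

theorem IsAdmissibleExponent.monotoneOn (hp : IsAdmissibleExponent Ω p) (hΩ : IsOpen Ω) {x : E n}
    (hx : x ∈ Ω) : MonotoneOn (p x) (Ici 0) := by
  refine monotoneOn_of_deriv_nonneg (convex_Ici 0) (hp.continuousOn_right hx) ?_ ?_
  · rw [interior_Ici]
    intro t ht
    have hmem : closure (cylinder Ω) ∈ 𝓝 (x, t) :=
      mem_of_superset ((hΩ.prod isOpen_Ioi).mem_nhds ⟨hx, ht⟩) subset_closure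
    have h1 : DifferentiableAt ℝ (fun z : E n × ℝ => p z.1 z.2) (x, t) :=
      (hp.contDiffOn.contDiffAt hmem).differentiableAt (by simp)
    have h2 : DifferentiableAt ℝ (fun t : ℝ => (x, t)) t := by fun_prop
    exact (h1.comp t h2).differentiableWithinAt
  · rw [interior_Ici]
    exact fun t ht => hp.deriv_nonneg x hx t ht

theorem IsAdmissibleExponent.isSubcritical (hp : IsAdmissibleExponent Ω p) (hn : 3 ≤ n)
    (hm : MeasurableSet Ω) {t : ℝ} (ht : 0 ≤ t) : IsSubcritical Ω (fun x => p x t) where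
  aemeasurable := (hp.continuousOn_left ht).aemeasurable hm
  two_lt _ hx := hp.two_lt.trans_le (hp.bounds hx ht).1
  le _ hx := (hp.bounds hx ht).2.trans (hp.pPlus_lt hn).le

theorem IsAdmissibleCoefficient.monotoneOn (hk : IsAdmissibleCoefficient k kInf) :
    MonotoneOn k (Ici 0) := by
  refine monotoneOn_of_deriv_nonneg (convex_Ici 0) hk.contDiffOn.continuousOn
    ((hk.contDiffOn.differentiableOn (by simp)).mono interior_subset) fun t ht => ?_
  rw [interior_Ici] at ht
  rw [← derivWithin_of_mem_nhds (Ici_mem_nhds ht)]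
  exact hk.deriv_nonneg t (le_of_lt ht)

theorem IsAdmissibleCoefficient.pos_of_nonneg (hk : IsAdmissibleCoefficient k kInf) {t : ℝ}
    (ht : 0 ≤ t) : 0 < k t :=
  hk.pos.trans_le (hk.monotoneOn self_mem_Ici ht ht)

theorem IsAdmissibleCoefficient.le_kInf (hk : IsAdmissibleCoefficient k kInf) {t : ℝ}
    (ht : 0 ≤ t) : k t ≤ kInf :=
  ge_of_tendsto hk.tendsto ((eventually_ge_atTop t).mono fun _ hs =>
    hk.monotoneOn ht (ht.trans hs) hs)

theorem IsAdmissibleCoefficient.kInf_pos (hk : IsAdmissibleCoefficient k kInf) : 0 < kInf :=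
  hk.pos.trans_le (hk.le_kInf le_rfl)

/-- The standing assumptions on the dimension, the domain and the coefficients. -/
structure Admissible (Ω : Set (E n)) (p : E n → ℝ → ℝ) (k : ℝ → ℝ) (kInf : ℝ) : Prop where
  three_le : 3 ≤ n
  isOpen : IsOpen Ω
  isBounded : Bornology.IsBounded Ω
  exponent : IsAdmissibleExponent Ω p
  coefficient : IsAdmissibleCoefficient k kInf

namespace Admissible

theorem isSubcritical (h : Admissible Ω p k kInf) {t : ℝ} (ht : 0 ≤ t) :
    IsSubcritical Ω (fun x => p x t) :=
  h.exponent.isSubcritical h.three_le h.isOpen.measurableSet ht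

/-! ### The vector field -/

/-- The energy embedding under the standing assumptions. -/
noncomputable abbrev emb (h : Admissible Ω p k kInf) :
    H10 Ω →L[ℝ] WithLp 2 (L2 Ω × L2Vec Ω) := energyEmb h.three_le Ω

/-- The operator `f ↦ (1/|x|² - Δ)⁻¹ f` on `L²(Ω)`. -/
noncomputable def solL2 (h : Admissible Ω p k kInf) : L2 Ω →L[ℝ] H10 Ω :=
  rieszLift h.three_le h.isBounded h.isOpen.measurableSet (fnMap Ω)

/-- The operator `v ↦ (1/|x|² - Δ)⁻¹ (-Δ v)` on `W₀^{1,2}(Ω)`. -/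
noncomputable def solGrad (h : Admissible Ω p k kInf) : H10 Ω →L[ℝ] H10 Ω :=
  (rieszLift h.three_le h.isBounded h.isOpen.measurableSet (gradMap Ω)).comp (gradMap Ω)

/-- The vector field `Φ(t, v) = (1/|x|² - Δ)⁻¹ (Δ v + k(t) |v|^{p(x,t)-2} v)`: the problem is the
ordinary differential equation `u' = Φ(t, u)` in `W₀^{1,2}(Ω)`. -/
noncomputable def field (h : Admissible Ω p k kInf) (t : ℝ) (v : H10 Ω) : H10 Ω :=
  k t • h.solL2 (nemytskii (fun x => p x t) v) - h.solGrad v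

variable (h : Admissible Ω p k kInf)
include h

theorem inner_emb_field (t : ℝ) (v φ : H10 Ω) :
    inner ℝ (h.emb (h.field t v)) (h.emb φ) =
      k t * inner ℝ (nemytskii (fun x => p x t) v) (fnMap Ω φ)
        - inner ℝ (gradMap Ω v) (gradMap Ω φ) := by
  simp only [emb, field, solL2, solGrad]
  rw [map_sub, map_smul, inner_sub_left, real_inner_smul_left, ContinuousLinearMap.comp_apply,
    inner_energyEmb_rieszLift, inner_energyEmb_rieszLift]

theorem weakForm_iff {t : ℝ} (ht : 0 ≤ t) (u w : H10 Ω) :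
    WeakForm p k t u w ↔ w = h.field t u := by
  have key : ∀ φ : H10 Ω, ((∫ x in Ω, fn w x / ‖x‖ ^ 2 * fn φ x)
        + (∫ x in Ω, inner ℝ (grad w x) (grad φ x)) + (∫ x in Ω, inner ℝ (grad u x) (grad φ x))
      = k t * ∫ x in Ω, (|fn u x| ^ (p x t - 2) * fn u x) * fn φ x) ↔
      inner ℝ (h.emb w) (h.emb φ) = inner ℝ (h.emb (h.field t u)) (h.emb φ) := by
    intro φ
    rw [inner_emb_field, integral_hardy_eq h.three_le, integral_grad_eq, integral_grad_eq,
      inner_nemytskii h.three_le h.isBounded h.isOpen.measurableSet (h.isSubcritical ht), emb,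
      inner_energyEmb, eq_sub_iff_add_eq]
  rw [WeakForm]
  simp only [key]
  exact ⟨eq_of_inner_energyEmb_eq h.three_le h.isBounded h.isOpen.measurableSet,
    fun hw φ => by rw [hw]⟩

theorem field_zero {t : ℝ} (ht : 0 ≤ t) : h.field t 0 = 0 := by
  rw [field, nemytskii_zero h.three_le h.isBounded h.isOpen.measurableSet (h.isSubcritical ht)]
  simp

theorem exists_field_lipschitz (R : ℝ) : ∃ K : ℝ≥0, ∀ t, 0 ≤ t → ∀ v w : H10 Ω, ‖v‖ ≤ R →
    ‖w‖ ≤ R → ‖h.field t v - h.field t w‖ ≤ K * ‖v - w‖ := by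
  obtain ⟨K, hK⟩ := exists_nemytskii_lipschitz h.three_le h.isBounded h.isOpen.measurableSet R
  refine ⟨(kInf * (‖h.solL2‖ * K) + ‖h.solGrad‖).toNNReal, fun t ht v w hv hw => ?_⟩
  have hk0 := h.coefficient.kInf_pos
  rw [Real.coe_toNNReal _ (by positivity)]
  have h1 : h.field t v - h.field t w =
      k t • h.solL2 (nemytskii (fun x => p x t) v - nemytskii (fun x => p x t) w)
        - h.solGrad (v - w) := by
    simp only [field, map_sub, smul_sub]
    abel
  rw [h1]
  refine (norm_sub_le _ _).trans ?_
  rw [norm_smul, Real.norm_of_nonneg (h.coefficient.pos_of_nonneg ht).le, add_mul, mul_assoc]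
  refine add_le_add ?_ (h.solGrad.le_opNorm _)
  refine mul_le_mul (h.coefficient.le_kInf ht) ?_ (norm_nonneg _) hk0.le
  refine (h.solL2.le_opNorm _).trans ?_
  rw [mul_assoc]
  exact mul_le_mul_of_nonneg_left (hK _ (h.isSubcritical ht) v w hv hw) (norm_nonneg _)

theorem exists_field_bound (R : ℝ) : ∃ M : ℝ, 0 ≤ M ∧ ∀ t, 0 ≤ t → ∀ v : H10 Ω, ‖v‖ ≤ R →
    ‖h.field t v‖ ≤ M := by
  obtain ⟨K, hK⟩ := h.exists_field_lipschitz R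
  refine ⟨K * |R|, by positivity, fun t ht v hv => ?_⟩
  have hR : 0 ≤ R := (norm_nonneg v).trans hv
  have := hK t ht v 0 hv (by simpa using hR)
  rw [h.field_zero ht, sub_zero, sub_zero] at this
  exact this.trans (mul_le_mul_of_nonneg_left (hv.trans (le_abs_self R)) (NNReal.coe_nonneg _))

theorem continuousOn_field (v : H10 Ω) : ContinuousOn (fun t => h.field t v) (Ici 0) := by
  refine ContinuousOn.sub (h.coefficient.contDiffOn.continuousOn.smul
    (h.solL2.continuous.comp_continuousOn ?_)) continuousOn_const
  intro t ht
  refine tendsto_nemytskii h.three_le h.isBounded h.isOpen.measurableSet ?_ (h.isSubcritical ht)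
    (fun x hx => h.exponent.continuousOn_right hx t ht) v
  exact eventually_mem_nhdsWithin.mono fun s hs => h.isSubcritical hs

theorem tendsto_field {ι : Type*} {l : Filter ι} {τ : ι → ℝ} {u : ι → H10 Ω} {t₀ : ℝ}
    {v₀ : H10 Ω} (ht₀ : 0 ≤ t₀) (hτ : Tendsto τ l (𝓝[Ici 0] t₀)) (hu : Tendsto u l (𝓝 v₀)) :
    Tendsto (fun i => h.field (τ i) (u i)) l (𝓝 (h.field t₀ v₀)) := by
  obtain ⟨K, hK⟩ := h.exists_field_lipschitz (‖v₀‖ + 1)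
  have h1 : Tendsto (fun i => h.field (τ i) v₀) l (𝓝 (h.field t₀ v₀)) :=
    (h.continuousOn_field v₀ t₀ ht₀).tendsto.comp hτ
  have h2 : Tendsto (fun i => h.field (τ i) (u i) - h.field (τ i) v₀) l (𝓝 0) := by
    refine squeeze_zero_norm' (a := fun i => K * ‖u i - v₀‖) ?_ ?_
    · have hb : ∀ᶠ i in l, ‖u i‖ ≤ ‖v₀‖ + 1 :=
        (hu.norm.eventually (gt_mem_nhds (lt_add_one ‖v₀‖))).mono fun _ hi => le_of_lt hi
      filter_upwards [hb, hτ.eventually eventually_mem_nhdsWithin] with i hi hi0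
      exact hK _ hi0 _ _ hi (by linarith)
    · have := (tendsto_iff_norm_sub_tendsto_zero.1 hu).const_mul (K : ℝ)
      simpa using this
  simpa using h2.add h1

theorem continuousOn_field_comp {u : ℝ → H10 Ω} {s : Set ℝ} (hs : s ⊆ Ici 0)
    (hu : ContinuousOn u s) : ContinuousOn (fun t => h.field t (u t)) s := fun t ht =>
  h.tendsto_field (hs ht) (tendsto_id.mono_left (nhdsWithin_mono t hs)) (hu t ht)

end Admissible

end PseudoParabolic

namespace PseudoParabolic

/-! ### Weak derivatives of functions of one variable -/

section WeakDerivative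

variable {X : Type*} [NormedAddCommGroup X] [NormedSpace ℝ X]

/-- A smooth increasing function that is `0` before `c` and `1` after `c + 1/(m+1)`. -/
noncomputable def ramp (c : ℝ) (m : ℕ) (t : ℝ) : ℝ := Real.smoothTransition ((m + 1) * (t - c))

theorem contDiff_ramp (c : ℝ) (m : ℕ) : ContDiff ℝ ∞ (ramp c m) :=
  Real.smoothTransition.contDiff.comp (by fun_prop)

theorem monotone_ramp (c : ℝ) (m : ℕ) : Monotone (ramp c m) := fun s t hst =>
  Real.smoothTransition.monotone (by gcongr)

theorem ramp_nonneg (c : ℝ) (m : ℕ) (t : ℝ) : 0 ≤ ramp c m t := Real.smoothTransition.nonneg _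

theorem ramp_le_one (c : ℝ) (m : ℕ) (t : ℝ) : ramp c m t ≤ 1 := Real.smoothTransition.le_one _

theorem ramp_of_le {c t : ℝ} (m : ℕ) (h : t ≤ c) : ramp c m t = 0 :=
  Real.smoothTransition.zero_of_nonpos
    (mul_nonpos_of_nonneg_of_nonpos (by positivity) (by linarith))

theorem ramp_of_ge {c t : ℝ} {m : ℕ} (h : c + 1 / ((m : ℝ) + 1) ≤ t) : ramp c m t = 1 := by
  refine Real.smoothTransition.one_of_one_le ?_
  have : 1 / ((m : ℝ) + 1) ≤ t - c := by linarith
  rwa [div_le_iff₀' (by positivity)] at this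

theorem deriv_ramp_eq_zero {c t : ℝ} {m : ℕ} (h : t < c ∨ c + 1 / ((m : ℝ) + 1) < t) :
    deriv (ramp c m) t = 0 := by
  rcases h with h | h
  · have : ramp c m =ᶠ[𝓝 t] fun _ => 0 := (eventually_lt_nhds h).mono fun s hs =>
      ramp_of_le m (le_of_lt hs)
    rw [this.deriv_eq, deriv_const]
  · have : ramp c m =ᶠ[𝓝 t] fun _ => 1 := (eventually_gt_nhds h).mono fun s hs =>
      ramp_of_ge (le_of_lt hs)
    rw [this.deriv_eq, deriv_const]

theorem continuous_deriv_ramp (c : ℝ) (m : ℕ) : Continuous (deriv (ramp c m)) :=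
  (contDiff_ramp c m).continuous_deriv (by simp)

theorem eventually_add_lt {c d : ℝ} (h : c < d) : ∀ᶠ m : ℕ in atTop, c + 1 / ((m : ℝ) + 1) < d := by
  have : Tendsto (fun m : ℕ => c + 1 / ((m : ℝ) + 1)) atTop (𝓝 (c + 0)) :=
    tendsto_const_nhds.add tendsto_one_div_add_atTop_nhds_zero_nat
  rw [add_zero] at this
  exact this.eventually (gt_mem_nhds h)

theorem integrableOn_deriv_ramp_smul {T : ℝ} {f : ℝ → X} (hf : ContinuousOn f (Icc 0 T)) (c : ℝ)
    (m : ℕ) : IntegrableOn (fun t => deriv (ramp c m) t • f t) (Ioo 0 T) :=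
  (((continuous_deriv_ramp c m).continuousOn.smul hf).integrableOn_compact
    isCompact_Icc).mono_set Ioo_subset_Icc_self

/-- The derivatives of the ramps form an approximation of the Dirac mass at `c`. -/
theorem tendsto_integral_deriv_ramp [CompleteSpace X] {T c : ℝ} (hc : c ∈ Ioo 0 T) {f : ℝ → X}
    (hf : ContinuousOn f (Icc 0 T)) :
    Tendsto (fun m : ℕ => ∫ t in Ioo 0 T, deriv (ramp c m) t • f t) atTop (𝓝 (f c)) := by
  rw [Metric.tendsto_atTop']
  intro ε hε
  have hT : 0 < T := hc.1.trans hc.2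
  have hfc : ContinuousAt f c := hf.continuousAt (Icc_mem_nhds hc.1 hc.2)
  obtain ⟨δ, hδ, hδf⟩ := Metric.continuousAt_iff.1 hfc (ε / 2) (half_pos hε)
  obtain ⟨N, hN⟩ := eventually_atTop.1
    ((eventually_add_lt hc.2).and (eventually_add_lt (lt_add_of_pos_right c hδ)))
  refine ⟨N, fun m hm => ?_⟩
  obtain ⟨h1, h2⟩ := hN m hm.le
  have hint : ∫ t in Ioo 0 T, deriv (ramp c m) t = 1 := by
    rw [← integral_Ioc_eq_integral_Ioo, ← intervalIntegral.integral_of_le hT.le,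
      intervalIntegral.integral_deriv_eq_sub
        (fun t _ => (contDiff_ramp c m).differentiable (by simp) t)
        ((continuous_deriv_ramp c m).intervalIntegrable _ _),
      ramp_of_ge h1.le, ramp_of_le m hc.1.le, sub_zero]
  have hi0 : IntegrableOn (deriv (ramp c m)) (Ioo 0 T) :=
    ((continuous_deriv_ramp c m).continuousOn.integrableOn_compact isCompact_Icc).mono_set
      Ioo_subset_Icc_self
  have heq : (∫ t in Ioo 0 T, deriv (ramp c m) t • f t) - f c =
      ∫ t in Ioo 0 T, deriv (ramp c m) t • (f t - f c) := by
    simp only [smul_sub]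
    rw [integral_sub (integrableOn_deriv_ramp_smul hf c m) (hi0.smul_const _),
      integral_smul_const, hint, one_smul]
  rw [dist_eq_norm, heq]
  refine lt_of_le_of_lt (norm_integral_le_of_norm_le (hi0.mul_const (ε / 2)) ?_) ?_
  · filter_upwards with t
    have hd : 0 ≤ deriv (ramp c m) t := (monotone_ramp c m).deriv_nonneg
    rw [norm_smul, Real.norm_of_nonneg hd]
    by_cases ht : t < c ∨ c + 1 / ((m : ℝ) + 1) < t
    · rw [deriv_ramp_eq_zero ht, zero_mul, zero_mul]
    · push Not at ht
      refine mul_le_mul_of_nonneg_left ?_ hd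
      rw [← dist_eq_norm]
      refine (hδf ?_).le
      rw [Real.dist_eq, abs_of_nonneg (by linarith)]
      linarith
  · rw [integral_mul_const, hint, one_mul]
    exact half_lt_self hε

theorem tendsto_integral_ramp {T c : ℝ} (hc : c ∈ Ioo 0 T) {w : ℝ → X}
    (hw : IntegrableOn w (Ioo 0 T)) :
    Tendsto (fun m : ℕ => ∫ t in Ioo 0 T, ramp c m t • w t) atTop (𝓝 (∫ t in c..T, w t)) := by
  have hlim : ∫ t in c..T, w t = ∫ t in Ioo 0 T, (Ioi c).indicator w t := by
    rw [intervalIntegral.integral_of_le hc.2.le, integral_Ioc_eq_integral_Ioo,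
      setIntegral_indicator measurableSet_Ioi]
    congr 2
    ext t
    simp only [mem_inter_iff, mem_Ioo, mem_Ioi]
    exact ⟨fun h => ⟨⟨hc.1.trans h.1, h.2⟩, h.1⟩, fun h => ⟨h.2, h.1.2⟩⟩
  rw [hlim]
  refine tendsto_integral_of_dominated_convergence (fun t => ‖w t‖) (fun m => ?_) hw.norm
    (fun m => ?_) ?_
  · exact (contDiff_ramp c m).continuous.aestronglyMeasurable.smul hw.1
  · filter_upwards with t
    rw [norm_smul, Real.norm_of_nonneg (ramp_nonneg c m t)]
    exact mul_le_of_le_one_left (norm_nonneg _) (ramp_le_one c m t)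
  · filter_upwards with t
    by_cases ht : c < t
    · rw [indicator_of_mem (mem_Ioi.2 ht)]
      refine tendsto_const_nhds.congr' ?_
      filter_upwards [eventually_add_lt ht] with m hm
      rw [ramp_of_ge hm.le, one_smul]
    · rw [indicator_of_notMem (by simpa using ht)]
      refine tendsto_const_nhds.congr fun m => ?_
      rw [ramp_of_le m (not_lt.1 ht), zero_smul]

/-- A continuous function with an integrable weak derivative is a primitive of it. -/
theorem IsWeakTimeDeriv.sub_eq_integral [CompleteSpace X] {T : ℝ} (hT : 0 < T) {f w : ℝ → X}
    (hf : ContinuousOn f (Icc 0 T)) (hw : IntegrableOn w (Ioo 0 T)) (h : IsWeakTimeDeriv T f w)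
    {t : ℝ} (ht : t ∈ Icc 0 T) : f t - f 0 = ∫ s in (0 : ℝ)..t, w s := by
  have hii : IntervalIntegrable w volume 0 T := by
    rw [intervalIntegrable_iff_integrableOn_Ioo_of_le hT.le]; exact hw
  have hsub : ∀ {a b : ℝ}, a ∈ Icc 0 T → b ∈ Icc 0 T → IntervalIntegrable w volume a b :=
    fun {a b} ha hb => hii.mono_set (by
      rw [uIcc_of_le hT.le]; exact uIcc_subset_Icc ha hb)
  have hT0 : (0 : ℝ) ∈ Icc 0 T := ⟨le_rfl, hT.le⟩
  have hTT : T ∈ Icc 0 T := ⟨hT.le, le_rfl⟩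
  have hint : ∀ a ∈ Ioo 0 T, ∀ b ∈ Ioo 0 T, a ≤ b → f a - f b = -∫ t in a..b, w t := by
    intro a ha b hb hab
    have h1 := (tendsto_integral_deriv_ramp ha hf).sub (tendsto_integral_deriv_ramp hb hf)
    have h2 := ((tendsto_integral_ramp ha hw).sub (tendsto_integral_ramp hb hw)).neg
    have h3 : (∫ t in a..T, w t) - ∫ t in b..T, w t = ∫ t in a..b, w t := by
      rw [sub_eq_iff_eq_add, intervalIntegral.integral_add_adjacent_intervals
        (hsub (Ioo_subset_Icc_self ha) (Ioo_subset_Icc_self hb))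
        (hsub (Ioo_subset_Icc_self hb) hTT)]
    rw [h3] at h2
    refine tendsto_nhds_unique (h1.congr' ?_) h2
    filter_upwards [eventually_add_lt hb.2] with m hm
    have hsupp : Function.support (fun t => ramp a m t - ramp b m t) ⊆
        Icc a (b + 1 / ((m : ℝ) + 1)) := by
      intro t ht
      by_contra hcon
      rw [mem_Icc, not_and_or, not_le, not_le] at hcon
      refine ht ?_
      rcases hcon with hcon | hcon
      · simp only [ramp_of_le m hcon.le, ramp_of_le m (hcon.le.trans hab), sub_zero]
      · have h4 : a + 1 / ((m : ℝ) + 1) ≤ t := by linarith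
        simp only [ramp_of_ge hcon.le, ramp_of_ge h4, sub_self]
    have htest := h (fun t => ramp a m t - ramp b m t)
      ((contDiff_ramp a m).sub (contDiff_ramp b m))
      (HasCompactSupport.of_support_subset_isCompact isCompact_Icc hsupp)
      ((closure_minimal hsupp isClosed_Icc).trans fun t ht =>
        ⟨ha.1.trans_le ht.1, ht.2.trans_lt hm⟩)
    have hd : ∀ t, deriv (fun t => ramp a m t - ramp b m t) t =
        deriv (ramp a m) t - deriv (ramp b m) t := fun t =>
      deriv_fun_sub ((contDiff_ramp a m).differentiable (by simp) t)
        ((contDiff_ramp b m).differentiable (by simp) t)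
    have hrw : ∀ c : ℝ, IntegrableOn (fun t => ramp c m t • w t) (Ioo 0 T) := fun c =>
      hw.bdd_smul 1 (contDiff_ramp c m).continuous.aestronglyMeasurable
        (Eventually.of_forall fun t => by
          rw [Real.norm_of_nonneg (ramp_nonneg c m t)]; exact ramp_le_one c m t)
    simp only [hd, sub_smul] at htest
    rw [integral_sub (integrableOn_deriv_ramp_smul hf a m) (integrableOn_deriv_ramp_smul hf b m),
      integral_sub (hrw a) (hrw b)] at htest
    exact htest
  -- both sides of the identity are continuous up to the end points
  have hg : ContinuousOn (fun t => f t - ∫ s in (0 : ℝ)..t, w s) (Icc 0 T) := by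
    refine hf.sub ?_
    have := intervalIntegral.continuousOn_primitive_interval' hii left_mem_uIcc
    rwa [uIcc_of_le hT.le] at this
  have hmid : T / 2 ∈ Ioo 0 T := ⟨by linarith, by linarith⟩
  have hconst : EqOn (fun t => f t - ∫ s in (0 : ℝ)..t, w s)
      (fun _ => f (T / 2) - ∫ s in (0 : ℝ)..(T / 2), w s) (Icc 0 T) := by
    have hsubset : Icc 0 T ⊆ closure (Ioo 0 T) := by rw [closure_Ioo hT.ne]
    refine EqOn.of_subset_closure (s := Ioo 0 T) ?_ hg continuousOn_const Ioo_subset_Icc_self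
      hsubset
    intro t ht
    have key : ∀ a ∈ Ioo 0 T, ∀ b ∈ Ioo 0 T, a ≤ b →
        f a - (∫ s in (0 : ℝ)..a, w s) = f b - ∫ s in (0 : ℝ)..b, w s := by
      intro a ha b hb hab
      have h5 := hint a ha b hb hab
      rw [← intervalIntegral.integral_add_adjacent_intervals
        (hsub hT0 (Ioo_subset_Icc_self ha)) (hsub (Ioo_subset_Icc_self ha)
          (Ioo_subset_Icc_self hb)), sub_eq_sub_iff_add_eq_add]
      rw [sub_eq_iff_eq_add] at h5
      rw [h5]
      abel
    rcases le_total t (T / 2) with h' | h'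
    · exact key t ht _ hmid h'
    · exact (key _ hmid t ht h').symm
  have e1 := hconst ht
  have e0 := hconst hT0
  simp only [intervalIntegral.integral_same, sub_zero] at e1 e0
  rw [e0, ← e1]
  abel

/-- A `C¹` function has its derivative as a weak derivative. -/
theorem isWeakTimeDeriv_of_hasDerivWithinAt [CompleteSpace X] {T : ℝ} (hT : 0 < T) {f w : ℝ → X}
    (hf : ∀ t ∈ Icc 0 T, HasDerivWithinAt f (w t) (Icc 0 T) t) (hw : ContinuousOn w (Icc 0 T)) :
    IsWeakTimeDeriv T f w := by
  intro η h1 h2 h3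
  have hfc : ContinuousOn f (Icc 0 T) := fun t ht => (hf t ht).continuousWithinAt
  have hη0 : ∀ t ∉ Ioo 0 T, η t = 0 := fun t ht =>
    image_eq_zero_of_notMem_tsupport fun h => ht (h3 h)
  have hη' : Continuous (deriv η) := h1.continuous_deriv (by simp)
  have i1 : IntegrableOn (fun t => deriv η t • f t) (Icc 0 T) :=
    (hη'.continuousOn.smul hfc).integrableOn_compact isCompact_Icc
  have i2 : IntegrableOn (fun t => η t • w t) (Icc 0 T) :=
    (h1.continuous.continuousOn.smul hw).integrableOn_compact isCompact_Icc
  have hsum : IntervalIntegrable (fun t => η t • w t + deriv η t • f t) volume 0 T := by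
    rw [intervalIntegrable_iff_integrableOn_Icc_of_le hT.le]
    exact i2.add i1
  have hftc := intervalIntegral.integral_eq_sub_of_hasDeriv_right
    (f := fun t => η t • f t) (f' := fun t => η t • w t + deriv η t • f t) (a := 0) (b := T)
    (by rw [uIcc_of_le hT.le]; exact h1.continuous.continuousOn.smul hfc) (fun t ht => by
      rw [min_eq_left hT.le, max_eq_right hT.le] at ht
      have hd := (hf t (Ioo_subset_Icc_self ht)).hasDerivAt (Icc_mem_nhds ht.1 ht.2)
      exact ((h1.differentiable (by simp) t).hasDerivAt.smul hd).hasDerivWithinAt) hsum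
  rw [hη0 T (by simp), hη0 0 (by simp), zero_smul, zero_smul, sub_zero,
    intervalIntegral.integral_of_le hT.le, integral_Ioc_eq_integral_Ioo,
    integral_add (i2.mono_set Ioo_subset_Icc_self) (i1.mono_set Ioo_subset_Icc_self)] at hftc
  exact eq_neg_of_add_eq_zero_right hftc

end WeakDerivative

/-! ### Weak solutions are solutions of the differential equation -/

variable {n : ℕ} {Ω : Set (E n)} {p : E n → ℝ → ℝ} {k : ℝ → ℝ} {kInf : ℝ}

namespace Admissible

variable (h : Admissible Ω p k kInf)

/-- `u` is a solution of `u' = Φ(t, u)` on `[0,T]` in `W₀^{1,2}(Ω)`. -/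
def IsODESol (T : ℝ) (u : ℝ → H10 Ω) : Prop :=
  ∀ t ∈ Icc 0 T, HasDerivWithinAt u (h.field t (u t)) (Icc 0 T) t

instance : SecondCountableTopologyEither ℝ (H10 Ω) :=
  secondCountableTopologyEither_of_left _ _

theorem isODESol_of_isWeakSolution {u₀ : H10 Ω} {T : ℝ} (hT : 0 < T) {u : ℝ → H10 Ω}
    (hu : IsWeakSolution p k u₀ T u) : h.IsODESol T u := by
  obtain ⟨w, hw, heq⟩ := hu.equation
  obtain ⟨C, hC⟩ := hu.essBounded
  obtain ⟨M, -, hM⟩ := h.exists_field_bound C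
  have hwf : ∀ᵐ t ∂volume.restrict (Ioo 0 T), w t = h.field t (u t) := by
    filter_upwards [heq, ae_restrict_mem measurableSet_Ioo] with t ht ht0
    exact (h.weakForm_iff ht0.1.le _ _).1 ht
  have hwint : IntegrableOn w (Ioo 0 T) := by
    refine Integrable.of_bound hw.aestronglyMeasurable M ?_
    filter_upwards [hwf, hC, ae_restrict_mem measurableSet_Ioo] with t h1 h2 h3
    rw [h1]
    exact hM t h3.1.le _ h2
  have hii : IntervalIntegrable w volume 0 T := by
    rw [intervalIntegrable_iff_integrableOn_Ioo_of_le hT.le]; exact hwint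
  -- the equation integrated in time holds in `L²`, hence in `W₀^{1,2}`
  have hint : ∀ t ∈ Icc 0 T, u t = u 0 + ∫ s in (0 : ℝ)..t, w s := by
    intro t ht
    apply fnMap_injective h.isOpen
    have hL2 := hw.weakDeriv.sub_eq_integral hT hu.continuousOn
      ((fnMap Ω).integrable_comp hwint) ht
    have hsub : IntervalIntegrable w volume 0 t := hii.mono_set (by
      rw [uIcc_of_le hT.le]; exact uIcc_subset_Icc ⟨le_rfl, hT.le⟩ ht)
    rw [map_add, ← ContinuousLinearMap.intervalIntegral_comp_comm _ hsub]
    exact sub_eq_iff_eq_add'.1 hL2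
  have hcont : ContinuousOn u (Icc 0 T) := by
    have h1 := intervalIntegral.continuousOn_primitive_interval' hii left_mem_uIcc
    rw [uIcc_of_le hT.le] at h1
    exact (continuousOn_const.add h1).congr hint
  have hfield : ContinuousOn (fun t => h.field t (u t)) (Icc 0 T) :=
    h.continuousOn_field_comp Icc_subset_Ici_self hcont
  have hint' : ∀ t ∈ Icc 0 T, u t = u 0 + ∫ s in (0 : ℝ)..t, h.field s (u s) := by
    intro t ht
    rw [hint t ht]
    congr 1
    rw [intervalIntegral.integral_of_le ht.1, intervalIntegral.integral_of_le ht.1,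
      integral_Ioc_eq_integral_Ioo, integral_Ioc_eq_integral_Ioo]
    exact integral_congr_ae (ae_restrict_of_ae_restrict_of_subset
      (Ioo_subset_Ioo_right ht.2) hwf)
  intro t ht
  have : Fact (t ∈ Icc 0 T) := ⟨ht⟩
  have hd : HasDerivWithinAt (fun t => ∫ s in (0 : ℝ)..t, h.field s (u s)) (h.field t (u t))
      (Icc 0 T) t := by
    refine intervalIntegral.integral_hasDerivWithinAt_right ?_ ?_ (hfield t ht)
    · refine (hfield.mono ?_).intervalIntegrable
      exact uIcc_subset_Icc ⟨le_rfl, hT.le⟩ ht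
    · exact hfield.stronglyMeasurableAtFilter_nhdsWithin measurableSet_Icc t
  exact (hd.const_add (u 0)).congr hint' (hint' t ht)

theorem isWeakSolution_of_isODESol {u₀ : H10 Ω} {T : ℝ} (hT : 0 < T) {u : ℝ → H10 Ω}
    (h0 : u 0 = u₀) (hu : h.IsODESol T u) : IsWeakSolution p k u₀ T u := by
  have hcont : ContinuousOn u (Icc 0 T) := fun t ht => (hu t ht).continuousWithinAt
  have hfield : ContinuousOn (fun t => h.field t (u t)) (Icc 0 T) :=
    h.continuousOn_field_comp Icc_subset_Ici_self hcont
  obtain ⟨C, hC⟩ := isCompact_Icc.exists_bound_of_continuousOn hcont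
  obtain ⟨M, hM⟩ := isCompact_Icc.exists_bound_of_continuousOn hfield
  refine ⟨h0, (fnMap Ω).continuous.comp_continuousOn hcont, ?_, ⟨C, ?_⟩,
    fun t => h.field t (u t), ⟨?_, ?_, ?_⟩, ?_⟩
  · exact (hcont.mono Ioo_subset_Icc_self).aestronglyMeasurable measurableSet_Ioo
  · filter_upwards [ae_restrict_mem measurableSet_Ioo] with t ht
    exact hC t (Ioo_subset_Icc_self ht)
  · exact (hfield.mono Ioo_subset_Icc_self).aestronglyMeasurable measurableSet_Ioo
  · refine lt_of_le_of_lt (setLIntegral_mono' (g := fun _ =>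
      ENNReal.ofReal ((‖hardyMap h.three_le Ω‖ * M) ^ 2)) measurableSet_Ioo fun t ht => ?_) ?_
    · rw [hardyNormSq_eq h.three_le]
      refine ENNReal.ofReal_le_ofReal (pow_le_pow_left₀ (norm_nonneg _) ?_ 2)
      exact ((hardyMap h.three_le Ω).le_opNorm _).trans
        (mul_le_mul_of_nonneg_left (hM t (Ioo_subset_Icc_self ht)) (norm_nonneg _))
    · rw [setLIntegral_const]
      exact ENNReal.mul_lt_top ENNReal.ofReal_lt_top (by simp)
  · refine isWeakTimeDeriv_of_hasDerivWithinAt hT (fun t ht => ?_)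
      ((fnMap Ω).continuous.comp_continuousOn hfield)
    exact (fnMap Ω).hasFDerivAt.comp_hasDerivWithinAt t (hu t ht)
  · filter_upwards [ae_restrict_mem measurableSet_Ioo] with t ht
    exact (h.weakForm_iff ht.1.le _ _).2 rfl

end Admissible

end PseudoParabolic

namespace PseudoParabolic

/-! ### Differential inequalities on the line -/

/-- A function that is nowhere locally decreasing satisfies `f a ≤ f b`; continuity is not needed,
as the hypotheses are imposed on both sides of each point. -/
theorem le_of_eventually_le {f : ℝ → ℝ} {a b : ℝ} (hab : a ≤ b)
    (hr : ∀ t ∈ Ico a b, ∀ᶠ s in 𝓝[>] t, f t ≤ f s)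
    (hl : ∀ t ∈ Ioc a b, ∀ᶠ s in 𝓝[<] t, f s ≤ f t) : f a ≤ f b := by
  let S : Set ℝ := {t | ∀ r ∈ Icc a t, f a ≤ f r}
  have hS : Icc a b ⊆ S := by
    refine IsClosed.Icc_subset_of_forall_mem_nhdsWithin ?_ ?_ ?_
    · refine isClosed_of_closure_subset fun t ht => ?_
      have htab : t ∈ Icc a b :=
        closure_minimal inter_subset_right isClosed_Icc ht
      refine ⟨fun r hr => ?_, htab⟩
      have hlt : ∀ r ∈ Ico a t, f a ≤ f r := by
        intro r hr
        obtain ⟨s, hs, hsS⟩ := mem_closure_iff_nhds.1 ht (Ioi r) (Ioi_mem_nhds hr.2)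
        exact hsS.1 r ⟨hr.1, le_of_lt hs⟩
      rcases hr.2.lt_or_eq with h | h
      · exact hlt r ⟨hr.1, h⟩
      · subst h
        rcases hr.1.eq_or_lt with h | h
        · rw [← h]
        · obtain ⟨s, hs1, hs2⟩ := ((hl r ⟨h, htab.2⟩).and (Ioo_mem_nhdsLT h)).exists
          exact (hlt s ⟨hs2.1.le, hs2.2⟩).trans hs1
    · intro r hr
      rw [le_antisymm hr.2 hr.1]
    · rintro x ⟨hxS, hx⟩
      obtain ⟨u, hu, hsub⟩ := mem_nhdsGT_iff_exists_Ioc_subset.1 (hr x hx)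
      refine mem_nhdsGT_iff_exists_Ioc_subset.2 ⟨u, hu, fun s hs r hr => ?_⟩
      rcases le_or_gt r x with h | h
      · exact hxS r ⟨hr.1, h⟩
      · exact (hxS x ⟨hx.1, le_rfl⟩).trans (hsub ⟨h, hr.2.trans hs.2⟩)
  exact hS ⟨hab, le_rfl⟩ b ⟨hab, le_rfl⟩

theorem eventually_sub_le_of_hasDerivWithinAt {G : ℝ → ℝ} {g' t ε : ℝ} {s : Set ℝ} (hε : 0 < ε)
    (hG : HasDerivWithinAt G g' s t) :
    ∀ᶠ r in 𝓝[s] t, |G r - G t - (r - t) * g'| ≤ ε * |r - t| := by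
  have := (hasDerivWithinAt_iff_isLittleO.1 hG).def hε
  simpa [Real.norm_eq_abs] using this

/-- If the increments of `F` are bounded below to first order by those of `G`, then `F - G` does not
decrease. -/
theorem add_sub_le_of_local {F G g : ℝ → ℝ} {a b : ℝ}
    (hG : ∀ t ∈ Ico a b, HasDerivWithinAt G (g t) (Ici a) t)
    (hr : ∀ t ∈ Ico a b, ∀ ε > 0, ∀ᶠ s in 𝓝[>] t, (s - t) * (g t - ε) ≤ F s - F t)
    (hl : ∀ t ∈ Ioo a b, ∀ ε > 0, ∀ᶠ s in 𝓝[<] t, (t - s) * (g t - ε) ≤ F t - F s)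
    {t : ℝ} (ht : t ∈ Ico a b) : F a + (G t - G a) ≤ F t := by
  have key : ∀ ε > 0, F a + (G t - G a) ≤ F t + ε * (t - a) := by
    intro ε hε
    have := le_of_eventually_le (f := fun s => F s - G s + ε * s) ht.1 (fun x hx => ?_)
      (fun x hx => ?_)
    · linarith
    · have hx' : x ∈ Ico a b := ⟨hx.1, hx.2.trans ht.2⟩
      have hGr := eventually_sub_le_of_hasDerivWithinAt (half_pos hε)
        ((hG x hx').mono (Ioi_subset_Ici hx.1))
      filter_upwards [hr x hx' (ε / 2) (half_pos hε), hGr, self_mem_nhdsWithin] with s h1 h2 h3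
      have h3' : 0 < s - x := sub_pos.2 h3
      rw [abs_of_pos h3'] at h2
      have := (abs_le.1 h2).2
      linarith
    · have hx' : x ∈ Ioo a b := ⟨hx.1, hx.2.trans_lt ht.2⟩
      have hGl := eventually_sub_le_of_hasDerivWithinAt (half_pos hε)
        ((hG x ⟨hx.1.le, hx'.2⟩).hasDerivAt (Ici_mem_nhds hx.1)).hasDerivWithinAt (s := Iio x)
      filter_upwards [hl x hx' (ε / 2) (half_pos hε), hGl, self_mem_nhdsWithin] with s h1 h2 h3
      have h3' : s - x < 0 := sub_neg.2 h3
      rw [abs_of_neg h3'] at h2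
      have := (abs_le.1 h2).1
      linarith
  have hlim : Tendsto (fun ε => F t + ε * (t - a)) (𝓝[>] 0) (𝓝 (F t + 0 * (t - a))) :=
    ((continuous_const.add (continuous_id.mul continuous_const)).tendsto 0).mono_left
      nhdsWithin_le_nhds
  rw [zero_mul, add_zero] at hlim
  exact ge_of_tendsto hlim (eventually_mem_nhdsWithin.mono fun ε hε => key ε hε)

theorem monotoneOn_Ico_of_hasDerivWithinAt {f f' : ℝ → ℝ} {a b : ℝ}
    (hf : ∀ t ∈ Ico a b, HasDerivWithinAt f (f' t) (Ici a) t) (hf' : ∀ t ∈ Ico a b, 0 ≤ f' t) :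
    MonotoneOn f (Ico a b) := by
  have hd : ∀ t ∈ interior (Ico a b), HasDerivAt f (f' t) t := by
    intro t ht
    rw [interior_Ico] at ht
    exact (hf t (Ioo_subset_Ico_self ht)).hasDerivAt (Ici_mem_nhds ht.1)
  refine monotoneOn_of_deriv_nonneg (convex_Ico a b)
    (fun t ht => (hf t ht).continuousWithinAt.mono Ico_subset_Ici_self)
    (fun t ht => (hd t ht).differentiableAt.differentiableWithinAt) fun t ht => ?_
  rw [(hd t ht).deriv]
  exact hf' t (interior_subset ht)

section Levine

variable {L F l g : ℝ → ℝ} {a b q : ℝ}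

/-- The concavity method: if `L' ≥ 4qF` and `(L')² ≤ 4 L F'`, then `F L^{-q}` does not decrease. -/
theorem levine_lower_bound (hq : 0 < q)
    (hL : ∀ t ∈ Ico a b, HasDerivWithinAt L (l t) (Ici a) t)
    (hF : ∀ t ∈ Ico a b, HasDerivWithinAt F (g t) (Ici a) t)
    (hLpos : ∀ t ∈ Ico a b, 0 < L t) (hFa : 0 < F a)
    (h1 : ∀ t ∈ Ico a b, 4 * q * F t ≤ l t) (h2 : ∀ t ∈ Ico a b, l t ^ 2 ≤ 4 * L t * g t)
    {t : ℝ} (ht : t ∈ Ico a b) : F a / L a ^ q * L t ^ q ≤ F t := by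
  have ha : a ∈ Ico a b := ⟨le_rfl, ht.1.trans_lt ht.2⟩
  have hg : ∀ t ∈ Ico a b, 0 ≤ g t := by
    intro t ht
    have h3 := h2 t ht
    have h4 := hLpos t ht
    by_contra hcon
    nlinarith [sq_nonneg (l t), mul_pos h4 (neg_pos.2 (not_le.1 hcon))]
  have hFpos : ∀ t ∈ Ico a b, 0 < F t := fun t ht =>
    hFa.trans_le (monotoneOn_Ico_of_hasDerivWithinAt hF hg ha ht ht.1)
  have hmono := monotoneOn_Ico_of_hasDerivWithinAt (f := fun t => F t * L t ^ (-q))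
    (fun t ht => (hF t ht).mul ((hL t ht).rpow_const (p := -q) (Or.inl (hLpos t ht).ne')))
    (fun t ht => by
      have hLt := hLpos t ht
      have hFt := hFpos t ht
      have e1 : L t ^ (-q) = L t ^ (-q - 1) * L t := by
        rw [← Real.rpow_add_one hLt.ne', sub_add_cancel]
      have e2 : g t * L t ^ (-q) + F t * (l t * -q * L t ^ (-q - 1)) =
          L t ^ (-q - 1) * (g t * L t - q * F t * l t) := by rw [e1]; ring
      rw [e2]
      refine mul_nonneg (Real.rpow_nonneg hLt.le _) ?_
      have h3 := h1 t ht
      have h4 := h2 t ht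
      have h5 : 0 ≤ l t := le_trans (by positivity) h3
      nlinarith [mul_le_mul_of_nonneg_right h3 h5])
  have h := hmono ha ht ht.1
  have hLa := hLpos a ha
  have hLt := hLpos t ht
  simp only [Real.rpow_neg hLa.le, Real.rpow_neg hLt.le] at h
  have hp : 0 < L t ^ q := Real.rpow_pos_of_pos hLt q
  calc F a / L a ^ q * L t ^ q = F a * (L a ^ q)⁻¹ * L t ^ q := by rw [div_eq_mul_inv]
    _ ≤ F t * (L t ^ q)⁻¹ * L t ^ q := by gcongr
    _ = F t := by field_simp

/-- The concavity method: the interval of existence is bounded when `q > 1`. -/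
theorem levine_time_bound (hq : 1 < q)
    (hL : ∀ t ∈ Ico a b, HasDerivWithinAt L (l t) (Ici a) t)
    (hF : ∀ t ∈ Ico a b, HasDerivWithinAt F (g t) (Ici a) t)
    (hLpos : ∀ t ∈ Ico a b, 0 < L t) (hFa : 0 < F a)
    (h1 : ∀ t ∈ Ico a b, 4 * q * F t ≤ l t) (h2 : ∀ t ∈ Ico a b, l t ^ 2 ≤ 4 * L t * g t)
    {t : ℝ} (ht : t ∈ Ico a b) : t - a ≤ L a / (4 * q * (q - 1) * F a) := by
  have ha : a ∈ Ico a b := ⟨le_rfl, ht.1.trans_lt ht.2⟩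
  have hLa := hLpos a ha
  have hLt := hLpos t ht
  set c := F a / L a ^ q with hc
  have hc0 : 0 < c := by positivity
  have hlow := fun t ht => levine_lower_bound (by linarith) hL hF hLpos hFa h1 h2 (t := t) ht
  have hmono := monotoneOn_Ico_of_hasDerivWithinAt
    (f := fun t => -(L t ^ (1 - q)) - 4 * q * (q - 1) * c * t)
    (fun t ht => (((hL t ht).rpow_const (p := 1 - q) (Or.inl (hLpos t ht).ne')).neg).sub
      ((hasDerivWithinAt_id t (Ici a)).const_mul (4 * q * (q - 1) * c)))
    (fun t ht => by
      have hLt := hLpos t ht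
      have h3 := (mul_le_mul_of_nonneg_left (hlow t ht) (show 0 ≤ 4 * q by linarith)).trans
        (h1 t ht)
      have e1 : (1 : ℝ) - q - 1 = -q := by ring
      have e2 : L t ^ (-q) * L t ^ q = 1 := by
        rw [← Real.rpow_add hLt, neg_add_cancel, Real.rpow_zero]
      rw [e1, mul_one]
      have h4 := mul_le_mul_of_nonneg_left h3 (show 0 ≤ (q - 1) * L t ^ (-q) from
        mul_nonneg (by linarith) (Real.rpow_nonneg hLt.le _))
      have e3 : (q - 1) * L t ^ (-q) * (4 * q * (c * L t ^ q)) =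
          4 * q * (q - 1) * c * (L t ^ (-q) * L t ^ q) := by ring
      rw [e3, e2] at h4
      linarith)
  have h := hmono ha ht ht.1
  simp only at h
  have h5 : 0 ≤ L t ^ (1 - q) := Real.rpow_nonneg hLt.le _
  have h6 : 4 * q * (q - 1) * c * (t - a) ≤ L a ^ (1 - q) := by linarith
  have h7 : L a ^ (1 - q) = L a / L a ^ q := by
    rw [Real.rpow_sub hLa, Real.rpow_one]
  have hLq : 0 < L a ^ q := Real.rpow_pos_of_pos hLa q
  rw [h7, hc] at h6
  have hq1 : 0 < q - 1 := by linarith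
  rw [le_div_iff₀ (by positivity)]
  have e4 : 4 * q * (q - 1) * (F a / L a ^ q) * (t - a) =
      (t - a) * (4 * q * (q - 1) * F a) / L a ^ q := by ring
  rw [e4] at h6
  exact (div_le_div_iff_of_pos_right hLq).1 h6

end Levine

theorem exists_bound_of_rpow_le {c C σ q : ℝ} (hc : 0 < c) (hC : 0 ≤ C) (hσ : 0 ≤ σ)
    (hσq : σ < q) : ∃ B : ℝ, ∀ x : ℝ, 0 ≤ x → c * x ^ q ≤ C * (1 + x ^ σ) → x ≤ B := by
  refine ⟨max 1 ((2 * C / c) ^ (1 / (q - σ))), fun x hx h => ?_⟩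
  by_contra hcon
  rw [not_le, max_lt_iff] at hcon
  obtain ⟨h1, h2⟩ := hcon
  have hx0 : 0 < x := by linarith
  have h3 : 1 ≤ x ^ σ := Real.one_le_rpow h1.le hσ
  have hxσ : 0 < x ^ σ := by linarith
  have hsub : 0 < q - σ := by linarith
  have h4 : x ^ q = x ^ (q - σ) * x ^ σ := by rw [← Real.rpow_add hx0, sub_add_cancel]
  have h5 : x ^ (q - σ) ≤ 2 * C / c := by
    rw [le_div_iff₀ hc]
    have h6 : c * (x ^ (q - σ) * x ^ σ) ≤ 2 * C * x ^ σ := by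
      rw [← h4]; nlinarith
    have h7 : (x ^ (q - σ) * c) * x ^ σ ≤ 2 * C * x ^ σ := by linarith
    exact le_of_mul_le_mul_right h7 hxσ
  have h8 := Real.rpow_le_rpow (Real.rpow_nonneg hx _) h5 (show 0 ≤ 1 / (q - σ) by positivity)
  rw [← Real.rpow_mul hx, mul_one_div_cancel hsub.ne', Real.rpow_one] at h8
  linarith

theorem exists_mul_rpow_le {b ε θ : ℝ} (hb : 0 ≤ b) (hε : 0 < ε) (hθ : 0 ≤ θ) (hθ1 : θ < 1) :
    ∃ D : ℝ, 0 ≤ D ∧ ∀ x : ℝ, 0 ≤ x → b * x ^ θ ≤ ε * x + D := by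
  obtain ⟨B, hB⟩ := exists_bound_of_rpow_le (c := ε) (C := b) (σ := θ) (q := 1) hε hb hθ hθ1
  refine ⟨b * |B| ^ θ, by positivity, fun x hx => ?_⟩
  by_cases h : ε * x ≤ b * (1 + x ^ θ)
  · have h1 : x ≤ |B| := (hB x hx (by rwa [Real.rpow_one])).trans (le_abs_self B)
    have h2 : b * x ^ θ ≤ b * |B| ^ θ := by gcongr
    have : 0 ≤ ε * x := by positivity
    linarith
  · have : 0 ≤ b * |B| ^ θ := by positivity
    linarith

/-- Gronwall's inequality for `L' ≤ L + G'`. -/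
theorem exp_neg_mul_sub_le {L G l g : ℝ → ℝ} {a b : ℝ} (ha0 : 0 ≤ a)
    (hL : ∀ t ∈ Ico a b, HasDerivWithinAt L (l t) (Ici a) t)
    (hG : ∀ t ∈ Ico a b, HasDerivWithinAt G (g t) (Ici a) t)
    (hg : ∀ t ∈ Ico a b, 0 ≤ g t) (h : ∀ t ∈ Ico a b, l t ≤ L t + g t) {t : ℝ}
    (ht : t ∈ Ico a b) : Real.exp (-t) * L t ≤ Real.exp (-a) * L a + (G t - G a) := by
  have ha : a ∈ Ico a b := ⟨le_rfl, ht.1.trans_lt ht.2⟩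
  have hmono := monotoneOn_Ico_of_hasDerivWithinAt (f := fun t => G t - Real.exp (-t) * L t)
    (fun t ht => (hG t ht).sub
      ((((hasDerivWithinAt_id t (Ici a)).neg).exp).mul (hL t ht)))
    (fun t ht => by
      have h1 := h t ht
      have h2 := hg t ht
      have h3 : Real.exp (-t) ≤ 1 := Real.exp_le_one_iff.2 (by linarith [ht.1])
      have h4 := Real.exp_pos (-t)
      simp only [id, Pi.neg_apply]
      nlinarith)
  have := hmono ha ht ht.1
  simp only at this
  linarith

end PseudoParabolic

namespace PseudoParabolic

variable {n : ℕ} {Ω : Set (E n)}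

/-! ### Interpolation -/

/-- The function `|v|^r` is integrable for `v ∈ W₀^{1,2}(Ω)` and `2 ≤ r ≤ 2*`, and if `‖v/|x|‖₂` is
bounded, then its integral grows at most like `‖∇v‖₂` to the power `n(r-2)/2`. -/
theorem exists_integral_rpow_le (hn : 3 ≤ n) (hb : Bornology.IsBounded Ω) (hm : MeasurableSet Ω)
    {r : ℝ} (hr2 : 2 ≤ r) (hr : r ≤ sobolevExp n) (M : ℝ) : ∃ C : ℝ, 0 ≤ C ∧ ∀ v : H10 Ω,
      ‖hardyMap hn Ω v‖ ^ 2 ≤ M →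
        Integrable (fun x => |fn v x| ^ r) (volume.restrict Ω) ∧
        ∫ x in Ω, |fn v x| ^ r ≤ C * (‖gradMap Ω v‖ ^ 2) ^ (n * (r - 2) / 4) := by
  have h3 : (3 : ℝ) ≤ n := by exact_mod_cast hn
  obtain ⟨R, hR0, hR⟩ := exists_norm_fnMap_le hn hb hm
  set S : ℝ := (sobolevConst n : ℝ)
  have hS0 : 0 ≤ S := NNReal.coe_nonneg _
  set P := sobolevExp n with hP
  have hP2 : 2 < P := sobolevExp_gt_two hn
  set θ : ℝ := (r - 2) / (P - 2) with hθ
  have hθ0 : 0 ≤ θ := div_nonneg (by linarith) (by linarith)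
  have hθ1 : θ ≤ 1 := (div_le_one (by linarith)).2 (by linarith)
  have hPθ : P * θ = n * (r - 2) / 2 := by
    have h2 : (n : ℝ) - 2 ≠ 0 := by linarith
    have h4 : P - 2 = 4 / (n - 2) := by rw [hP, sobolevExp]; field_simp; ring
    rw [hθ, h4, hP, sobolevExp]
    field_simp
    ring
  have hrθ : r = 2 * (1 - θ) + P * θ := by
    have : P - 2 ≠ 0 := by linarith
    rw [hθ]; field_simp; ring
  refine ⟨(R ^ 2 * |M|) ^ (1 - θ) * S ^ (P * θ), by positivity, fun v hv => ?_⟩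
  set y := ‖gradMap Ω v‖ with hy
  have hy0 : 0 ≤ y := norm_nonneg _
  set f : E n → ℝ≥0∞ := fun x => ‖fn v x‖ₑ with hf
  have hfm : AEMeasurable f (volume.restrict Ω) := (memLp_fn v).1.enorm
  have hL2 : ∫⁻ x in Ω, f x ^ (2 : ℝ) ≤ ENNReal.ofReal (R ^ 2 * |M|) := by
    have h1 : ∫⁻ x in Ω, f x ^ (2 : ℝ) = ENNReal.ofReal (‖fnMap Ω v‖ ^ 2) := by
      rw [ENNReal.ofReal_pow (norm_nonneg _), ofReal_norm, Lp.enorm_def, eLpNorm_two_sq]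
      refine lintegral_congr fun x => ?_
      rw [ENNReal.rpow_two]
      rfl
    rw [h1]
    refine ENNReal.ofReal_le_ofReal ?_
    calc ‖fnMap Ω v‖ ^ 2 ≤ (R * ‖hardyMap hn Ω v‖) ^ 2 :=
          pow_le_pow_left₀ (norm_nonneg _) (hR v) 2
      _ = R ^ 2 * ‖hardyMap hn Ω v‖ ^ 2 := mul_pow _ _ _
      _ ≤ R ^ 2 * |M| := by gcongr; exact hv.trans (le_abs_self M)
  have hLP : ∫⁻ x in Ω, f x ^ P ≤ ENNReal.ofReal ((S * y) ^ P) := by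
    have h1 := eLpNorm_sobolev_le_ofReal hn v
    rw [eLpNorm_eq_lintegral_rpow_enorm_toReal (by simp; linarith) ENNReal.ofReal_ne_top,
      ENNReal.toReal_ofReal (by linarith)] at h1
    have h2 := ENNReal.rpow_le_rpow h1 (show 0 ≤ P by linarith)
    rwa [← ENNReal.rpow_mul, one_div_mul_cancel (show P ≠ 0 by linarith), ENNReal.rpow_one,
      ENNReal.ofReal_rpow_of_nonneg (by positivity) (by linarith)] at h2
  have hint : ∫⁻ x in Ω, f x ^ r ≤
      ENNReal.ofReal ((R ^ 2 * |M|) ^ (1 - θ) * S ^ (P * θ) * (y ^ 2) ^ (n * (r - 2) / 4)) := by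
    calc ∫⁻ x in Ω, f x ^ r = ∫⁻ x in Ω, (f x ^ (2 : ℝ)) ^ (1 - θ) * (f x ^ P) ^ θ := by
          refine lintegral_congr fun x => ?_
          rw [← ENNReal.rpow_mul, ← ENNReal.rpow_mul, ← ENNReal.rpow_add_of_nonneg _ _
            (mul_nonneg two_pos.le (by linarith)) (mul_nonneg (by linarith) hθ0), ← hrθ]
      _ ≤ (∫⁻ x in Ω, f x ^ (2 : ℝ)) ^ (1 - θ) * (∫⁻ x in Ω, f x ^ P) ^ θ :=
          ENNReal.lintegral_mul_norm_pow_le (hfm.pow_const _) (hfm.pow_const _) (by linarith) hθ0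
            (by ring)
      _ ≤ ENNReal.ofReal (R ^ 2 * |M|) ^ (1 - θ) * ENNReal.ofReal ((S * y) ^ P) ^ θ := by
          gcongr
      _ = _ := by
          rw [ENNReal.ofReal_rpow_of_nonneg (by positivity) (by linarith),
            ENNReal.ofReal_rpow_of_nonneg (by positivity) hθ0,
            ← ENNReal.ofReal_mul (by positivity), ← Real.rpow_mul (by positivity),
            Real.mul_rpow hS0 hy0, ← Real.rpow_natCast y 2, ← Real.rpow_mul hy0, mul_assoc]
          congr 4
          rw [hPθ]
          push_cast
          ring
  have hm' : AEStronglyMeasurable (fun x => |fn v x| ^ r) (volume.restrict Ω) :=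
    ((memLp_fn v).1.aemeasurable.abs.pow_const r).aestronglyMeasurable
  have hfr : ∀ x, ENNReal.ofReal (|fn v x| ^ r) = f x ^ r := fun x => by
    rw [← ENNReal.ofReal_rpow_of_nonneg (abs_nonneg _) (by linarith), ← Real.norm_eq_abs,
      ofReal_norm]
  refine ⟨⟨hm', ?_⟩, ?_⟩
  · rw [hasFiniteIntegral_iff_ofReal (Eventually.of_forall fun x => by positivity)]
    simp only [hfr]
    exact hint.trans_lt ENNReal.ofReal_lt_top
  · rw [integral_eq_lintegral_of_nonneg_ae (Eventually.of_forall fun x => by positivity) hm']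
    simp only [hfr]
    exact ENNReal.toReal_le_of_le_ofReal (by positivity) hint

/-! ### The energy -/

variable {p : E n → ℝ → ℝ} {k : ℝ → ℝ} {kInf : ℝ}

theorem integrable_inv_exponent (hb : Bornology.IsBounded Ω) (hm : MeasurableSet Ω) {q : E n → ℝ}
    (hq : IsSubcritical Ω q) : Integrable (fun x => 1 / q x) (volume.restrict Ω) := by
  have : IsFiniteMeasure (volume.restrict Ω) := ⟨by
    rw [Measure.restrict_apply_univ]; exact hb.measure_lt_top⟩
  refine Integrable.of_bound (C := 1 / 2)
    (aemeasurable_const.div hq.aemeasurable).aestronglyMeasurable ?_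
  filter_upwards [ae_restrict_mem hm] with x hx
  have := hq.two_lt x hx
  rw [Real.norm_of_nonneg (by positivity)]
  exact one_div_le_one_div_of_le two_pos this.le

theorem abs_rpow_mul_self_mul_self {q : ℝ} (hq : 2 < q) (a : ℝ) :
    |a| ^ (q - 2) * a * a = |a| ^ q := by
  rw [mul_assoc, ← abs_mul_abs_self a, ← mul_assoc]
  rcases (abs_nonneg a).eq_or_lt with h0 | h0
  · rw [← h0, mul_zero, Real.zero_rpow (by linarith)]
  · rw [← Real.rpow_add_one h0.ne', ← Real.rpow_add_one h0.ne']
    ring_nf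

theorem integrable_abs_rpow (hn : 3 ≤ n) (hb : Bornology.IsBounded Ω) (hm : MeasurableSet Ω)
    {q : E n → ℝ} (hq : IsSubcritical Ω q) (v : H10 Ω) :
    Integrable (fun x => |fn v x| ^ q x) (volume.restrict Ω) := by
  refine ((memLp_power hn hb hm hq v).integrable_mul (memLp_fn v)).congr ?_
  filter_upwards [ae_restrict_mem hm] with x hx
  exact abs_rpow_mul_self_mul_self (hq.two_lt x hx) _

theorem integrable_inv_mul_abs_rpow (hn : 3 ≤ n) (hb : Bornology.IsBounded Ω)
    (hm : MeasurableSet Ω) {q : E n → ℝ} (hq : IsSubcritical Ω q) (v : H10 Ω) :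
    Integrable (fun x => 1 / q x * |fn v x| ^ q x) (volume.restrict Ω) := by
  refine (integrable_abs_rpow hn hb hm hq v).bdd_mul (c := 1)
    (aemeasurable_const.div hq.aemeasurable).aestronglyMeasurable ?_
  filter_upwards [ae_restrict_mem hm] with x hx
  have := hq.two_lt x hx
  rw [Real.norm_of_nonneg (by positivity), div_le_one (by positivity)]
  linarith

theorem inner_nemytskii_self (hn : 3 ≤ n) (hb : Bornology.IsBounded Ω) (hm : MeasurableSet Ω)
    {q : E n → ℝ} (hq : IsSubcritical Ω q) (v : H10 Ω) :
    inner ℝ (nemytskii q v) (fnMap Ω v) = ∫ x in Ω, |fn v x| ^ q x := by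
  rw [inner_nemytskii hn hb hm hq]
  refine integral_congr_ae ?_
  filter_upwards [ae_restrict_mem hm] with x hx
  exact abs_rpow_mul_self_mul_self (hq.two_lt x hx) _

namespace Admissible

variable (h : Admissible Ω p k kInf)
include h

theorem energyE_eq {t : ℝ} (ht : 0 ≤ t) (v : H10 Ω) :
    energyE p k kInf v t = 1 / 2 * ‖gradMap Ω v‖ ^ 2 -
      ∫ x in Ω, (k t * (1 / p x t * |fn v x| ^ p x t) - kInf * (1 / p x t)) := by
  have hm := h.isOpen.measurableSet
  rw [integral_sub ((integrable_inv_mul_abs_rpow h.three_le h.isBounded hm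
      (h.isSubcritical ht) v).const_mul _)
    ((integrable_inv_exponent h.isBounded hm (h.isSubcritical ht)).const_mul _),
    integral_const_mul, integral_const_mul, energyE, energyJ, gradNormSq_eq]
  ring

/-- The energy inequality before division by the time increment: it follows from the convexity of
`|a|^p` and the monotonicity of the energy density in `t`, so that no derivative of the nonlinear
term with respect to the exponent is needed. -/
theorem energyE_le {s t : ℝ} (hs : 0 ≤ s) (hst : s ≤ t) (v w : H10 Ω) :
    energyE p k kInf w t ≤ energyE p k kInf v s - inner ℝ (h.emb (h.field s v)) (h.emb (w - v))
      + 1 / 2 * ‖gradMap Ω (w - v)‖ ^ 2 := by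
  have hm := h.isOpen.measurableSet
  have ht := hs.trans hst
  have hqs := h.isSubcritical hs
  have hqt := h.isSubcritical ht
  have hint : ∀ {r : ℝ}, 0 ≤ r → ∀ z : H10 Ω, Integrable
      (fun x => k r * (1 / p x r * |fn z x| ^ p x r) - kInf * (1 / p x r))
      (volume.restrict Ω) := fun {r} hr z =>
    ((integrable_inv_mul_abs_rpow h.three_le h.isBounded hm
      (h.isSubcritical hr) z).const_mul _).sub
    ((integrable_inv_exponent h.isBounded hm (h.isSubcritical hr)).const_mul _)
  have hnem : Integrable (fun x => (|fn v x| ^ (p x s - 2) * fn v x) * fn (w - v) x)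
      (volume.restrict Ω) :=
    (memLp_power h.three_le h.isBounded hm hqs v).integrable_mul (memLp_fn (w - v))
  have hD : (∫ x in Ω, (k s * (1 / p x s * |fn v x| ^ p x s) - kInf * (1 / p x s))) +
      k s * ∫ x in Ω, (|fn v x| ^ (p x s - 2) * fn v x) * fn (w - v) x ≤
      ∫ x in Ω, (k t * (1 / p x t * |fn w x| ^ p x t) - kInf * (1 / p x t)) := by
    rw [← integral_const_mul, ← integral_add (hint hs v) (hnem.const_mul _)]
    refine integral_mono_ae ((hint hs v).add (hnem.const_mul _)) (hint ht w) ?_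
    filter_upwards [ae_restrict_mem hm, fn_sub w v] with x hx hsub
    have h1 := tangent_le_abs_rpow (hqs.two_lt x hx).le (fn v x) (fn w x)
    have h2 := energy_density_mono (a := fn w x) (h.coefficient.pos_of_nonneg hs).le
      (h.coefficient.monotoneOn hs ht hst) (h.coefficient.le_kInf ht)
      (by linarith [hqs.two_lt x hx]) (h.exponent.monotoneOn h.isOpen hx hs ht hst)
    have h3 := mul_le_mul_of_nonneg_left h1 (h.coefficient.pos_of_nonneg hs).le
    simp only [hsub, Pi.sub_apply]
    linarith
  rw [h.energyE_eq ht, h.energyE_eq hs, h.inner_emb_field,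
    inner_nemytskii h.three_le h.isBounded hm hqs]
  have hgrad : 1 / 2 * ‖gradMap Ω w‖ ^ 2 = 1 / 2 * ‖gradMap Ω v‖ ^ 2 +
      inner ℝ (gradMap Ω v) (gradMap Ω (w - v)) + 1 / 2 * ‖gradMap Ω (w - v)‖ ^ 2 := by
    have : gradMap Ω w = gradMap Ω v + gradMap Ω (w - v) := by rw [← map_add]; congr 1; abel
    rw [this, norm_add_sq_real]
    ring
  linarith

theorem two_mul_inner_emb_field {t : ℝ} (ht : 0 ≤ t) (v : H10 Ω) :
    2 * inner ℝ (h.emb (h.field t v)) (h.emb v) =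
      2 * k t * (∫ x in Ω, |fn v x| ^ p x t) - 2 * ‖gradMap Ω v‖ ^ 2 := by
  rw [h.inner_emb_field, inner_nemytskii_self h.three_le h.isBounded h.isOpen.measurableSet
    (h.isSubcritical ht), real_inner_self_eq_norm_sq]
  ring

theorem integral_inv_exponent_nonneg {t : ℝ} (ht : 0 ≤ t) : 0 ≤ ∫ x in Ω, 1 / p x t := by
  refine setIntegral_nonneg h.isOpen.measurableSet fun x hx => ?_
  have := (h.isSubcritical ht).two_lt x hx
  positivity

theorem neg_energyE_le {t : ℝ} (ht : 0 ≤ t) (v : H10 Ω) :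
    -energyE p k kInf v t ≤
      k t * (∫ x in Ω, 1 / p x t * |fn v x| ^ p x t) - 1 / 2 * ‖gradMap Ω v‖ ^ 2 := by
  have := mul_nonneg h.coefficient.kInf_pos.le (h.integral_inv_exponent_nonneg ht)
  rw [energyE, energyJ, gradNormSq_eq]
  linarith

/-- The norm of the solution grows at least at the rate `2 p⁻` times the negative energy. -/
theorem neg_energyE_le_inner {t : ℝ} (ht : 0 ≤ t) (v : H10 Ω) :
    2 * pMinus Ω p * -energyE p k kInf v t ≤ 2 * inner ℝ (h.emb (h.field t v)) (h.emb v) := by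
  have hm := h.isOpen.measurableSet
  have hq := h.isSubcritical ht
  have hp2 := h.exponent.two_lt
  have hk := h.coefficient.pos_of_nonneg ht
  have hI : pMinus Ω p * (∫ x in Ω, 1 / p x t * |fn v x| ^ p x t) ≤
      ∫ x in Ω, |fn v x| ^ p x t := by
    rw [← integral_const_mul]
    refine integral_mono_ae ((integrable_inv_mul_abs_rpow h.three_le h.isBounded hm hq
      v).const_mul _) (integrable_abs_rpow h.three_le h.isBounded hm hq v) ?_
    filter_upwards [ae_restrict_mem hm] with x hx
    have h1 := (h.exponent.bounds hx ht).1
    have h2 := hq.two_lt x hx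
    rw [← mul_assoc, mul_one_div]
    exact mul_le_of_le_one_left (by positivity) ((div_le_one (by linarith)).2 h1)
  rw [h.two_mul_inner_emb_field ht]
  have h1 := mul_le_mul_of_nonneg_left (h.neg_energyE_le ht v)
    (show 0 ≤ 2 * pMinus Ω p by linarith)
  have h2 := mul_le_mul_of_nonneg_left hI hk.le
  nlinarith [sq_nonneg ‖gradMap Ω v‖]

/-- If `‖v/|x|‖₂` stays bounded, the part of the nonlinearity with exponents below `2 + 3/n` is of
lower order, so that the constant `p⁻` in `neg_energyE_le_inner` may be replaced by `2 + 3/n`. -/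
theorem exists_neg_energyE_le_inner (M : ℝ) : ∃ C : ℝ, ∀ t, 0 ≤ t → ∀ v : H10 Ω,
    ‖hardyMap h.three_le Ω v‖ ^ 2 ≤ M →
      2 * (2 + 3 / (n : ℝ)) * (-energyE p k kInf v t - C) ≤
        2 * inner ℝ (h.emb (h.field t v)) (h.emb v) := by
  have hm := h.isOpen.measurableSet
  have h3 : (3 : ℝ) ≤ n := by exact_mod_cast h.three_le
  have hkI := h.coefficient.kInf_pos
  have : IsFiniteMeasure (volume.restrict Ω) := ⟨by
    rw [Measure.restrict_apply_univ]; exact h.isBounded.measure_lt_top⟩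
  set r : ℝ := 2 + 3 / (n : ℝ) with hr
  have hn0 : 0 < 3 / (n : ℝ) := by positivity
  have hrP : r ≤ sobolevExp n := by
    rw [hr, sobolevExp, ← sub_nonneg]
    have h2 : (0 : ℝ) < n - 2 := by linarith
    have : 2 * (n : ℝ) / (n - 2) - (2 + 3 / n) = (n + 6) / (n * (n - 2)) := by
      field_simp; ring
    rw [this]; positivity
  obtain ⟨C, hC0, hC⟩ := exists_integral_rpow_le h.three_le h.isBounded hm
    (show 2 ≤ r by linarith) hrP M
  -- the interpolation exponent is below one
  have hθ : n * (r - 2) / 4 = 3 / 4 := by rw [hr]; field_simp; ring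
  rw [hθ] at hC
  obtain ⟨D, hD0, hD⟩ := exists_mul_rpow_le (b := kInf * r * C) (ε := r - 2) (θ := 3 / 4)
    (by positivity) (by linarith) (by norm_num) (by norm_num)
  set V := ∫ _ in Ω, (1 : ℝ) with hV
  have hV0 : 0 ≤ V := integral_nonneg fun _ => zero_le_one
  refine ⟨(kInf * r * V + D) / (2 * r), fun t ht v hv => ?_⟩
  obtain ⟨hint, hle⟩ := hC v hv
  have hq := h.isSubcritical ht
  have hk := h.coefficient.pos_of_nonneg ht
  have hkle := h.coefficient.le_kInf ht
  set y := ‖gradMap Ω v‖ ^ 2 with hy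
  have hy0 : 0 ≤ y := by positivity
  have hone : Integrable (fun _ : E n => (1 : ℝ)) (volume.restrict Ω) := integrable_const _
  have hI1 := integrable_inv_mul_abs_rpow h.three_le h.isBounded hm hq v
  have hsum : Integrable (fun x => 1 + |fn v x| ^ r) (volume.restrict Ω) := hone.add hint
  have hI : r * (∫ x in Ω, 1 / p x t * |fn v x| ^ p x t) - r / 2 * (V + ∫ x in Ω, |fn v x| ^ r) ≤
      ∫ x in Ω, |fn v x| ^ p x t := by
    rw [hV, ← integral_add hone hint, ← integral_const_mul, ← integral_const_mul,
      ← integral_sub (hI1.const_mul _) (hsum.const_mul _)]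
    refine integral_mono_ae ((hI1.const_mul _).sub (hsum.const_mul _))
      (integrable_abs_rpow h.three_le h.isBounded hm hq v) ?_
    filter_upwards [ae_restrict_mem hm] with x hx
    have h2 := hq.two_lt x hx
    have h4 : 0 ≤ |fn v x| ^ r := by positivity
    have h5 : 0 ≤ |fn v x| ^ p x t := by positivity
    rcases le_total r (p x t) with h6 | h6
    · have : r * (1 / p x t * |fn v x| ^ p x t) ≤ |fn v x| ^ p x t := by
        rw [← mul_assoc, mul_one_div]
        exact mul_le_of_le_one_left h5 ((div_le_one (by linarith)).2 h6)
      have : 0 ≤ r / 2 * (1 + |fn v x| ^ r) := by positivity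
      linarith
    · have h7 : |fn v x| ^ p x t ≤ 1 + |fn v x| ^ r :=
        rpow_le_one_add_rpow (abs_nonneg _) (by linarith) h6
      have h8 : r * (1 / p x t * |fn v x| ^ p x t) ≤ r / 2 * |fn v x| ^ p x t := by
        rw [← mul_assoc, mul_one_div]
        gcongr
      have h9 : r / 2 * |fn v x| ^ p x t ≤ r / 2 * (1 + |fn v x| ^ r) := by gcongr
      linarith
  rw [h.two_mul_inner_emb_field ht]
  have e1 := mul_le_mul_of_nonneg_left (h.neg_energyE_le ht v) (show 0 ≤ 2 * r by linarith)
  have e2 := mul_le_mul_of_nonneg_left hI (show 0 ≤ 2 * k t by linarith)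
  have e3 : k t * (V + ∫ x in Ω, |fn v x| ^ r) ≤ kInf * (V + C * y ^ (3 / 4 : ℝ)) := by
    refine mul_le_mul hkle (by linarith) ?_ hkI.le
    have : 0 ≤ ∫ x in Ω, |fn v x| ^ r := integral_nonneg fun x => by positivity
    linarith
  have e4 := mul_le_mul_of_nonneg_left e3 (show 0 ≤ r by linarith)
  have e5 := hD y hy0
  have e6 : 2 * r * ((kInf * r * V + D) / (2 * r)) = kInf * r * V + D := by
    have : r ≠ 0 := by positivity
    field_simp
  rw [mul_sub, e6]
  nlinarith

/-- If `‖v/|x|‖₂` stays bounded, the negative energy is bounded by a power of `‖∇v‖₂²` that is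
smaller than `(2 + 3/n)/2`. -/
theorem exists_neg_energyE_le_rpow (M : ℝ) : ∃ (C σ : ℝ), 0 ≤ C ∧ 0 ≤ σ ∧
    σ < (2 + 3 / (n : ℝ)) / 2 ∧ ∀ t, 0 ≤ t → ∀ v : H10 Ω, ‖hardyMap h.three_le Ω v‖ ^ 2 ≤ M →
      -energyE p k kInf v t ≤ C * (1 + (‖h.emb v‖ ^ 2) ^ σ) := by
  have hm := h.isOpen.measurableSet
  have h3 : (3 : ℝ) ≤ n := by exact_mod_cast h.three_le
  have h2 : (0 : ℝ) < n - 2 := by linarith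
  have hkI := h.coefficient.kInf_pos
  have : IsFiniteMeasure (volume.restrict Ω) := ⟨by
    rw [Measure.restrict_apply_univ]; exact h.isBounded.measure_lt_top⟩
  by_cases hne : Ω.Nonempty
  swap
  · refine ⟨0, 0, le_rfl, le_rfl, by positivity, fun t ht v _ => ?_⟩
    have := h.neg_energyE_le ht v
    rw [not_nonempty_iff_eq_empty] at hne
    subst hne
    simp only [Measure.restrict_empty, integral_zero_measure, mul_zero] at this
    nlinarith [sq_nonneg ‖gradMap (∅ : Set (E n)) v‖]
  obtain ⟨x₀, hx₀⟩ := hne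
  set r := pPlus Ω p with hr
  have hr2 : 2 < r := by
    have h4 := h.exponent.bounds hx₀ le_rfl
    linarith [h.exponent.two_lt, h4.1, h4.2]
  have hrlt : r < 2 + growthExp n := h.exponent.pPlus_lt h.three_le
  have hrP : r ≤ sobolevExp n := by
    refine hrlt.le.trans ?_
    rw [growthExp, sobolevExp, ← sub_nonneg]
    have : 2 * (n : ℝ) / (n - 2) - (2 + 2 / (n - 2)) = 2 / (n - 2) := by
      field_simp; ring
    rw [this]; positivity
  obtain ⟨C, hC0, hC⟩ := exists_integral_rpow_le h.three_le h.isBounded hm hr2.le hrP M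
  set V := ∫ _ in Ω, (1 : ℝ) with hV
  have hV0 : 0 ≤ V := integral_nonneg fun _ => zero_le_one
  have hσ0 : 0 ≤ n * (r - 2) / 4 := by
    have : 0 ≤ r - 2 := by linarith
    positivity
  refine ⟨kInf * (V + C), n * (r - 2) / 4, by positivity, hσ0, ?_, fun t ht v hv => ?_⟩
  · have e1 : n * (r - 2) / 4 < n * growthExp n / 4 := by
      have : r - 2 < growthExp n := by linarith
      gcongr
    refine e1.trans_le ?_
    rw [growthExp, ← sub_nonneg]
    have : (2 + 3 / (n : ℝ)) / 2 - n * (2 / (n - 2)) / 4 =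
        (n - 3) * (n + 2) / (2 * n * (n - 2)) := by
      field_simp; ring
    rw [this]
    have : (0 : ℝ) ≤ n - 3 := by linarith
    positivity
  · obtain ⟨hint, hle⟩ := hC v hv
    have hq := h.isSubcritical ht
    have hk := h.coefficient.pos_of_nonneg ht
    have hone : Integrable (fun _ : E n => (1 : ℝ)) (volume.restrict Ω) := integrable_const _
    have hI : (∫ x in Ω, 1 / p x t * |fn v x| ^ p x t) ≤ V + ∫ x in Ω, |fn v x| ^ r := by
      rw [hV, ← integral_add hone hint]
      refine integral_mono_ae (integrable_inv_mul_abs_rpow h.three_le h.isBounded hm hq v)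
        (hone.add hint) ?_
      filter_upwards [ae_restrict_mem hm] with x hx
      have h5 := hq.two_lt x hx
      have h6 : |fn v x| ^ p x t ≤ 1 + |fn v x| ^ r :=
        rpow_le_one_add_rpow (abs_nonneg _) (by linarith) (h.exponent.bounds hx ht).2
      refine le_trans (mul_le_of_le_one_left (by positivity) ?_) h6
      rw [div_le_one (by linarith)]
      linarith
    have hyL : ‖gradMap Ω v‖ ^ 2 ≤ ‖h.emb v‖ ^ 2 :=
      pow_le_pow_left₀ (norm_nonneg _) (norm_gradMap_le_energyEmb h.three_le v) 2
    set L := ‖h.emb v‖ ^ 2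
    set σ := n * (r - 2) / 4
    have e1 : C * (‖gradMap Ω v‖ ^ 2) ^ σ ≤ C * L ^ σ := by gcongr
    have hLσ : 0 ≤ L ^ σ := by positivity
    have e2 := h.neg_energyE_le ht v
    have hI0 : 0 ≤ ∫ x in Ω, 1 / p x t * |fn v x| ^ p x t := by
      refine setIntegral_nonneg hm fun x hx => ?_
      have h5 := hq.two_lt x hx
      positivity
    have e3 : k t * (∫ x in Ω, 1 / p x t * |fn v x| ^ p x t) ≤ kInf * (V + C * L ^ σ) :=
      mul_le_mul (h.coefficient.le_kInf ht) (by linarith) hI0 hkI.le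
    have e4 : V + C * L ^ σ ≤ (V + C) * (1 + L ^ σ) := by nlinarith
    have e5 := mul_le_mul_of_nonneg_left e4 hkI.le
    nlinarith [sq_nonneg ‖gradMap Ω v‖]

end Admissible

end PseudoParabolic

namespace PseudoParabolic

variable {n : ℕ} {Ω : Set (E n)} {p : E n → ℝ → ℝ} {k : ℝ → ℝ} {kInf : ℝ}

namespace Admissible

variable (h : Admissible Ω p k kInf)

/-! ### The concavity method along a solution -/

/-- `u` is a solution of `u' = Φ(t, u)` on `[0,b)` in `W₀^{1,2}(Ω)`; the derivative is one-sided at `0`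
and two-sided elsewhere. -/
def IsODESolIco (b : ℝ) (u : ℝ → H10 Ω) : Prop :=
  ∀ t ∈ Ico 0 b, HasDerivWithinAt u (h.field t (u t)) (Ici 0) t

variable {h} {u : ℝ → H10 Ω} {b : ℝ}

theorem IsODESolIco.continuousOn (hu : h.IsODESolIco b u) : ContinuousOn u (Ico 0 b) := fun t ht =>
  (hu t ht).continuousWithinAt.mono Ico_subset_Ici_self

theorem IsODESolIco.hasDerivWithinAt_normSq (hu : h.IsODESolIco b u) {t : ℝ} (ht : t ∈ Ico 0 b) :
    HasDerivWithinAt (fun t => ‖h.emb (u t)‖ ^ 2)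
      (2 * inner ℝ (h.emb (h.field t (u t))) (h.emb (u t))) (Ici 0) t := by
  have := ((h.emb).hasFDerivAt.comp_hasDerivWithinAt t (hu t ht)).norm_sq
  rw [real_inner_comm]
  exact this

/-- The first-order expansion of the right-hand side of `energyE_le` along a differentiable curve. -/
theorem eventually_abs_inner_emb_sub_le {s : Set ℝ} {t ε : ℝ} {v' : H10 Ω} (hε : 0 < ε)
    (hu : HasDerivWithinAt u v' s t) :
    ∀ᶠ r in 𝓝[s] t, |inner ℝ (h.emb v') (h.emb (u r - u t)) - (r - t) * ‖h.emb v'‖ ^ 2|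
      + 1 / 2 * ‖gradMap Ω (u r - u t)‖ ^ 2 ≤ ε * |r - t| := by
  have hd := hu.sub_const (u t)
  have h1 : HasDerivWithinAt (fun r => inner ℝ (h.emb v') (h.emb (u r - u t)))
      (‖h.emb v'‖ ^ 2) s t := by
    have := ((innerSL ℝ (h.emb v')).comp h.emb).hasFDerivAt.comp_hasDerivWithinAt t hd
    rw [← real_inner_self_eq_norm_sq]
    exact this
  have h2 : HasDerivWithinAt (fun r => ‖gradMap Ω (u r - u t)‖ ^ 2) 0 s t := by
    have := ((gradMap Ω).hasFDerivAt.comp_hasDerivWithinAt t hd).norm_sq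
    simp only [Function.comp_apply, sub_self, map_zero, inner_zero_left, mul_zero] at this
    exact this
  filter_upwards [eventually_sub_le_of_hasDerivWithinAt (half_pos hε) h1,
    eventually_sub_le_of_hasDerivWithinAt (half_pos hε) h2] with r hr1 hr2
  simp only [sub_self, map_zero, inner_zero_right, sub_zero, norm_zero, mul_zero, ne_eq,
    OfNat.ofNat_ne_zero, not_false_eq_true, zero_pow] at hr1 hr2
  rw [abs_of_nonneg (sq_nonneg _)] at hr2
  have := abs_nonneg (r - t)
  nlinarith

/-- The energy inequality: the negative energy grows at least at the rate
`‖u_t/|x|‖² + ‖∇u_t‖²`. -/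
theorem IsODESolIco.exists_le_neg_energyE (hu : h.IsODESolIco b u) : ∃ G : ℝ → ℝ,
    G 0 = -energyE p k kInf (u 0) 0 ∧
    (∀ t ∈ Ico 0 b, HasDerivWithinAt G (‖h.emb (h.field t (u t))‖ ^ 2) (Ici 0) t) ∧
    ∀ t ∈ Ico 0 b, G t ≤ -energyE p k kInf (u t) t := by
  have hg : ContinuousOn (fun t => ‖h.emb (h.field t (u t))‖ ^ 2) (Ico 0 b) :=
    ((h.emb.continuous.comp_continuousOn
      (h.continuousOn_field_comp Ico_subset_Ici_self hu.continuousOn)).norm).pow 2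
  let G : ℝ → ℝ := fun t =>
    -energyE p k kInf (u 0) 0 + ∫ s in (0 : ℝ)..t, ‖h.emb (h.field s (u s))‖ ^ 2
  have hG0 : G 0 = -energyE p k kInf (u 0) 0 := by simp [G]
  have hG : ∀ t ∈ Ico 0 b, HasDerivWithinAt G (‖h.emb (h.field t (u t))‖ ^ 2) (Ici 0) t := by
    intro t ht
    obtain ⟨c, htc, hcb⟩ := exists_between ht.2
    have hgc := hg.mono (Icc_subset_Ico_right hcb)
    have htI : t ∈ Icc 0 c := ⟨ht.1, htc.le⟩
    have : Fact (t ∈ Icc 0 c) := ⟨htI⟩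
    have hd : HasDerivWithinAt (fun t => ∫ s in (0 : ℝ)..t, ‖h.emb (h.field s (u s))‖ ^ 2)
        (‖h.emb (h.field t (u t))‖ ^ 2) (Icc 0 c) t := by
      refine intervalIntegral.integral_hasDerivWithinAt_right ?_ ?_ (hgc t htI)
      · refine (hgc.mono ?_).intervalIntegrable
        exact uIcc_subset_Icc ⟨le_rfl, ht.1.trans htc.le⟩ htI
      · exact hgc.stronglyMeasurableAtFilter_nhdsWithin measurableSet_Icc t
    refine (hd.const_add _).mono_of_mem_nhdsWithin ?_
    rw [← Ici_inter_Iic]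
    exact inter_mem self_mem_nhdsWithin (mem_nhdsWithin_of_mem_nhds (Iic_mem_nhds htc))
  refine ⟨G, hG0, hG, fun t ht => ?_⟩
  have := add_sub_le_of_local (F := fun t => -energyE p k kInf (u t) t) hG ?_ ?_ ht
  · simpa [hG0] using this
  · intro t ht ε hε
    filter_upwards [eventually_abs_inner_emb_sub_le (h := h) hε
      ((hu t ht).mono (Ioi_subset_Ici ht.1)), self_mem_nhdsWithin] with s hs hst
    have hE := h.energyE_le ht.1 (le_of_lt hst) (u t) (u s)
    rw [abs_of_pos (show 0 < s - t from sub_pos.2 hst)] at hs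
    have := neg_abs_le (inner ℝ (h.emb (h.field t (u t))) (h.emb (u s - u t)) -
      (s - t) * ‖h.emb (h.field t (u t))‖ ^ 2)
    linarith
  · intro t ht ε hε
    have htI : t ∈ Ico 0 b := Ioo_subset_Ico_self ht
    have hd : HasDerivWithinAt u (h.field t (u t)) (Iio t) t :=
      ((hu t htI).hasDerivAt (Ici_mem_nhds ht.1)).hasDerivWithinAt
    have hO : ∃ C : ℝ, 0 < C ∧ ∀ᶠ s in 𝓝[<] t, ‖h.emb (u s - u t)‖ ≤ C * |s - t| := by
      have h1 := (h.emb.hasFDerivAt.comp_hasDerivWithinAt t hd).hasFDerivWithinAt.isBigO_sub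
      obtain ⟨C, hC, hb⟩ := h1.exists_pos
      refine ⟨C, hC, hb.bound.mono fun s hs => ?_⟩
      simpa [map_sub] using hs
    obtain ⟨C, hC, hC'⟩ := hO
    have hcont : Tendsto (fun s => h.emb (h.field s (u s))) (𝓝[<] t)
        (𝓝 (h.emb (h.field t (u t)))) := by
      have := (h.emb.continuous.comp_continuousOn
        (h.continuousOn_field_comp Ico_subset_Ici_self hu.continuousOn)) t htI
      exact this.tendsto.mono_left (nhdsWithin_le_iff.2 (mem_of_superset
        (Ioo_mem_nhdsLT ht.1) fun s hs => ⟨hs.1.le, hs.2.trans ht.2⟩))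
    have hclose := (tendsto_iff_norm_sub_tendsto_zero.1 hcont).eventually
      (gt_mem_nhds (show 0 < ε / 2 / C by positivity))
    filter_upwards [eventually_abs_inner_emb_sub_le (h := h) (half_pos hε) hd, hC', hclose,
      Ioo_mem_nhdsLT ht.1] with s h1 h2 h3 hs
    have hE := h.energyE_le hs.1.le hs.2.le (u s) (u t)
    have hneg : u t - u s = -(u s - u t) := by abel
    rw [hneg, map_neg, map_neg, norm_neg, inner_neg_right] at hE
    rw [abs_of_neg (sub_neg.2 hs.2)] at h1 h2
    set A := h.emb (h.field t (u t))
    set B := h.emb (h.field s (u s))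
    set D := h.emb (u s - u t)
    have h4 : inner ℝ B D = inner ℝ A D + inner ℝ (B - A) D := by rw [inner_sub_left]; ring
    have h5 : inner ℝ (B - A) D ≤ ε / 2 * (t - s) := by
      refine (real_inner_le_norm _ _).trans ?_
      calc ‖B - A‖ * ‖D‖ ≤ ε / 2 / C * (C * -(s - t)) := by
            refine mul_le_mul h3.le h2 (norm_nonneg _) (by positivity)
        _ = ε / 2 * (t - s) := by field_simp; ring
    have h6 := le_abs_self (inner ℝ A D - (s - t) * ‖A‖ ^ 2)
    linarith

theorem emb_normSq_pos (h : Admissible Ω p k kInf) {t : ℝ} (ht : 0 ≤ t) {v : H10 Ω}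
    (hv : energyE p k kInf v t < 0) : 0 < ‖h.emb v‖ ^ 2 := by
  have h1 := h.neg_energyE_le_inner ht v
  have hp := h.exponent.two_lt
  by_contra hcon
  have h0 : h.emb v = 0 := by
    rw [← norm_eq_zero]
    exact pow_eq_zero_iff two_ne_zero |>.1 (le_antisymm (not_lt.1 hcon) (sq_nonneg _))
  rw [h0, inner_zero_right] at h1
  nlinarith

theorem inner_sq_le {t : ℝ} (v : H10 Ω) : (2 * inner ℝ (h.emb (h.field t v)) (h.emb v)) ^ 2 ≤
    4 * ‖h.emb v‖ ^ 2 * ‖h.emb (h.field t v)‖ ^ 2 := by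
  have h1 := abs_real_inner_le_norm (h.emb (h.field t v)) (h.emb v)
  have h2 := sq_le_sq' (neg_le_of_abs_le h1) (le_of_abs_le h1)
  nlinarith

/-- The norm of a solution with negative initial energy does not decrease. -/
theorem IsODESolIco.monotoneOn_normSq (hu : h.IsODESolIco b u)
    (hE : energyE p k kInf (u 0) 0 < 0) :
    MonotoneOn (fun t => ‖h.emb (u t)‖ ^ 2) (Ico 0 b) := by
  obtain ⟨G, hG0, hG, hGle⟩ := hu.exists_le_neg_energyE
  have hGmono := monotoneOn_Ico_of_hasDerivWithinAt hG fun t _ => sq_nonneg _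
  refine monotoneOn_Ico_of_hasDerivWithinAt (fun t ht => hu.hasDerivWithinAt_normSq ht)
    fun t ht => ?_
  have h1 := hGmono ⟨le_rfl, ht.1.trans_lt ht.2⟩ ht ht.1
  have h2 := hGle t ht
  have hp := h.exponent.two_lt
  refine le_trans ?_ (h.neg_energyE_le_inner ht.1 (u t))
  exact mul_nonneg (by linarith) (by linarith)

theorem IsODESolIco.normSq_pos (hu : h.IsODESolIco b u) (hE : energyE p k kInf (u 0) 0 < 0) {t : ℝ}
    (ht : t ∈ Ico 0 b) : 0 < ‖h.emb (u t)‖ ^ 2 :=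
  (emb_normSq_pos h le_rfl hE).trans_le
    (hu.monotoneOn_normSq hE ⟨le_rfl, ht.1.trans_lt ht.2⟩ ht ht.1)

/-- A solution with negative initial energy does not exist beyond the time given by the concavity
method. -/
theorem IsODESolIco.time_bound (hu : h.IsODESolIco b u) (hE : energyE p k kInf (u 0) 0 < 0) {t : ℝ}
    (ht : t ∈ Ico 0 b) : t ≤ ‖h.emb (u 0)‖ ^ 2 /
      (pMinus Ω p * (2 - pMinus Ω p) * energyE p k kInf (u 0) 0) := by
  obtain ⟨G, hG0, hG, hGle⟩ := hu.exists_le_neg_energyE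
  have hp := h.exponent.two_lt
  have := levine_time_bound (q := pMinus Ω p / 2) (by linarith)
    (fun t ht => hu.hasDerivWithinAt_normSq ht) hG (fun t ht => hu.normSq_pos hE ht)
    (by rw [hG0]; linarith) (fun t ht => ?_) (fun t _ => inner_sq_le (u t)) ht
  · rw [sub_zero, hG0] at this
    refine this.trans_eq ?_
    congr 1
    ring
  · refine le_trans ?_ (h.neg_energyE_le_inner ht.1 (u t))
    have := mul_le_mul_of_nonneg_left (hGle t ht) (show 0 ≤ 2 * pMinus Ω p by linarith)
    linarith

/-- If `‖u/|x|‖₂` stays bounded near the end of the interval, so does the whole norm. -/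
theorem IsODESolIco.exists_normSq_le (hu : h.IsODESolIco b u) (hE : energyE p k kInf (u 0) 0 < 0)
    {a M : ℝ} (ha : a ∈ Ico 0 b)
    (hM : ∀ t ∈ Ico a b, ‖hardyMap h.three_le Ω (u t)‖ ^ 2 ≤ M) :
    ∃ B : ℝ, ∀ t ∈ Ico a b, ‖h.emb (u t)‖ ^ 2 ≤ B := by
  obtain ⟨G, hG0, hG, hGle⟩ := hu.exists_le_neg_energyE
  obtain ⟨C, hC⟩ := h.exists_neg_energyE_le_inner M
  obtain ⟨C', σ, hC'0, hσ0, hσ, hC'⟩ := h.exists_neg_energyE_le_rpow M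
  have hLmono := hu.monotoneOn_normSq hE
  have hsub : ∀ {c}, 0 ≤ c → ∀ {t}, t ∈ Ico c b → t ∈ Ico 0 b :=
    fun hc _ ht => ⟨hc.trans ht.1, ht.2⟩
  by_cases hcase : ∃ c ∈ Ico a b, C < G c
  · -- the concavity method makes the energy grow faster than the interpolation allows
    obtain ⟨c, hc, hCc⟩ := hcase
    have hc0 : 0 ≤ c := ha.1.trans hc.1
    have hq : 0 < (2 + 3 / (n : ℝ)) / 2 := by positivity
    have hlow := fun t ht => levine_lower_bound (a := c) (b := b) (F := fun t => G t - C) hq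
      (fun t ht => (hu.hasDerivWithinAt_normSq (hsub hc0 ht)).mono (Ici_subset_Ici.2 hc0))
      (fun t ht => ((hG t (hsub hc0 ht)).mono (Ici_subset_Ici.2 hc0)).sub_const C)
      (fun t ht => hu.normSq_pos hE (hsub hc0 ht)) (by linarith)
      (fun t ht => by
        refine le_trans ?_ (hC t (hsub hc0 ht).1 (u t) (hM t ⟨hc.1.trans ht.1, ht.2⟩))
        have h1 := hGle t (hsub hc0 ht)
        have h2 := mul_le_mul_of_nonneg_left h1 (show 0 ≤ 2 * (2 + 3 / (n : ℝ)) by positivity)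
        linarith)
      (fun t _ => inner_sq_le (u t)) (t := t) ht
    have hLc := hu.normSq_pos hE (hsub hc0 ⟨le_rfl, hc.2⟩)
    obtain ⟨B, hB⟩ := exists_bound_of_rpow_le (c := (G c - C) /
      (‖h.emb (u c)‖ ^ 2) ^ ((2 + 3 / (n : ℝ)) / 2)) (C := C' + |C|) (div_pos (by linarith)
        (Real.rpow_pos_of_pos hLc _)) (by positivity) hσ0 hσ
    have hcB : ∀ t ∈ Ico c b, ‖h.emb (u t)‖ ^ 2 ≤ B := by
      intro t ht
      refine hB _ (sq_nonneg _) ((hlow t ht).trans ?_)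
      have h1 := hGle t (hsub hc0 ht)
      have h2 := hC' t (hsub hc0 ht).1 (u t) (hM t ⟨hc.1.trans ht.1, ht.2⟩)
      have h3 := neg_abs_le C
      have h4 : 0 ≤ (‖h.emb (u t)‖ ^ 2) ^ σ := by positivity
      have h5 : 0 ≤ |C| * (‖h.emb (u t)‖ ^ 2) ^ σ := by positivity
      linarith
    refine ⟨B, fun t ht => ?_⟩
    rcases le_total c t with h1 | h1
    · exact hcB t ⟨h1, ht.2⟩
    · exact (hLmono (hsub ha.1 ht) (hsub hc0 ⟨le_rfl, hc.2⟩) h1).trans (hcB c ⟨le_rfl, hc.2⟩)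
  · -- the total dissipation is bounded
    push Not at hcase
    set D := Real.exp (-a) * ‖h.emb (u a)‖ ^ 2 + (C - G a) with hD
    refine ⟨Real.exp b * |D|, fun t ht => ?_⟩
    have h1 := exp_neg_mul_sub_le (a := a) (b := b) ha.1
      (fun t ht => (hu.hasDerivWithinAt_normSq (hsub ha.1 ht)).mono (Ici_subset_Ici.2 ha.1))
      (fun t ht => (hG t (hsub ha.1 ht)).mono (Ici_subset_Ici.2 ha.1))
      (fun t _ => sq_nonneg _) (fun t _ => by
        have h2 := real_inner_le_norm (h.emb (h.field t (u t))) (h.emb (u t))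
        nlinarith [sq_nonneg (‖h.emb (h.field t (u t))‖ - ‖h.emb (u t)‖)]) ht
    have h2 := hcase t ht
    have h3 : Real.exp (-t) * ‖h.emb (u t)‖ ^ 2 ≤ |D| := by
      refine le_trans ?_ (le_abs_self D)
      rw [hD]; linarith
    have h4 : ‖h.emb (u t)‖ ^ 2 = Real.exp t * (Real.exp (-t) * ‖h.emb (u t)‖ ^ 2) := by
      rw [← mul_assoc, ← Real.exp_add, add_neg_cancel, Real.exp_zero, one_mul]
    rw [h4]
    gcongr
    exact ht.2.le

/-! ### Continuation -/

/-- A solution that stays bounded has a limit at the end of the interval. -/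
theorem IsODESolIco.exists_tendsto (hu : h.IsODESolIco b u) {a B : ℝ} (ha : a ∈ Ico 0 b)
    (hB : ∀ t ∈ Ico a b, ‖h.emb (u t)‖ ^ 2 ≤ B) : ∃ v, Tendsto u (𝓝[<] b) (𝓝 v) := by
  obtain ⟨K, hK⟩ := exists_norm_le_energyEmb h.three_le h.isBounded h.isOpen.measurableSet
  obtain ⟨M, hM0, hM⟩ := h.exists_field_bound (K * √B)
  have hLip : LipschitzOnWith M.toNNReal u (Ico a b) := by
    refine (convex_Ico a b).lipschitzOnWith_of_nnnorm_hasDerivWithin_le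
      (f' := fun t => h.field t (u t)) (fun t ht => ?_) fun t ht => ?_
    · exact (hu t ⟨ha.1.trans ht.1, ht.2⟩).mono
        (Ico_subset_Ici_self.trans (Ici_subset_Ici.2 ha.1))
    · rw [← NNReal.coe_le_coe, coe_nnnorm, Real.coe_toNNReal _ hM0]
      refine hM t (ha.1.trans ht.1) (u t) ((hK _).trans ?_)
      exact mul_le_mul_of_nonneg_left (Real.le_sqrt_of_sq_le (hB t ht)) (NNReal.coe_nonneg _)
  refine cauchy_map_iff_exists_tendsto.1 ?_
  refine (cauchy_nhds.mono nhdsWithin_le_nhds).map_of_le hLip.uniformContinuousOn ?_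
  exact le_principal_iff.2 (mem_of_superset (Ioo_mem_nhdsLT ha.2) Ioo_subset_Ico_self)

/-- Local existence by Picard–Lindelöf. -/
theorem exists_local_solution (h : Admissible Ω p k kInf) {t₀ : ℝ} (ht₀ : 0 ≤ t₀) (v₀ : H10 Ω) :
    ∃ δ > 0, ∃ v : ℝ → H10 Ω, v t₀ = v₀ ∧ ∀ t ∈ Icc t₀ (t₀ + δ),
      HasDerivWithinAt v (h.field t (v t)) (Icc t₀ (t₀ + δ)) t := by
  obtain ⟨K, hK⟩ := h.exists_field_lipschitz (‖v₀‖ + 1)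
  obtain ⟨M, hM0, hM⟩ := h.exists_field_bound (‖v₀‖ + 1)
  have hball : ∀ v ∈ Metric.closedBall v₀ ((1 : ℝ≥0) : ℝ), ‖v‖ ≤ ‖v₀‖ + 1 := by
    intro v hv
    rw [mem_closedBall_iff_norm] at hv
    have := norm_le_norm_add_norm_sub v₀ v
    rw [norm_sub_rev] at this
    exact this.trans (by simpa using hv)
  have hδ : 0 < 1 / (M + 1) := by positivity
  have hPL : IsPicardLindelof h.field (tmin := t₀) (tmax := t₀ + 1 / (M + 1))
      ⟨t₀, le_rfl, by linarith⟩ v₀ 1 0 M.toNNReal K := by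
    refine ⟨fun t ht => ?_, fun v _ => ?_, fun t ht v hv => ?_, ?_⟩
    · refine LipschitzOnWith.of_dist_le_mul fun v hv w hw => ?_
      rw [dist_eq_norm, dist_eq_norm]
      exact hK t (ht₀.trans ht.1) v w (hball v hv) (hball w hw)
    · exact (h.continuousOn_field v).mono fun t ht => ht₀.trans ht.1
    · rw [Real.coe_toNNReal _ hM0]
      exact hM t (ht₀.trans ht.1) v (hball v hv)
    · rw [Real.coe_toNNReal _ hM0]
      simp only [add_sub_cancel_left, sub_self, NNReal.coe_one, NNReal.coe_zero, sub_zero]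
      rw [max_eq_left hδ.le, mul_one_div, div_le_one (by positivity)]
      linarith
  obtain ⟨v, hv0, hv⟩ := hPL.exists_eq_forall_mem_Icc_hasDerivWithinAt₀
  exact ⟨_, hδ, v, hv0, hv⟩

/-- A bounded solution on `[0,b)` is the restriction of a solution on a longer interval. -/
theorem IsODESolIco.exists_extension (hu : h.IsODESolIco b u) {v₀ : H10 Ω} (hb : 0 < b)
    (hlim : Tendsto u (𝓝[<] b) (𝓝 v₀)) :
    ∃ δ > 0, ∃ V : ℝ → H10 Ω, (∀ t < b, V t = u t) ∧ h.IsODESol (b + δ) V := by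
  obtain ⟨δ, hδ, v, hv0, hv⟩ := h.exists_local_solution hb.le v₀
  set V : ℝ → H10 Ω := fun t => if t < b then u t else v t with hV
  have hVu : ∀ t < b, V t = u t := fun t ht => if_pos ht
  have hVv : ∀ t, b ≤ t → V t = v t := fun t ht => if_neg (not_lt.2 ht)
  refine ⟨δ, hδ, V, hVu, fun t ht => ?_⟩
  have hleft : ∀ t ∈ Ico 0 b, HasDerivWithinAt V (h.field t (u t)) (Ici 0) t := fun t ht =>
    (hu t ht).congr_of_eventuallyEq
      (mem_nhdsWithin_of_mem_nhds ((eventually_lt_nhds ht.2).mono hVu)) (hVu t ht.2)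
  rcases lt_trichotomy t b with htb | htb | htb
  · rw [hVu t htb]
    exact (hleft t ⟨ht.1, htb⟩).mono Icc_subset_Ici_self
  · subst htb
    have hVt : V t = v₀ := (hVv t le_rfl).trans hv0
    have hd : ∀ s ∈ Ioo 0 t, HasDerivAt V (h.field s (u s)) s := fun s hs =>
      (hleft s (Ioo_subset_Ico_self hs)).hasDerivAt (Ici_mem_nhds hs.1)
    have hl : HasDerivWithinAt V (h.field t v₀) (Iic t) t := by
      refine hasDerivWithinAt_Iic_of_tendsto_deriv (s := Ioo 0 t)
        (fun s hs => (hd s hs).differentiableAt.differentiableWithinAt) ?_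
        (Ioo_mem_nhdsLT hb) ?_
      · rw [ContinuousWithinAt, hVt, nhdsWithin_Ioo_eq_nhdsLT hb]
        exact hlim.congr' (eventually_mem_nhdsWithin.mono fun s hs => (hVu s hs).symm)
      · have hτ : Tendsto (fun s : ℝ => s) (𝓝[<] t) (𝓝[Ici 0] t) := by
          refine tendsto_nhdsWithin_iff.2 ⟨tendsto_id.mono_left nhdsWithin_le_nhds, ?_⟩
          exact (eventually_of_mem (Ioo_mem_nhdsLT hb)) fun s hs => hs.1.le
        refine (h.tendsto_field hb.le hτ hlim).congr' ?_
        filter_upwards [Ioo_mem_nhdsLT hb] with s hs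
        exact (hd s hs).deriv.symm
    have hr : HasDerivWithinAt V (h.field t v₀) (Icc t (t + δ)) t := by
      have := hv t ⟨le_rfl, by linarith⟩
      rw [hv0] at this
      exact this.congr (fun s hs => hVv s hs.1) (hVv t le_rfl)
    rw [hVt]
    refine (hl.union hr).mono fun s hs => ?_
    rcases le_total s t with h1 | h1
    · exact Or.inl h1
    · exact Or.inr ⟨h1, hs.2⟩
  · have hr := hv t ⟨htb.le, ht.2⟩
    rw [hVv t htb.le]
    have : HasDerivWithinAt V (h.field t (v t)) (Icc b (b + δ)) t :=
      hr.congr (fun s hs => hVv s hs.1) (hVv t htb.le)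
    refine this.mono_of_mem_nhdsWithin ?_
    filter_upwards [self_mem_nhdsWithin, mem_nhdsWithin_of_mem_nhds (Ioi_mem_nhds htb)]
      with s hs1 hs2
    exact ⟨le_of_lt hs2, hs1.2⟩

end Admissible

end PseudoParabolic

namespace PseudoParabolic

variable {n : ℕ} {Ω : Set (E n)} {p : E n → ℝ → ℝ} {k : ℝ → ℝ} {kInf : ℝ}

namespace Admissible

variable {h : Admissible Ω p k kInf} {u v : ℝ → H10 Ω} {T T' b : ℝ}

/-! ### The maximal existence time -/

theorem IsODESol.congr (hu : h.IsODESol T u) (hT : T' ≤ T) (hv : ∀ t ∈ Icc 0 T', v t = u t) :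
    h.IsODESol T' v := fun t ht => by
  rw [hv t ht]
  exact ((hu t ⟨ht.1, ht.2.trans hT⟩).mono (Icc_subset_Icc_right hT)).congr hv (hv t ht)

theorem isODESolIco_of_forall (hu : ∀ T, 0 < T → T < b → h.IsODESol T u) :
    h.IsODESolIco b u := by
  intro t ht
  obtain ⟨c, htc, hcb⟩ := exists_between ht.2
  refine (hu c (ht.1.trans_lt htc) hcb t ⟨ht.1, htc.le⟩).mono_of_mem_nhdsWithin ?_
  rw [← Ici_inter_Iic]
  exact inter_mem self_mem_nhdsWithin (mem_nhdsWithin_of_mem_nhds (Iic_mem_nhds htc))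

/-- Two solutions that agree before time `T` agree at time `T`. -/
theorem IsODESol.eq_of_eqOn_Ico (hT : 0 < T) (hu : h.IsODESol T u) (hTT' : T ≤ T')
    (hv : h.IsODESol T' v) (heq : ∀ t ∈ Ico 0 T, v t = u t) : v T = u T := by
  have hmono : 𝓝[Ico 0 T] T ≤ 𝓝[Icc 0 T] T := nhdsWithin_mono T Ico_subset_Icc_self
  have hTI : T ∈ Icc 0 T := ⟨hT.le, le_rfl⟩
  have h1 : Tendsto u (𝓝[Ico 0 T] T) (𝓝 (u T)) :=
    (hu T hTI).continuousWithinAt.tendsto.mono_left hmono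
  have h2 : Tendsto v (𝓝[Ico 0 T] T) (𝓝 (v T)) :=
    ((hv T ⟨hT.le, hTT'⟩).continuousWithinAt.mono
      (Icc_subset_Icc_right hTT')).tendsto.mono_left hmono
  have : (𝓝[Ico 0 T] T).NeBot := by
    rw [nhdsWithin_Ico_eq_nhdsLT hT]
    infer_instance
  exact tendsto_nhds_unique h2 (h1.congr' (eventually_mem_nhdsWithin.mono fun t ht =>
    (heq t ht).symm))

variable (h) in
/-- A continuation `(S, U)` of the solution `u` on `[0,T]`: the function `U` is a solution on every
interval `[0,T']` with `T' < S`, and it agrees with `u` on `[0,T]`. -/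
structure IsContinuation (T : ℝ) (u : ℝ → H10 Ω) (q : ℝ≥0∞ × (ℝ → H10 Ω)) : Prop where
  le : ENNReal.ofReal T ≤ q.1
  eqOn : ∀ t ∈ Icc 0 T, q.2 t = u t
  isODESol : ∀ T', 0 < T' → ENNReal.ofReal T' < q.1 → h.IsODESol T' q.2

/-- A continuation that is not the restriction of one on a longer interval exists by Zorn's lemma;
the order is that of extension of solutions. -/
theorem exists_maximal_continuation (hu : h.IsODESol T u) : ∃ q, h.IsContinuation T u q ∧
    ∀ q', h.IsContinuation T u q' → q.1 ≤ q'.1 →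
      (∀ t, 0 ≤ t → ENNReal.ofReal t < q.1 → q'.2 t = q.2 t) → q'.1 ≤ q.1 := by
  let r : {q // h.IsContinuation T u q} → {q // h.IsContinuation T u q} → Prop := fun q q' =>
    q.1.1 ≤ q'.1.1 ∧ ∀ t, 0 ≤ t → ENNReal.ofReal t < q.1.1 → q'.1.2 t = q.1.2 t
  have hr : ∃ m, ∀ q, r m q → r q m := by
    refine exists_maximal_of_chains_bounded (fun c hc => ?_) fun {q₁ q₂ q₃} h₁ h₂ =>
      ⟨h₁.1.trans h₂.1, fun t ht0 ht => (h₂.2 t ht0 (ht.trans_le h₁.1)).trans (h₁.2 t ht0 ht)⟩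
    have hcomp : ∀ q ∈ c, ∀ q' ∈ c, ∀ t, 0 ≤ t → ENNReal.ofReal t < q.1.1 →
        ENNReal.ofReal t < q'.1.1 → q.1.2 t = q'.1.2 t := by
      intro q hq q' hq' t ht0 ht ht'
      by_cases hqq : q = q'
      · rw [hqq]
      · rcases hc hq hq' hqq with h1 | h1
        · exact (h1.2 t ht0 ht).symm
        · exact h1.2 t ht0 ht'
    classical
    let U : ℝ → H10 Ω := fun t =>
      if ht : ∃ q ∈ c, ENNReal.ofReal t < q.1.1 then ht.choose.1.2 t else u t
    have hU : ∀ q ∈ c, ∀ t, 0 ≤ t → ENNReal.ofReal t < q.1.1 → U t = q.1.2 t := by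
      intro q hq t ht0 ht
      have hex : ∃ q ∈ c, ENNReal.ofReal t < q.1.1 := ⟨q, hq, ht⟩
      have : U t = hex.choose.1.2 t := dif_pos hex
      rw [this]
      exact hcomp _ hex.choose_spec.1 q hq t ht0 hex.choose_spec.2 ht
    have hUu : ∀ t ∈ Icc 0 T, U t = u t := by
      intro t ht
      by_cases hex : ∃ q ∈ c, ENNReal.ofReal t < q.1.1
      · obtain ⟨q, hq, hqt⟩ := hex
        rw [hU q hq t ht.1 hqt, q.2.eqOn t ht]
      · exact dif_neg hex
    refine ⟨⟨(ENNReal.ofReal T ⊔ ⨆ q ∈ c, q.1.1, U), le_sup_left, hUu, fun T' hT' hlt => ?_⟩,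
      fun q hq => ⟨le_sup_of_le_right (le_iSup₂_of_le q hq le_rfl), fun t => hU q hq t⟩⟩
    rcases lt_sup_iff.1 hlt with h1 | h1
    · have hTT : T' ≤ T := (ENNReal.ofReal_lt_ofReal_iff_of_nonneg hT'.le).1 h1 |>.le
      exact hu.congr hTT fun t ht => hUu t ⟨ht.1, ht.2.trans hTT⟩
    · obtain ⟨q, hq⟩ := lt_iSup_iff.1 h1
      obtain ⟨hqc, hq⟩ := lt_iSup_iff.1 hq
      exact (q.2.isODESol T' hT' hq).congr le_rfl fun t ht =>
        hU q hqc t ht.1 ((ENNReal.ofReal_le_ofReal ht.2).trans_lt hq)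
  obtain ⟨m, hm⟩ := hr
  exact ⟨m.1, m.2, fun q' hq' h1 h2 => (hm ⟨q', hq'⟩ ⟨h1, h2⟩).1⟩

theorem exists_isMaximalExistenceTime (h : Admissible Ω p k kInf) {u₀ : H10 Ω} (hT : 0 < T)
    (hu : IsWeakSolution p k u₀ T u) : ∃ (Tmax : ℝ≥0∞) (U : ℝ → H10 Ω),
      (∀ t ∈ Icc 0 T, U t = u t) ∧ IsMaximalExistenceTime p k u₀ U Tmax := by
  have hode := h.isODESol_of_isWeakSolution hT hu
  obtain ⟨⟨S, U⟩, hq, hmax⟩ := exists_maximal_continuation hode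
  have hTS : ENNReal.ofReal T ≤ S := hq.le
  refine ⟨S, U, hq.eqOn, (ENNReal.ofReal_pos.2 hT).trans_le hTS, fun T' hT' hlt => ?_,
    fun T' v hlt hv heq => ?_⟩
  · refine h.isWeakSolution_of_isODESol hT' ?_ (hq.isODESol T' hT' hlt)
    exact (hq.eqOn 0 ⟨le_rfl, hT.le⟩).trans hu.initial
  · have hTT' : T < T' := (ENNReal.ofReal_lt_ofReal_iff_of_nonneg hT.le).1 (hTS.trans_lt hlt)
    have hvode := h.isODESol_of_isWeakSolution (hT.trans hTT') hv
    have hvu : ∀ t ∈ Ico 0 T, v t = u t := fun t ht =>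
      (heq t ht.1 (((ENNReal.ofReal_lt_ofReal_iff hT).2 ht.2).trans_le hTS)).trans
        (hq.eqOn t (Ico_subset_Icc_self ht))
    refine absurd hlt (not_lt.2 (hmax (ENNReal.ofReal T', v) ⟨hTS.trans hlt.le, fun t ht => ?_,
      fun T'' hT'' hlt'' => ?_⟩ hlt.le heq))
    · rcases ht.2.lt_or_eq with h1 | h1
      · exact hvu t ⟨ht.1, h1⟩
      · rw [h1]
        exact hode.eq_of_eqOn_Ico hT hTT'.le hvode hvu
    · exact hvode.congr ((ENNReal.ofReal_lt_ofReal_iff_of_nonneg hT''.le).1 hlt'').le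
        fun t _ => rfl

/-! ### Blow-up -/

theorem blowsUp_of_isMaximalExistenceTime (h : Admissible Ω p k kInf) {u₀ : H10 Ω}
    (hE : energyE p k kInf u₀ 0 < 0) {Tmax : ℝ≥0∞} {U : ℝ → H10 Ω}
    (hU : IsMaximalExistenceTime p k u₀ U Tmax) :
    Tmax < ⊤ ∧ BlowsUpAt U Tmax.toReal ∧
      Tmax.toReal ≤ ((hardyNormSq u₀).toReal + gradNormSq u₀) /
        (pMinus Ω p * (2 - pMinus Ω p) * energyE p k kInf u₀ 0) := by
  obtain ⟨hpos, hsol, hmax⟩ := hU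
  set R := ((hardyNormSq u₀).toReal + gradNormSq u₀) /
    (pMinus Ω p * (2 - pMinus Ω p) * energyE p k kInf u₀ 0) with hR
  have hU0 : U 0 = u₀ := by
    obtain ⟨c, hc0, hc⟩ := ENNReal.lt_iff_exists_nnreal_btwn.1 hpos
    refine (hsol c (by exact_mod_cast hc0) ?_).initial
    rwa [ENNReal.ofReal_coe_nnreal]
  have hE' : energyE p k kInf (U 0) 0 < 0 := by rwa [hU0]
  have hIco : ∀ b : ℝ, ENNReal.ofReal b ≤ Tmax → h.IsODESolIco b U := fun b hb =>
    isODESolIco_of_forall fun T hT hTb => h.isODESol_of_isWeakSolution hT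
      (hsol T hT (((ENNReal.ofReal_lt_ofReal_iff_of_nonneg hT.le).2 hTb).trans_le hb))
  have hbound : ∀ b : ℝ, ENNReal.ofReal b ≤ Tmax → ∀ t ∈ Ico 0 b, t ≤ R := by
    intro b hb t ht
    have := (hIco b hb).time_bound hE' ht
    rwa [hU0, norm_energyEmb_sq, ← toReal_hardyNormSq, ← gradNormSq_eq] at this
  have htop : Tmax < ⊤ := by
    rw [lt_top_iff_ne_top]
    intro hcon
    have := hbound (|R| + 2) (by rw [hcon]; exact le_top) (|R| + 1)
      ⟨by positivity, by linarith⟩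
    linarith [le_abs_self R]
  set b := Tmax.toReal with hb
  have hbT : ENNReal.ofReal b = Tmax := ENNReal.ofReal_toReal htop.ne
  have hb0 : 0 < b := ENNReal.toReal_pos hpos.ne' htop.ne
  refine ⟨htop, ?_, ?_⟩
  · by_contra hcon
    obtain ⟨M, hM, hMtop⟩ := exists_between (lt_top_iff_ne_top.2 hcon)
    obtain ⟨l, hl, hlM⟩ := mem_nhdsLT_iff_exists_Ioo_subset.1 (eventually_lt_of_limsup_lt hM)
    obtain ⟨a, ha, hab⟩ := exists_between (max_lt (mem_Iio.1 hl) hb0)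
    have ha0 : a ∈ Ico 0 b := ⟨(le_max_right _ _).trans ha.le, hab⟩
    have hode := hIco b hbT.le
    obtain ⟨B, hB⟩ := hode.exists_normSq_le hE' (M := M.toReal) ha0 fun t ht => by
      have h1 : hardyNormSq (U t) < M :=
        hlM ⟨((le_max_left _ _).trans_lt ha).trans_le ht.1, ht.2⟩
      rw [← toReal_hardyNormSq]
      exact ENNReal.toReal_mono hMtop.ne h1.le
    obtain ⟨v₀, hv₀⟩ := hode.exists_tendsto ha0 hB
    obtain ⟨δ, hδ, V, hVU, hV⟩ := hode.exists_extension hb0 hv₀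
    refine hmax (b + δ) V ?_ (h.isWeakSolution_of_isODESol (by linarith)
      ((hVU 0 hb0).trans hU0) hV) fun t ht0 ht => hVU t ?_
    · rw [← hbT]
      exact (ENNReal.ofReal_lt_ofReal_iff (by linarith)).2 (by linarith)
    · rw [← hbT] at ht
      exact (ENNReal.ofReal_lt_ofReal_iff hb0).1 ht
  · by_contra hcon
    obtain ⟨t, ht1, ht2⟩ := exists_between (max_lt (not_le.1 hcon) hb0)
    exact absurd (hbound b hbT.le t ⟨(le_max_right _ _).trans ht1.le, ht2⟩)
      (not_le.2 ((le_max_left _ _).trans_lt ht1))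

end Admissible

end PseudoParabolic

open PseudoParabolic in
theorem theorem1p3 (n : ℕ) (hn : 3 ≤ n) (Ω : Set (E n)) (hΩ_open : IsOpen Ω)
    (hΩ_bdd : Bornology.IsBounded Ω) (hΩ_lip : HasLipschitzBoundary Ω)
    (p : E n → ℝ → ℝ) (hp : IsAdmissibleExponent Ω p)
    (k : ℝ → ℝ) (kInf : ℝ) (hk : IsAdmissibleCoefficient k kInf)
    (u₀ : H10 Ω) (hE : energyE p k kInf u₀ 0 < 0)
    (T : ℝ) (hT : 0 < T) (u : ℝ → H10 Ω) (hu : IsWeakSolution p k u₀ T u) :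
    (∃ (Tmax : ℝ≥0∞) (U : ℝ → H10 Ω),
      (∀ t ∈ Set.Icc 0 T, U t = u t) ∧ IsMaximalExistenceTime p k u₀ U Tmax) ∧
    ∀ (Tmax : ℝ≥0∞) (U : ℝ → H10 Ω),
      (∀ t ∈ Set.Icc 0 T, U t = u t) → IsMaximalExistenceTime p k u₀ U Tmax →
        Tmax < ⊤ ∧ BlowsUpAt U Tmax.toReal ∧
          Tmax.toReal ≤ ((hardyNormSq u₀).toReal + gradNormSq u₀) /
            (pMinus Ω p * (2 - pMinus Ω p) * energyE p k kInf u₀ 0) := by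
  have h : Admissible Ω p k kInf := ⟨hn, hΩ_open, hΩ_bdd, hp, hk⟩
  exact ⟨h.exists_isMaximalExistenceTime hT hu,
    fun _ _ _ hU => h.blowsUp_of_isMaximalExistenceTime hE hU⟩
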